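/- Let $d\ge 2$. Let $\Phi$ be the set of functions $\varphi(k)=\int_{\mathbb R^d}e^{-ik\cdot v}f(dv)$, $f$ a Borel probability measure on $\mathbb R^d$. A kernel is a measurable $g:[-1,1]\to[0,\infty)$ with $\int_{S^{d-1}}g(\omega\cdot n)\,dn=1$ for all $\omega\in S^{d-1}$; put $q=\int_{S^{d-1}}g(\omega\cdot n)\,(1-(\omega\cdot n)^2)\,dn$ (independent of $\omega$) and $$\Gamma[\varphi](k)=\int_{S^{d-1}}g(\hat k\cdot n)\,\varphi(k_+)\varphi(k_-)\,dn,\qquad k_\pm=\tfrac12(k\pm|k|n),\quad \hat k=k/|k|,\qquad \Gamma[\varphi](0)=\varphi(0)^2 .$$ For a real $d\times d$ matrix $A$ let $\|A\|=\sup_{|k|=1}|Ak|$. For $\beta\in\mathbb R$ let $A_\beta=A+\beta I$ and $E_\beta(t)\psi(k)=e^{-t}\psi(e^{-tA_\beta}k)$. A solution with initial datum $\varphi_0\in\Phi$ is a family $\varphi(\cdot,t)\in\Phi$, $t\ge0$, continuous in $t$ for uniform convergence on compact sets of $k$, such that for all $t\ge 0$ and $k\in\mathbb R^d$ $$\varphi(k,t)=E_\beta(t)\varphi_0(k)+\int_0^tE_\beta(\tau)\,\Gamma[\varphi(\cdot,t-\tau)](k)\,d\tau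 ,$$ the mild form of $\partial_t\varphi+(A_\beta k)\cdot\partial_k\varphi+\varphi=\Gamma[\varphi]$. For a real symmetric matrix $B=(b_{jl})$ and $r>2$ let $\mathcal F_r(B)$ be the set of $\Psi\in\Phi$ with $\sup_{k\neq0}|k|^{-r}\big|\Psi(k)-(1-\frac12\sum_{j,l}b_{jl}k_jk_l)\big|<\infty$. Consider on complex symmetric matrices $B$ the eigenvalue problem $$2\beta B+\big(BA+(BA)^T\big)+\frac{qd}{2(d-1)}\Big(B-\frac{\operatorname{Tr}B}{d}I\Big)=0.\qquad(*)$$ **Theorem.** Let $p>2$. There is $\theta>0$ depending only on $q$, $p$, $d$, and for each kernel $g$ with this value of $q$ there is $\varepsilon_0>0$ (depending on $g$, $p$, $d$), such that the following holds. (a) If $\|A\|\le\varepsilon_0$, the eigenvalue $\beta$ of $(*)$ with the largest real part is real and simple (all other eigenvalues have strictly smaller real part); it has a unique real symmetric positive definite eigenvector $N$ with $\frac1d\operatorname{Tr}(N^TN)=1$; and there is a unique $\Psi\in\mathcal F_{\min(p,4)}(N)$ with $\Psi=\int_0^\infty E_\beta(\tau)\Gamma[\Psi]\,d\tau$. (b)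 Let $\varphi_0\in\Phi$ satisfy, for some $c_\alpha\in\mathbb C$ and $C_0>0$, $$\Big|\varphi_0(k)-\Big(1+\sum_{|\alpha|=2}c_\alpha k^\alpha\Big)\Big|\le C_0|k|^p,\qquad k\in\mathbb R^d .$$ Then there is $C>0$ (depending on $\varphi_0$, and on $g,p,d$, but not on $A$) such that for every $A$ with $\|A\|\le\varepsilon_0$, with $\beta$, $N$, $\Psi$ as in (a), there is $\lambda\ge0$ such that the solution $\varphi$ with initial datum $\varphi_0$ satisfies $$|\varphi(k,t)-\Psi(\lambda k)|\le C e^{-\theta t}\big(|k|^2+|k|^p\big),\qquad k\in\mathbb R^d,\ t\ge 0 .$$ -/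

import Mathlib

open MeasureTheory Set
open scoped RealInnerProductSpace

noncomputable section

namespace MaxwellFourier

/-- The velocity space and the Fourier space `ℝ^d`, with the Euclidean norm. -/
abbrev E (d : ℕ) : Type := EuclideanSpace ℝ (Fin d)

/-- The unit sphere `S^{d-1}`. -/
abbrev Sph (d : ℕ) : Type := Metric.sphere (0 : E d) 1

/-- The surface measure `dn` on `S^{d-1}`. -/
def surf (d : ℕ) : Measure (Sph d) := (volume : Measure (E d)).toSphere

/-- The Fourier transform `f̂(k) = ∫ e^{-i k·v} f(dv)` of a measure. -/
def fourierMeas {d : ℕ} (f : Measure (E d)) (k : E d) : ℂ :=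
  ∫ v, Complex.exp (-(Complex.I * ((⟪k, v⟫ : ℝ) : ℂ))) ∂f

/-- The set `Φ` of characteristic functions of Borel probability measures on `ℝ^d`. -/
def charFcts (d : ℕ) : Set (E d → ℂ) :=
  {φ | ∃ f : Measure (E d), IsProbabilityMeasure f ∧ ∀ k, φ k = fourierMeas f k}

/-- Collision kernels: only the values of `g` on `[-1,1]` are ever used. -/
structure IsKernel (d : ℕ) (g : ℝ → ℝ) : Prop where
  measurable : Measurable g
  nonneg : ∀ η ∈ Icc (-1 : ℝ) 1, 0 ≤ g η
  integrable : ∀ ω : Sph d, Integrable (fun n : Sph d => g ⟪(ω : E d), (n : E d)⟫) (surf d)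
  normalized : ∀ ω : Sph d, ∫ n : Sph d, g ⟪(ω : E d), (n : E d)⟫ ∂(surf d) = 1

/-- The vector `(1,0,…,0)`. -/
def e₁ (d : ℕ) : E d := WithLp.toLp 2 (fun i : Fin d => if (i : ℕ) = 0 then (1 : ℝ) else 0)

/-- `q = ∫ g(ω·n) (1 - (ω·n)²) dn`, which by rotation invariance does not depend on the unit
vector `ω`; here `ω = (1,0,…,0)`. -/
def kernelQ (d : ℕ) (g : ℝ → ℝ) : ℝ :=
  ∫ n : Sph d, g ⟪e₁ d, (n : E d)⟫ * (1 - ⟪e₁ d, (n : E d)⟫ ^ 2) ∂(surf d)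

/-- The gain operator
`Γ[φ](k) = ∫ g(k̂·n) φ(k₊) φ(k₋) dn`, `k_± = (k ± |k| n)/2`, `k̂ = k/|k|`;
at `k = 0`, where `k̂` is undefined, the value is the one obtained by continuity. -/
def Gain {d : ℕ} (g : ℝ → ℝ) (φ : E d → ℂ) (k : E d) : ℂ :=
  open Classical in
  if k = 0 then φ 0 * φ 0
  else ∫ n : Sph d, ((g ⟪‖k‖⁻¹ • k, (n : E d)⟫ : ℝ) : ℂ) *
    (φ ((1 / 2 : ℝ) • (k + ‖k‖ • (n : E d))) * φ ((1 / 2 : ℝ) • (k - ‖k‖ • (n : E d)))) ∂(surf d)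

/-- The linear map `k ↦ M k` of Euclidean space. Its norm is `sup_{|k| = 1} |M k|`. -/
def act {d : ℕ} (M : Matrix (Fin d) (Fin d) ℝ) : E d →L[ℝ] E d :=
  Matrix.toEuclideanCLM (n := Fin d) (𝕜 := ℝ) M

/-- `(E_β(t) ψ)(k) = e^{-t} ψ(e^{-t A_β} k)` with `A_β = A + β I`. -/
def Eop {d : ℕ} (A : Matrix (Fin d) (Fin d) ℝ) (β t : ℝ) (ψ : E d → ℂ) (k : E d) : ℂ :=
  (Real.exp (-t) : ℂ) * ψ (NormedSpace.exp ((-t) • act (A + β • 1)) k)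

/-- Solutions of the rescaled Cauchy problem
`∂_t φ + (A_β k)·∂_k φ + φ = Γ[φ]`, `φ(·,0) = φ₀`, in mild form. The time-continuity asked for is
that of uniform convergence on compact sets of `k` (joint continuity in `(t,k)`). -/
structure IsMildSolution {d : ℕ} (g : ℝ → ℝ) (A : Matrix (Fin d) (Fin d) ℝ) (β : ℝ)
    (φ₀ : E d → ℂ) (φ : ℝ → E d → ℂ) : Prop where
  mem : ∀ t, 0 ≤ t → φ t ∈ charFcts d
  cont : ContinuousOn (Function.uncurry φ) (Ici (0 : ℝ) ×ˢ univ)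
  eqn : ∀ t, 0 ≤ t → ∀ k, φ t k =
    Eop A β t φ₀ k + ∫ τ in (0 : ℝ)..t, Eop A β τ (Gain g (φ (t - τ))) k

/-- The stationary equation `Ψ = ∫_0^∞ E_β(τ) Γ[Ψ] dτ`. -/
def IsStationary {d : ℕ} (g : ℝ → ℝ) (A : Matrix (Fin d) (Fin d) ℝ) (β : ℝ)
    (Ψ : E d → ℂ) : Prop :=
  ∀ k, Ψ k = ∫ τ in Ioi (0 : ℝ), Eop A β τ (Gain g Ψ) k

/-- The class `𝓕_p(B)` of characteristic functions with
`Ψ(k) = 1 - ½ ∑ b_{jl} k_j k_l + O(|k|^p)`. -/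
def Fclass {d : ℕ} (p : ℝ) (B : Matrix (Fin d) (Fin d) ℝ) : Set (E d → ℂ) :=
  {Ψ | Ψ ∈ charFcts d ∧ ∃ K : ℝ, ∀ k : E d,
    ‖Ψ k - (1 - (1 / 2 : ℂ) * ∑ j, ∑ l, ((B j l * k j * k l : ℝ) : ℂ))‖ ≤ K * ‖k‖ ^ p}

/-- The complex symmetric `d × d` matrices. -/
def symmMat (d : ℕ) : Submodule ℂ (Matrix (Fin d) (Fin d) ℂ) where
  carrier := {B | B.IsSymm}
  add_mem' := fun ha hb => Matrix.IsSymm.add ha hb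
  zero_mem' := Matrix.isSymm_zero
  smul_mem' := fun c _ hx => Matrix.IsSymm.smul hx c

/-- The left-hand side, without the term `2 β B`, of the second-moment eigenvalue problem
`2 β B + (B A + (B A)ᵀ) + q d / (2 (d - 1)) (B - (Tr B / d) I) = 0`. -/
def momentForm {d : ℕ} {R : Type} [Field R] (A : Matrix (Fin d) (Fin d) R) (q : R)
    (B : Matrix (Fin d) (Fin d) R) : Matrix (Fin d) (Fin d) R :=
  (B * A + (B * A).transpose) +
    (q * d / (2 * ((d : R) - 1))) • (B - (B.trace / d) • (1 : Matrix (Fin d) (Fin d) R))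

theorem momentForm_isSymm {d : ℕ} {R : Type} [Field R] (A : Matrix (Fin d) (Fin d) R) (q : R)
    {B : Matrix (Fin d) (Fin d) R} (hB : B.IsSymm) : (momentForm A q B).IsSymm := by
  have hB' : B.transpose = B := hB
  simp only [Matrix.IsSymm, momentForm, Matrix.transpose_add, Matrix.transpose_sub,
    Matrix.transpose_smul, Matrix.transpose_transpose, Matrix.transpose_one, hB']
  rw [add_comm (B * A).transpose]

/-- The operator `B ↦ -½ [(B A + (B A)ᵀ) + q d / (2 (d - 1)) (B - (Tr B / d) I)]` on complex
symmetric matrices, so that `β` and `B` solve the second-moment eigenvalue problem exactly when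
`momentOp A q B = β B`. -/
def momentOp {d : ℕ} (A : Matrix (Fin d) (Fin d) ℝ) (q : ℝ) : Module.End ℂ (symmMat d) where
  toFun B := (-(1 / 2) : ℂ) •
    ⟨momentForm (A.map ((↑) : ℝ → ℂ)) (q : ℂ) B.1, momentForm_isSymm _ _ B.2⟩
  map_add' B B' := by
    ext1
    simp only [momentForm, Submodule.coe_add, Submodule.coe_smul, Matrix.trace_add,
      Matrix.transpose_add, add_mul, add_div, add_smul]
    module
  map_smul' c B := by
    ext1
    simp only [momentForm, Submodule.coe_smul, Matrix.trace_smul,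
      Matrix.transpose_smul, Matrix.smul_mul, smul_eq_mul, mul_div_assoc, RingHom.id_apply]
    module

/-- `β` is the eigenvalue with the largest real part of the second-moment problem; it is real
and (algebraically) simple, and every other eigenvalue has a strictly smaller real part. -/
structure IsLeadingEigenvalue {d : ℕ} (A : Matrix (Fin d) (Fin d) ℝ) (q β : ℝ) : Prop where
  eigen : (momentOp A q).HasEigenvalue (β : ℂ)
  simple : Module.finrank ℂ ((momentOp A q).maxGenEigenspace (β : ℂ)) = 1
  largest : ∀ μ : ℂ, (momentOp A q).HasEigenvalue μ → μ ≠ (β : ℂ) → μ.re < β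

/-- `β` is the leading eigenvalue of the second-moment problem, `N` is its real symmetric positive
definite eigenvector with `(1/d) Tr(Nᵀ N) = 1`, and `Ψ` is a solution of the stationary equation
in `𝓕_{p'}(N)`, where `p' = min(p,4)`. -/
structure IsProfile {d : ℕ} (g : ℝ → ℝ) (p : ℝ) (A : Matrix (Fin d) (Fin d) ℝ)
    (β : ℝ) (N : Matrix (Fin d) (Fin d) ℝ) (Ψ : E d → ℂ) : Prop where
  leading : IsLeadingEigenvalue A (kernelQ d g) β
  eigenvector : (2 * β) • N + momentForm A (kernelQ d g) N = 0
  posDef : N.PosDef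
  norm_eq : (1 / (d : ℝ)) * (N.transpose * N).trace = 1
  mem : Ψ ∈ Fclass (min p 4) N
  stationary : IsStationary g A β Ψ

end MaxwellFourier

end

/-!
Let `M` denote the operator `B ↦ -½ [(B A + (B A)ᵀ) + (q d / (2 (d - 1))) (B - (Tr B / d) I)]` on
real symmetric matrices (`realMoment`), so that the second moment `B` of a solution evolves by
`B' = 2 (M - β) B`, and the eigenvalue problem reads `M B = β B`.

**Spectrum.** For `A = 0` the operator `M` is `-c (1 - P)` with `c = q d / (4 (d - 1)) > 0`, where
`P` is the Frobenius-orthogonal projection on the multiples of the identity. For small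
`A` a fixed point argument gives an eigenvector of `M` and one of its adjoint, both close to the
identity, with a common eigenvalue `β` close to `0`; on the complement of the left eigenvector the
quadratic form of `M` stays negative (`exists_spectralData`). Simplicity and maximality of `β` among
the complex eigenvalues follow from this coercivity alone (`SpectralData.isLeadingEigenvalue`).

**Contraction.** The gain operator maps `Φ` to itself (Bobylev's identity, `Gain_mem_charFcts`). If
`|φ - ψ| ≤ a |k|^r` with `2 ≤ r ≤ 4`, then `|Γ[φ] - Γ[ψ]| ≤ (1 - (r - 2) q / 4) a |k|^r`: with
`x = |k₊|² / |k|²` the factor is the mean of `x^(r/2) + (1 - x)^(r/2)`, and this is at most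
`1 - (r - 2) x (1 - x)` by Bernoulli's inequality, while `x (1 - x) = (1 - (k̂·n)²) / 4`. The
estimate persists when a quadratic form is subtracted from `φ - ψ`, with `Γ` linearised on quadratic
forms by `gainMoment` and a cross term in the error (`norm_Gain_sub_le`). Hence `φ ↦ ∫ E_β Γ[φ]` is
a contraction for the distance `sup |φ - ψ| / |k|^r`, `2 < r ≤ 4`. Its iteration, started at the
Gaussian with second moment `N`, converges to the profile `Ψ`; the limit is a characteristic
function by Lévy's continuity theorem (`exists_isStationary`).

**Convergence.** Let `B₀` be the second moment of `φ₀`, and choose `λ` so that `B₀ - λ² N` has no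
component along the leading eigenvector. Then the matrix curve `D` with `D(0) = B₀ - λ² N` and
`D' = 2 (M - β) D` decays exponentially, and the function `φ(k, t) - Ψ(λ k) + ½ ∑ D(t)_{jl} k_j k_l`
is `O(|k|^r)` at `t = 0`. By the mild equation and the estimate for `Γ` it stays bounded by a
multiple of `e^{-θ t} |k|^r` (`IsMildSolution.norm_sub_le`), and the quadratic form itself is
`O(e^{-θ t} |k|²)`.
-/

noncomputable section

namespace MaxwellFourier

variable {d : ℕ}

/-! ### Rotation invariance of averages over the sphere -/

/-- The action of a linear isometry on the unit sphere. -/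
def sphMap (R : E d ≃ₗᵢ[ℝ] E d) (n : Sph d) : Sph d := ⟨R n, by simp⟩

@[simp] lemma coe_sphMap (R : E d ≃ₗᵢ[ℝ] E d) (n : Sph d) : (sphMap R n : E d) = R n := rfl

lemma continuous_sphMap (R : E d ≃ₗᵢ[ℝ] E d) : Continuous (sphMap R) :=
  Continuous.subtype_mk (R.continuous.comp continuous_subtype_val) _

instance : IsFiniteMeasure (surf d) := by unfold surf; infer_instance

open scoped Pointwise in
lemma measurePreserving_sphMap (R : E d ≃ₗᵢ[ℝ] E d) :
    MeasurePreserving (sphMap R) (surf d) (surf d) := by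
  have hm := (continuous_sphMap R).measurable
  refine ⟨hm, ?_⟩
  ext s hs
  rw [Measure.map_apply hm hs, surf, Measure.toSphere_apply' _ hs,
    Measure.toSphere_apply' _ (hm hs)]
  congr 1
  have h : Ioo (0 : ℝ) 1 • ((↑) '' (sphMap R ⁻¹' s) : Set (E d))
      = R ⁻¹' (Ioo (0 : ℝ) 1 • ((↑) '' s : Set (E d))) := by
    ext x
    simp only [mem_smul, mem_image, mem_preimage]
    constructor
    · rintro ⟨r, hr, _, ⟨n, hn, rfl⟩, rfl⟩
      exact ⟨r, hr, _, ⟨_, hn, rfl⟩, by simp⟩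
    · rintro ⟨r, hr, _, ⟨n, hn, rfl⟩, hx⟩
      have hn' : sphMap R (sphMap R.symm n) = n := by ext1; simp
      refine ⟨r, hr, _, ⟨sphMap R.symm n, by rw [hn']; exact hn, rfl⟩, ?_⟩
      apply R.injective
      rw [← hx]; simp
  rw [h]
  exact R.measurePreserving.measure_preimage_equiv (f := R.toMeasurableEquiv) _

lemma integral_comp_sphMap {X : Type*} [NormedAddCommGroup X] [NormedSpace ℝ X]
    (R : E d ≃ₗᵢ[ℝ] E d) (f : Sph d → X) :
    ∫ n, f (sphMap R n) ∂(surf d) = ∫ n, f n ∂(surf d) := by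
  refine (measurePreserving_sphMap R).integral_comp
    ((continuous_sphMap R).measurableEmbedding fun a b hab => ?_) f
  ext1
  exact R.injective (congrArg Subtype.val hab)

/-- Rotating the axis of a kernel average. -/
lemma integral_kernel_rotate {X : Type*} [NormedAddCommGroup X] [NormedSpace ℝ X] (g : ℝ → ℝ)
    (R : E d ≃ₗᵢ[ℝ] E d) (ω : E d) (f : E d → X) :
    ∫ n : Sph d, g ⟪R ω, (n : E d)⟫ • f n ∂(surf d)
      = ∫ n : Sph d, g ⟪ω, (n : E d)⟫ • f (R n) ∂(surf d) := by
  rw [← integral_comp_sphMap R]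
  simp

/-- The reflection exchanging two vectors of equal length. -/
lemma exists_swap {u v : E d} (h : ‖u‖ = ‖v‖) :
    ∃ R : E d ≃ₗᵢ[ℝ] E d, R u = v ∧ (∀ x, R (R x) = x) ∧
      ∀ w : E d, ⟪w, u⟫ = ⟪w, v⟫ → R w = w := by
  refine ⟨Submodule.reflection (Submodule.span ℝ {u - v})ᗮ, Submodule.reflection_sub h,
    Submodule.reflection_reflection _, ?_⟩
  intro w hw
  apply Submodule.reflection_mem_subspace_eq_self
  rw [Submodule.mem_orthogonal_singleton_iff_inner_left, inner_sub_right, hw, sub_self]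

lemma norm_coe_sph (ω : Sph d) : ‖(ω : E d)‖ = 1 := by simp

lemma inner_mem_Icc (ω n : Sph d) : ⟪(ω : E d), (n : E d)⟫ ∈ Icc (-1 : ℝ) 1 := by
  have := abs_real_inner_le_norm (ω : E d) (n : E d)
  simp only [norm_coe_sph, mul_one] at this
  exact abs_le.1 this

lemma IsKernel.nonneg' {g : ℝ → ℝ} (hg : IsKernel d g) (ω n : Sph d) :
    0 ≤ g ⟪(ω : E d), (n : E d)⟫ := hg.nonneg _ (inner_mem_Icc ω n)

/-- Continuous functions on the sphere are integrable against the kernel. -/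
lemma IsKernel.integrable_mul {g : ℝ → ℝ} (hg : IsKernel d g) (ω : Sph d) {f : Sph d → ℝ}
    (hf : Continuous f) : Integrable (fun n : Sph d => g ⟪(ω : E d), (n : E d)⟫ * f n) (surf d) := by
  obtain ⟨C, hC⟩ := isCompact_univ.exists_bound_of_continuousOn (f := f) hf.continuousOn
  exact (hg.integrable ω).mul_bdd (c := C) hf.aestronglyMeasurable
    (Filter.Eventually.of_forall fun n => hC n (mem_univ n))

lemma IsKernel.integrable_smul {g : ℝ → ℝ} (hg : IsKernel d g) (ω : Sph d) {f : Sph d → ℂ}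
    (hf : Continuous f) : Integrable (fun n : Sph d => g ⟪(ω : E d), (n : E d)⟫ • f n) (surf d) := by
  obtain ⟨C, hC⟩ := isCompact_univ.exists_bound_of_continuousOn (f := f) hf.continuousOn
  refine (hg.integrable ω).smul_bdd C hf.aestronglyMeasurable
    (Filter.Eventually.of_forall fun n => hC n (mem_univ n))

/-- The first basis vector as a point of the sphere. -/
def e₁Sph (hd : 2 ≤ d) : Sph d := ⟨e₁ d, by
  have h : e₁ d = EuclideanSpace.single (⟨0, by omega⟩ : Fin d) (1 : ℝ) := by
    ext i
    simp only [e₁, PiLp.single_apply, Fin.ext_iff]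
  simp [h]⟩

lemma kernelQ_eq (hd : 2 ≤ d) (g : ℝ → ℝ) (ω : Sph d) :
    ∫ n : Sph d, g ⟪(ω : E d), (n : E d)⟫ * (1 - ⟪(ω : E d), (n : E d)⟫ ^ 2) ∂(surf d)
      = kernelQ d g := by
  obtain ⟨R, hR, -⟩ := exists_swap (u := (ω : E d)) (v := e₁Sph hd) (by simp)
  have := integral_kernel_rotate g R ω (fun n => 1 - ⟪R ω, n⟫ ^ 2)
  simp only [LinearIsometryEquiv.inner_map_map, smul_eq_mul] at this
  rw [← this, hR]
  rfl

lemma integral_kernel_sq_self (hd : 2 ≤ d) {g : ℝ → ℝ} (hg : IsKernel d g) (ω : Sph d) :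
    ∫ n : Sph d, g ⟪(ω : E d), (n : E d)⟫ * ⟪(ω : E d), (n : E d)⟫ ^ 2 ∂(surf d)
      = 1 - kernelQ d g := by
  have h := integral_sub (hg.integrable ω)
    (hg.integrable_mul ω (f := fun n => ⟪(ω : E d), (n : E d)⟫ ^ 2) (by fun_prop))
  rw [hg.normalized ω] at h
  have h2 := kernelQ_eq hd g ω
  simp only [mul_sub, mul_one] at h2
  linarith

open scoped Pointwise in
/-- The mass of a kernel cannot sit on the two poles, which form a null set when `d ≥ 2`. -/
lemma kernelQ_pos (hd : 2 ≤ d) {g : ℝ → ℝ} (hg : IsKernel d g) : 0 < kernelQ d g := by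
  set ω := e₁Sph hd
  have h0 : 0 ≤ fun n : Sph d => g ⟪(ω : E d), (n : E d)⟫ * (1 - ⟪(ω : E d), (n : E d)⟫ ^ 2) := by
    intro n
    have := inner_mem_Icc ω n
    exact mul_nonneg (hg.nonneg' ω n) (by nlinarith [this.1, this.2])
  have hint := hg.integrable_mul ω (f := fun n => 1 - ⟪(ω : E d), (n : E d)⟫ ^ 2) (by fun_prop)
  rw [← kernelQ_eq hd g ω]
  refine lt_of_le_of_ne (integral_nonneg h0) fun h => ?_
  rw [eq_comm, integral_eq_zero_iff_of_nonneg h0 hint] at h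
  have hnull : surf d {n : Sph d | ⟪(ω : E d), (n : E d)⟫ ^ 2 = 1} = 0 := by
    have hms : MeasurableSet {n : Sph d | ⟪(ω : E d), (n : E d)⟫ ^ 2 = 1} :=
      (isClosed_eq (by fun_prop) continuous_const).measurableSet
    rw [surf, Measure.toSphere_apply' _ hms]
    have hsub : Ioo (0 : ℝ) 1 • ((↑) '' {n : Sph d | ⟪(ω : E d), (n : E d)⟫ ^ 2 = 1} : Set (E d))
        ⊆ (Submodule.span ℝ {(ω : E d)} : Submodule ℝ (E d)) := by
      rintro _ ⟨r, -, _, ⟨n, hn, rfl⟩, rfl⟩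
      refine Submodule.smul_mem _ r ?_
      have hn : ⟪(ω : E d), (n : E d)⟫ ^ 2 = 1 := hn
      have hz : (n : E d) = ⟪(ω : E d), (n : E d)⟫ • (ω : E d) := by
        rw [← sub_eq_zero, ← norm_eq_zero, ← sq_eq_zero_iff, norm_sub_sq_real, norm_smul,
          real_inner_smul_right, real_inner_comm (ω : E d) (n : E d), norm_coe_sph,
          norm_coe_sph, Real.norm_eq_abs,
          mul_one, sq_abs]
        linear_combination -hn
      rw [hz]
      exact Submodule.smul_mem _ _ (Submodule.mem_span_singleton_self _)
    have hne : (Submodule.span ℝ {(ω : E d)} : Submodule ℝ (E d)) ≠ ⊤ := by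
      intro htop
      have h1 := finrank_span_le_card (R := ℝ) ({(ω : E d)} : Set (E d))
      rw [htop, finrank_top] at h1
      simp at h1
      omega
    rw [measure_mono_null hsub (Measure.addHaar_submodule _ _ hne), mul_zero]
  have hg0 : ∀ᵐ n ∂(surf d), g ⟪(ω : E d), ((n : Sph d) : E d)⟫ = 0 := by
    have h2 : ∀ᵐ n ∂(surf d), ¬ (⟪(ω : E d), ((n : Sph d) : E d)⟫ ^ 2 = 1) := by
      rw [ae_iff]; simpa only [not_not] using hnull
    filter_upwards [h, h2] with n hn hn2
    have hn : g ⟪(ω : E d), (n : E d)⟫ * (1 - ⟪(ω : E d), (n : E d)⟫ ^ 2) = 0 := hn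
    rcases mul_eq_zero.1 hn with h3 | h3
    · exact h3
    · exact absurd (by linarith) hn2
  have := hg.normalized ω
  rw [integral_congr_ae hg0] at this
  simp at this

/-! ### Second moments of the kernel -/

/-- The quadratic form `∑ b_{jl} k_j k_l` of a matrix. -/
def qf (B : Matrix (Fin d) (Fin d) ℝ) (k : E d) : ℝ := ∑ j, ∑ l, B j l * k j * k l

/-- The second moments of the probability density `g(ω·n)` along `u`: it is a quadratic form in
`u` which is invariant under the isometries fixing `ω`. -/
lemma integral_kernel_inner_sq (hd : 2 ≤ d) {g : ℝ → ℝ} (hg : IsKernel d g) (ω : Sph d) :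
    ∃ b : ℝ, ∀ u : E d, ∫ n : Sph d, g ⟪(ω : E d), (n : E d)⟫ * ⟪u, (n : E d)⟫ ^ 2 ∂(surf d)
      = (1 - kernelQ d g) * ⟪u, (ω : E d)⟫ ^ 2 + b * (‖u‖ ^ 2 - ⟪u, (ω : E d)⟫ ^ 2) := by
  set Q : E d → ℝ := fun u => ∫ n : Sph d, g ⟪(ω : E d), (n : E d)⟫ * ⟪u, (n : E d)⟫ ^ 2 ∂(surf d)
    with hQ
  have hQs : ∀ (r : ℝ) (u : E d), Q (r • u) = r ^ 2 * Q u := by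
    intro r u
    simp only [hQ, real_inner_smul_left]
    rw [← integral_const_mul]
    congr 1; ext n; ring
  have hsame : ∃ b : ℝ, ∀ v : E d, ‖v‖ = 1 → ⟪(ω : E d), v⟫ = 0 → Q v = b := by
    by_cases hex : ∃ v₀ : E d, ‖v₀‖ = 1 ∧ ⟪(ω : E d), v₀⟫ = 0
    · obtain ⟨v₀, hv₀, hv₀'⟩ := hex
      refine ⟨Q v₀, fun v hv hv' => ?_⟩
      obtain ⟨R, h1, -, h2⟩ := exists_swap (u := v) (v := v₀) (by rw [hv, hv₀])
      have := integral_kernel_rotate g R ω (fun n => ⟪R v, n⟫ ^ 2)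
      rw [h2 ω (by rw [hv', hv₀'])] at this
      simp only [LinearIsometryEquiv.inner_map_map, smul_eq_mul] at this
      rw [h1] at this
      exact this.symm
    · exact ⟨0, fun v hv hv' => (hex ⟨v, hv, hv'⟩).elim⟩
  obtain ⟨b, hb⟩ := hsame
  refine ⟨b, fun u => ?_⟩
  change Q u = _
  set s := ⟪u, (ω : E d)⟫ with hs
  set w := u - s • (ω : E d) with hw
  have hωω : ⟪(ω : E d), (ω : E d)⟫ = 1 := by rw [real_inner_self_eq_norm_sq, norm_coe_sph]; norm_num
  have hwω : ⟪(ω : E d), w⟫ = 0 := by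
    rw [hw, inner_sub_right, real_inner_smul_right, hωω, real_inner_comm, hs]; ring
  have hwn : ‖w‖ ^ 2 = ‖u‖ ^ 2 - s ^ 2 := by
    rw [hw, norm_sub_sq_real, norm_smul, real_inner_smul_right, norm_coe_sph, Real.norm_eq_abs,
      mul_one, sq_abs, ← hs]
    ring
  have hQω : Q ω = 1 - kernelQ d g := integral_kernel_sq_self hd hg ω
  have hQw : Q w = b * ‖w‖ ^ 2 := by
    by_cases hw0 : w = 0
    · simp [hQ, hw0]
    · have hn : ‖w‖ ≠ 0 := norm_ne_zero_iff.2 hw0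
      have h1 : w = ‖w‖ • (‖w‖⁻¹ • w) := by rw [smul_smul, mul_inv_cancel₀ hn, one_smul]
      rw [h1, hQs, hb (‖w‖⁻¹ • w) (by rw [norm_smul, norm_inv, norm_norm, inv_mul_cancel₀ hn])
        (by rw [real_inner_smul_right, hwω, mul_zero]), ← h1]
      ring
  have hcross : ∫ n : Sph d, g ⟪(ω : E d), (n : E d)⟫ * (⟪(ω : E d), (n : E d)⟫ * ⟪w, (n : E d)⟫)
      ∂(surf d) = 0 := by
    obtain ⟨R, h1, -, h2⟩ := exists_swap (u := w) (v := -w) (by simp)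
    have hRω : R ω = ω := h2 ω (by rw [inner_neg_right, hwω, neg_zero])
    have := integral_kernel_rotate g R ω (fun n => ⟪(ω : E d), n⟫ * ⟪w, n⟫)
    have h3 : ∀ n, ⟪(ω : E d), R n⟫ = ⟪(ω : E d), n⟫ := fun n => by
      conv_lhs => rw [← hRω]
      exact R.inner_map_map _ _
    have h4 : ∀ n, ⟪w, R n⟫ = - ⟪w, n⟫ := fun n => by
      rw [← R.inner_map_map w n, h1, inner_neg_left, neg_neg]
    simp only [hRω, h3, h4, smul_eq_mul, mul_neg, integral_neg] at this
    linarith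
  have hu : ∀ n : E d, ⟪u, n⟫ = s * ⟪(ω : E d), n⟫ + ⟪w, n⟫ := fun n => by
    rw [hw, inner_sub_left, real_inner_smul_left]; ring
  have hexp : Q u = s ^ 2 * Q ω + 2 * s * (∫ n : Sph d, g ⟪(ω : E d), (n : E d)⟫ *
      (⟪(ω : E d), (n : E d)⟫ * ⟪w, (n : E d)⟫) ∂(surf d)) + Q w := by
    simp only [hQ]
    rw [← integral_const_mul, ← integral_const_mul, ← integral_add, ← integral_add]
    · congr 1; ext n; rw [hu]; ring
    · exact ((hg.integrable_mul ω (by fun_prop)).const_mul _).add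
        ((hg.integrable_mul ω (by fun_prop)).const_mul _)
    · exact hg.integrable_mul ω (by fun_prop)
    · exact (hg.integrable_mul ω (by fun_prop)).const_mul _
    · exact (hg.integrable_mul ω (by fun_prop)).const_mul _
  rw [hexp, hcross, hQω, hQw, hwn]
  ring

/-- The second-moment tensor of the density `g(ω·n)` is a combination of the identity and
`ω ⊗ ω`; the coefficients follow from its trace and its `(ω, ω)` entry. -/
lemma integral_kernel_qf (hd : 2 ≤ d) {g : ℝ → ℝ} (hg : IsKernel d g) (ω : Sph d)
    (B : Matrix (Fin d) (Fin d) ℝ) :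
    ∫ n : Sph d, g ⟪(ω : E d), (n : E d)⟫ * qf B n ∂(surf d)
      = kernelQ d g / (d - 1) * B.trace
        + (1 - kernelQ d g - kernelQ d g / (d - 1)) * qf B ω := by
  obtain ⟨b, hb⟩ := integral_kernel_inner_sq hd hg ω
  have hd1 : (d : ℝ) - 1 ≠ 0 := by
    have : (2 : ℝ) ≤ d := by exact_mod_cast hd
    linarith
  let ε : Fin d → E d := fun i => EuclideanSpace.single i (1 : ℝ)
  have hε : ∀ i (x : E d), ⟪ε i, x⟫ = x i := fun i x => by
    simp [ε, EuclideanSpace.inner_single_left]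
  have hεn : ∀ i, ‖ε i‖ = 1 := fun i => by simp [ε]
  have hsumsq : ∀ n : Sph d, ∑ i, ((n : E d) i) ^ 2 = 1 := fun n => by
    rw [← EuclideanSpace.real_norm_sq_eq, norm_coe_sph]; norm_num
  have hbval : b = kernelQ d g / (d - 1) := by
    have h1 : ∑ i, ∫ n : Sph d, g ⟪(ω : E d), (n : E d)⟫ * ⟪ε i, (n : E d)⟫ ^ 2 ∂(surf d) = 1 := by
      rw [← integral_finsetSum _ fun i _ => hg.integrable_mul ω (by fun_prop)]
      refine Eq.trans ?_ (hg.normalized ω)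
      congr 1; ext n
      rw [← Finset.mul_sum]
      simp only [hε, hsumsq, mul_one]
    simp only [hb] at h1
    simp only [hε, hεn] at h1
    rw [Finset.sum_add_distrib, ← Finset.mul_sum, ← Finset.mul_sum, Finset.sum_sub_distrib,
      hsumsq] at h1
    simp at h1
    field_simp
    linarith
  have hjl : ∀ j l, ∫ n : Sph d, g ⟪(ω : E d), (n : E d)⟫ * ((n : E d) j * (n : E d) l) ∂(surf d)
      = (1 - kernelQ d g - b) * ((ω : E d) j * (ω : E d) l) + b * ⟪ε j, ε l⟫ := by
    intro j l
    have h := hb (ε j + ε l)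
    have hj := hb (ε j)
    have hl := hb (ε l)
    have h2 : ∫ n : Sph d, g ⟪(ω : E d), (n : E d)⟫ * ⟪ε j + ε l, (n : E d)⟫ ^ 2 ∂(surf d)
        = (∫ n : Sph d, g ⟪(ω : E d), (n : E d)⟫ * ⟪ε j, (n : E d)⟫ ^ 2 ∂(surf d))
        + 2 * (∫ n : Sph d, g ⟪(ω : E d), (n : E d)⟫ * ((n : E d) j * (n : E d) l) ∂(surf d))
        + ∫ n : Sph d, g ⟪(ω : E d), (n : E d)⟫ * ⟪ε l, (n : E d)⟫ ^ 2 ∂(surf d) := by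
      rw [← integral_const_mul, ← integral_add, ← integral_add]
      · congr 1; ext n; rw [inner_add_left, hε, hε]; ring
      · exact (hg.integrable_mul ω (by fun_prop)).add
          ((hg.integrable_mul ω (by fun_prop)).const_mul _)
      · exact hg.integrable_mul ω (by fun_prop)
      · exact hg.integrable_mul ω (by fun_prop)
      · exact (hg.integrable_mul ω (by fun_prop)).const_mul _
    rw [h, hj, hl, norm_add_sq_real] at h2
    simp only [inner_add_left, hε j ω, hε l ω] at h2
    linarith
  have hexp : ∫ n : Sph d, g ⟪(ω : E d), (n : E d)⟫ * qf B n ∂(surf d)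
      = ∑ j, ∑ l, B j l * ∫ n : Sph d, g ⟪(ω : E d), (n : E d)⟫ * ((n : E d) j * (n : E d) l)
        ∂(surf d) := by
    have hi : ∀ j l, Integrable (fun n : Sph d => B j l * (g ⟪(ω : E d), (n : E d)⟫ *
        ((n : E d) j * (n : E d) l))) (surf d) := fun j l =>
      (hg.integrable_mul ω (by fun_prop)).const_mul _
    calc _ = ∫ n : Sph d, ∑ j, ∑ l, B j l * (g ⟪(ω : E d), (n : E d)⟫ *
          ((n : E d) j * (n : E d) l)) ∂(surf d) := by
          congr 1; ext n
          simp only [qf, Finset.mul_sum]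
          exact Finset.sum_congr rfl fun j _ => Finset.sum_congr rfl fun l _ => by ring
      _ = ∑ j, ∫ n : Sph d, ∑ l, B j l * (g ⟪(ω : E d), (n : E d)⟫ *
          ((n : E d) j * (n : E d) l)) ∂(surf d) :=
          integral_finsetSum _ fun j _ => integrable_finsetSum _ fun l _ => hi j l
      _ = _ := by
          refine Finset.sum_congr rfl fun j _ => ?_
          rw [integral_finsetSum _ fun l _ => hi j l]
          exact Finset.sum_congr rfl fun l _ => integral_const_mul _ _
  rw [hexp]
  simp only [hjl, hbval, qf, Matrix.trace, Matrix.diag]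
  have hδ : ∀ j l, ⟪ε j, ε l⟫ = if j = l then (1 : ℝ) else 0 := fun j l => by
    rw [hε]; simp [ε, PiLp.single_apply]
  simp only [hδ, mul_add, Finset.sum_add_distrib, Finset.mul_sum]
  rw [add_comm]
  congr 1
  · refine Finset.sum_congr rfl fun j _ => ?_
    rw [Finset.sum_eq_single j]
    · simp; ring
    · intro l _ hl; simp [hl.symm]
    · simp
  · refine Finset.sum_congr rfl fun j _ => Finset.sum_congr rfl fun l _ => by ring

/-! ### Characteristic functions -/

lemma fourierMeas_eq_charFun (f : Measure (E d)) (k : E d) :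
    fourierMeas f k = charFun f (-k) := by
  rw [fourierMeas, charFun_apply]
  congr 1; ext v
  rw [inner_neg_right, real_inner_comm]
  congr 1; push_cast; ring

lemma norm_le_one_of_mem {φ : E d → ℂ} (h : φ ∈ charFcts d) (k : E d) : ‖φ k‖ ≤ 1 := by
  obtain ⟨f, hf, h⟩ := h
  rw [h, fourierMeas_eq_charFun]
  exact norm_charFun_le_one _

lemma continuous_of_mem {φ : E d → ℂ} (h : φ ∈ charFcts d) : Continuous φ := by
  obtain ⟨f, hf, h⟩ := h
  have h' : φ = fun k => charFun f (-k) := funext fun k => by rw [h, fourierMeas_eq_charFun]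
  rw [h']
  fun_prop

lemma apply_neg_of_mem {φ : E d → ℂ} (h : φ ∈ charFcts d) (k : E d) :
    φ (-k) = (starRingEnd ℂ) (φ k) := by
  obtain ⟨f, hf, h⟩ := h
  rw [h, h, fourierMeas_eq_charFun, fourierMeas_eq_charFun, charFun_neg]

/-- The law of a random vector has its characteristic function in `Φ`. -/
lemma mem_charFcts_of_integral {Ω : Type*} [MeasurableSpace Ω] (P : Measure Ω)
    [IsProbabilityMeasure P] {X : Ω → E d} (hX : Measurable X) {φ : E d → ℂ}
    (h : ∀ k, φ k = ∫ x, Complex.exp (-(Complex.I * ((⟪k, X x⟫ : ℝ) : ℂ))) ∂P) :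
    φ ∈ charFcts d := by
  refine ⟨P.map X, Measure.isProbabilityMeasure_map hX.aemeasurable, fun k => ?_⟩
  rw [h, fourierMeas, integral_map hX.aemeasurable]
  exact Continuous.aestronglyMeasurable (by fun_prop)

lemma one_mem_charFcts : (fun _ => 1 : E d → ℂ) ∈ charFcts d :=
  mem_charFcts_of_integral (Measure.dirac (0 : E d)) measurable_id (fun k => by simp)

lemma comp_smul_mem_charFcts {φ : E d → ℂ} (h : φ ∈ charFcts d) (r : ℝ) :
    (fun k => φ (r • k)) ∈ charFcts d := by
  obtain ⟨f, hf, h⟩ := h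
  refine mem_charFcts_of_integral f (X := fun v => r • v) (by fun_prop) fun k => ?_
  simp only [h, fourierMeas, real_inner_smul_left, real_inner_smul_right]

/-- Lévy's theorem: a pointwise limit of characteristic functions that is continuous at the origin
is a characteristic function. -/
lemma mem_charFcts_of_tendsto {φ : ℕ → E d → ℂ} (h : ∀ n, φ n ∈ charFcts d) {ψ : E d → ℂ}
    (hψ : ContinuousAt ψ 0)
    (hlim : ∀ k, Filter.Tendsto (fun n => φ n k) Filter.atTop (nhds (ψ k))) :
    ψ ∈ charFcts d := by
  choose f hf hφ using h
  have hlim' : ∀ k, Filter.Tendsto (fun n => charFun (f n) k) Filter.atTop (nhds (ψ (-k))) := by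
    intro k
    have := hlim (-k)
    simpa only [hφ, fourierMeas_eq_charFun, neg_neg] using this
  have hψ' : ContinuousAt (fun k => ψ (-k)) 0 :=
    ContinuousAt.comp (f := fun k : E d => -k) (by simpa using hψ) continuous_neg.continuousAt
  have htight := isTightMeasureSet_of_tendsto_charFun hψ' hlim'
  let μ : ℕ → ProbabilityMeasure (E d) := fun n => ⟨f n, hf n⟩
  have hc : IsCompact (closure (range μ)) := by
    apply isCompact_closure_of_isTightMeasureSet
    have hset : {ν : Measure (E d) | ∃ ρ ∈ range μ, (ρ : Measure (E d)) = ν} = range f := by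
      apply Set.ext
      intro ν
      constructor
      · rintro ⟨_, ⟨n, rfl⟩, rfl⟩
        exact ⟨n, rfl⟩
      · rintro ⟨n, rfl⟩
        exact ⟨_, ⟨n, rfl⟩, rfl⟩
    exact hset ▸ htight
  obtain ⟨μ', -, hμ'⟩ := hc.ultrafilter_le_nhds
    ((Ultrafilter.of Filter.atTop).map μ)
    (by
      rw [Filter.le_principal_iff]
      exact Filter.mem_of_superset (Filter.range_mem_map (m := μ)) subset_closure)
  have hU : Filter.Tendsto μ (Ultrafilter.of (Filter.atTop (α := ℕ))) (nhds μ') := hμ'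
  rw [ProbabilityMeasure.tendsto_iff_forall_integral_rclike_tendsto ℂ] at hU
  refine ⟨μ', inferInstance, fun k => ?_⟩
  have h1 := hU (BoundedContinuousFunction.innerProbChar (-k))
  simp only [← charFun_eq_integral_innerProbChar] at h1
  have h2 := (hlim' (-k)).mono_left (Ultrafilter.of_le (f := Filter.atTop (α := ℕ)))
  rw [fourierMeas_eq_charFun, tendsto_nhds_unique h1 h2, neg_neg]

lemma qf_eq_dotProduct (B : Matrix (Fin d) (Fin d) ℝ) (k : E d) :
    qf B k = dotProduct k.ofLp (B.mulVec k.ofLp) := by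
  simp only [qf, dotProduct, Matrix.mulVec, Finset.mul_sum]
  exact Finset.sum_congr rfl fun j _ => Finset.sum_congr rfl fun l _ => by ring

lemma gaussian_mem_charFcts {N : Matrix (Fin d) (Fin d) ℝ} (hN : N.PosSemidef) :
    (fun k => ((Real.exp (-(qf N k / 2)) : ℝ) : ℂ)) ∈ charFcts d := by
  refine ⟨ProbabilityTheory.multivariateGaussian 0 N, inferInstance, fun k => ?_⟩
  rw [fourierMeas_eq_charFun, ProbabilityTheory.charFun_multivariateGaussian hN]
  simp [qf_eq_dotProduct, Matrix.mulVec_neg]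

/-! ### The gain operator on characteristic functions -/

/-- The direction `u/|u|` of a vector; at `u = 0` an arbitrary unit vector. -/
def dirV (u : E d) : E d :=
  open Classical in if u = 0 then e₁ d else ‖u‖⁻¹ • u

lemma measurable_dirV : Measurable (dirV (d := d)) := by
  classical
  unfold dirV
  exact Measurable.ite (measurableSet_singleton 0) measurable_const (by fun_prop)

lemma exists_dirV (hd : 2 ≤ d) (u : E d) : ∃ ω : Sph d, dirV u = ω ∧ u = ‖u‖ • (ω : E d) := by
  by_cases hu : u = 0
  · exact ⟨e₁Sph hd, by simp [dirV, hu, e₁Sph], by simp [hu]⟩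
  · have hn : ‖u‖ ≠ 0 := norm_ne_zero_iff.2 hu
    exact ⟨⟨‖u‖⁻¹ • u, by simp [norm_smul, hn]⟩, by simp [dirV, hu], by simp [smul_smul, hn]⟩

/-- The gain operator for any choice of the direction of `k`; this covers `k = 0`. -/
lemma Gain_eq {g : ℝ → ℝ} (hg : IsKernel d g) (φ : E d → ℂ) {k : E d} {ω : Sph d}
    (hk : k = ‖k‖ • (ω : E d)) :
    Gain g φ k = ∫ n : Sph d, g ⟪(ω : E d), (n : E d)⟫ •
      (φ ((1 / 2 : ℝ) • (k + ‖k‖ • (n : E d))) * φ ((1 / 2 : ℝ) • (k - ‖k‖ • (n : E d))))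
        ∂(surf d) := by
  by_cases h0 : k = 0
  · simp only [Gain, h0, if_true, norm_zero, zero_smul, add_zero, sub_zero, smul_zero]
    rw [integral_smul_const, hg.normalized, one_smul]
  · have hn : ‖k‖ ≠ 0 := norm_ne_zero_iff.2 h0
    have hω : ‖k‖⁻¹ • k = ω := by
      conv_lhs => rw [hk]
      simp [norm_smul, smul_smul, hn]
    simp only [Gain, h0, if_false, hω, Complex.real_smul]

lemma integral_kernel_swap {X : Type*} [NormedAddCommGroup X] [NormedSpace ℝ X] (g : ℝ → ℝ)
    (ω ω' : Sph d) (F : ℝ → X) :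
    ∫ n : Sph d, g ⟪(ω : E d), (n : E d)⟫ • F ⟪(ω' : E d), (n : E d)⟫ ∂(surf d)
      = ∫ n : Sph d, g ⟪(ω' : E d), (n : E d)⟫ • F ⟪(ω : E d), (n : E d)⟫ ∂(surf d) := by
  obtain ⟨R, h1, h2, -⟩ := exists_swap (u := (ω : E d)) (v := ω') (by simp)
  have := integral_kernel_rotate g R ω (fun n => F ⟪(ω : E d), n⟫)
  rw [h1] at this
  rw [this]
  congr 1; ext n
  rw [← R.inner_map_map (ω : E d) (R n), h2, h1]

lemma lintegral_kernel {g : ℝ → ℝ} (hg : IsKernel d g) (ω : Sph d) :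
    ∫⁻ n : Sph d, ENNReal.ofReal (g ⟪(ω : E d), (n : E d)⟫) ∂(surf d) = 1 := by
  rw [← ofReal_integral_eq_lintegral_ofReal (hg.integrable ω)
    (Filter.Eventually.of_forall fun n => hg.nonneg' ω n), hg.normalized, ENNReal.ofReal_one]

/-- Bobylev's identity: `Γ[φ]` is the characteristic function of the law of the post-collisional
velocity `(v + w)/2 + |v - w| n / 2`, where `v, w` are independent with characteristic function `φ`
and `n` has the density `g(û·n)`, `û` the direction of `v - w`. -/
lemma Gain_mem_charFcts (hd : 2 ≤ d) {g : ℝ → ℝ} (hg : IsKernel d g) {φ : E d → ℂ}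
    (hφ : φ ∈ charFcts d) : Gain g φ ∈ charFcts d := by
  obtain ⟨f, hf, hφ⟩ := hφ
  have hgm := hg.measurable
  have hdm := measurable_dirV (d := d)
  let G : (E d × E d) × Sph d → ℝ := fun x => g ⟪dirV (x.1.1 - x.1.2), (x.2 : E d)⟫
  have hGm : Measurable G := by
    refine hgm.comp (Measurable.inner (hdm.comp (by fun_prop)) (by fun_prop))
  have hG0 : ∀ x, 0 ≤ G x := fun x => by
    obtain ⟨ω, h1, -⟩ := exists_dirV hd (x.1.1 - x.1.2)
    simp only [G, h1]
    exact hg.nonneg' _ _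
  let P : Measure ((E d × E d) × Sph d) :=
    ((f.prod f).prod (surf d)).withDensity fun x => ENNReal.ofReal (G x)
  have hP : IsProbabilityMeasure P := by
    refine ⟨?_⟩
    rw [withDensity_apply _ MeasurableSet.univ, Measure.restrict_univ,
      lintegral_prod _ hGm.ennreal_ofReal.aemeasurable]
    have : ∀ x : E d × E d, ∫⁻ n : Sph d, ENNReal.ofReal (G (x, n)) ∂(surf d) = 1 := fun x => by
      obtain ⟨ω, h1, -⟩ := exists_dirV hd (x.1 - x.2)
      simp only [G, h1]
      exact lintegral_kernel hg ω
    simp [this]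
  refine mem_charFcts_of_integral P
    (X := fun x => (1 / 2 : ℝ) • (x.1.1 + x.1.2) + ((1 / 2 : ℝ) * ‖x.1.1 - x.1.2‖) • (x.2 : E d))
    (by fun_prop) fun k => ?_
  obtain ⟨κ, -, hκ⟩ := exists_dirV hd k
  set X : (E d × E d) × Sph d → E d := fun x =>
    (1 / 2 : ℝ) • (x.1.1 + x.1.2) + ((1 / 2 : ℝ) * ‖x.1.1 - x.1.2‖) • (x.2 : E d) with hX
  have hXm : Measurable X := by fun_prop
  let F : (E d × E d) × Sph d → ℂ := fun x => Complex.exp (-(Complex.I * ((⟪k, X x⟫ : ℝ) : ℂ)))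
  have hexp : ∀ r : ℝ, ‖Complex.exp (-(Complex.I * (r : ℂ)))‖ = 1 := fun r => by
    rw [Complex.norm_exp]; simp
  have hFm : Measurable F := by fun_prop
  have hGint : Integrable G ((f.prod f).prod (surf d)) := by
    refine ⟨hGm.aestronglyMeasurable, ?_⟩
    rw [hasFiniteIntegral_iff_ofReal (Filter.Eventually.of_forall hG0)]
    have h1 : P univ = 1 := measure_univ
    rw [withDensity_apply _ MeasurableSet.univ, Measure.restrict_univ] at h1
    rw [h1]; exact ENNReal.one_lt_top
  have hint : Integrable (fun x => G x • F x) ((f.prod f).prod (surf d)) :=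
    hGint.smul_bdd 1 hFm.aestronglyMeasurable (Filter.Eventually.of_forall fun x => (hexp _).le)
  let Ek : E d → E d → ℂ := fun l v => Complex.exp (-(Complex.I * ((⟪l, v⟫ : ℝ) : ℂ)))
  -- for fixed velocities, exchange the directions of `v - w` and `k`
  have hswap : ∀ x : E d × E d, ∫ n : Sph d, G (x, n) • F (x, n) ∂(surf d)
      = ∫ n : Sph d, g ⟪(κ : E d), (n : E d)⟫ •
        (Ek ((1 / 2 : ℝ) • (k + ‖k‖ • (n : E d))) x.1 * Ek ((1 / 2 : ℝ) • (k - ‖k‖ • (n : E d))) x.2)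
          ∂(surf d) := by
    intro x
    obtain ⟨ω, h1, h2⟩ := exists_dirV hd (x.1 - x.2)
    set s := ‖x.1 - x.2‖ with hs
    have := integral_kernel_swap g ω κ (fun r : ℝ => Complex.exp (-(Complex.I *
      (((1 / 2 : ℝ) * ⟪k, x.1 + x.2⟫ + (1 / 2 : ℝ) * s * ‖k‖ * r : ℝ) : ℂ))))
    convert this using 1
    · congr 1; ext n
      simp only [G, F, hX, h1]
      congr 5
      have h4 : ⟪k, (n : E d)⟫ = ‖k‖ * ⟪(κ : E d), (n : E d)⟫ := by
        conv_lhs => rw [hκ]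
        rw [real_inner_smul_left]
      rw [inner_add_right, real_inner_smul_right, real_inner_smul_right, h4, ← hs]
      ring
    · congr 1; ext n
      congr 1
      simp only [Ek]
      rw [← Complex.exp_add]
      congr 1
      have h3 : s * ⟪(ω : E d), (n : E d)⟫ = ⟪(n : E d), x.1⟫ - ⟪(n : E d), x.2⟫ := by
        rw [← inner_sub_right, h2, real_inner_smul_right, real_inner_comm]
      rw [← mul_neg, ← mul_neg, ← mul_neg, ← mul_add]
      congr 1
      rw [← neg_add, ← Complex.ofReal_add]
      congr 2
      simp only [real_inner_smul_left, inner_add_left, inner_sub_left, inner_add_right]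
      linear_combination (-(1 / 2 : ℝ) * ‖k‖) * h3
  have hFu : ∫ x, F x ∂P = ∫ x, G x • F x ∂((f.prod f).prod (surf d)) := by
    rw [integral_withDensity_eq_integral_toReal_smul hGm.ennreal_ofReal
      (Filter.Eventually.of_forall fun x => ENNReal.ofReal_lt_top)]
    congr 1; ext x
    rw [ENNReal.toReal_ofReal (hG0 x)]
  change _ = ∫ x, F x ∂P
  rw [hFu, integral_prod _ hint]
  simp only [hswap]
  rw [integral_integral_swap]
  · rw [Gain_eq hg φ hκ]
    congr 1; ext n
    rw [integral_smul, integral_prod_mul (Ek ((1 / 2 : ℝ) • (k + ‖k‖ • (n : E d))))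
      (Ek ((1 / 2 : ℝ) • (k - ‖k‖ • (n : E d)))), hφ, hφ]
    rfl
  · have h1 : Integrable (fun x : (E d × E d) × Sph d => g ⟪(κ : E d), (x.2 : E d)⟫)
      ((f.prod f).prod (surf d)) := (hg.integrable κ).comp_snd _
    refine h1.smul_bdd 1 (Continuous.aestronglyMeasurable (by fun_prop)) ?_
    refine Filter.Eventually.of_forall fun x => ?_
    simp only [Ek, norm_mul, hexp, mul_one, le_refl]

/-! ### The linear flow -/

section

variable {F : Type*} [NormedAddCommGroup F] [NormedSpace ℝ F]

lemma norm_exp_clm_le (L : F →L[ℝ] F) : ‖NormedSpace.exp L‖ ≤ Real.exp ‖L‖ := by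
  have h1 : ∀ n : ℕ, ‖((n.factorial : ℝ)⁻¹) • L ^ n‖ ≤ ((n.factorial : ℝ)⁻¹) • ‖L‖ ^ n := by
    intro n
    rw [norm_smul, norm_inv, Real.norm_natCast, smul_eq_mul]
    gcongr
    rcases Nat.eq_zero_or_pos n with rfl | hn
    · simpa using! ContinuousLinearMap.norm_id_le (𝕜 := ℝ) (E := F)
    · exact norm_pow_le' L hn
  rw [NormedSpace.exp_eq_tsum ℝ, Real.exp_eq_exp_ℝ, NormedSpace.exp_eq_tsum ℝ]
  exact tsum_of_norm_bounded (NormedSpace.expSeries_summable' (𝕂 := ℝ) ‖L‖).hasSum h1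

lemma norm_smul_clm (r : ℝ) (L : F →L[ℝ] F) : ‖r • L‖ = |r| * ‖L‖ := norm_smul r L

variable [CompleteSpace F]

lemma hasDerivAt_exp_neg_smul (L : F →L[ℝ] F) (t : ℝ) :
    HasDerivAt (fun s : ℝ => NormedSpace.exp ((-s) • L)) (-(L * NormedSpace.exp ((-t) • L))) t := by
  have h := (hasDerivAt_exp_smul_const' (𝕂 := ℝ) L (-t)).scomp t (hasDerivAt_neg t)
  simpa [Function.comp_def] using h

lemma exp_neg_add_smul (L : F →L[ℝ] F) (s t : ℝ) :
    NormedSpace.exp ((-(s + t)) • L) = NormedSpace.exp ((-s) • L) * NormedSpace.exp ((-t) • L) := by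
  let _ := NormedAlgebra.restrictScalars ℚ ℝ (F →L[ℝ] F)
  rw [neg_add, add_smul, NormedSpace.exp_add_of_commute]
  exact (Commute.refl _).smul_left _ |>.smul_right _

end

/-- The flow `e^{-τ A_β}`. -/
def flow (A : Matrix (Fin d) (Fin d) ℝ) (β τ : ℝ) : E d →L[ℝ] E d :=
  NormedSpace.exp ((-τ) • act (A + β • 1))

lemma hasDerivAt_flow (A : Matrix (Fin d) (Fin d) ℝ) (β t : ℝ) :
    HasDerivAt (flow A β) (-(act (A + β • 1) * flow A β t)) t :=
  hasDerivAt_exp_neg_smul _ t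

lemma Eop_eq (A : Matrix (Fin d) (Fin d) ℝ) (β τ : ℝ) (ψ : E d → ℂ) (k : E d) :
    Eop A β τ ψ k = (Real.exp (-τ) : ℂ) * ψ (flow A β τ k) := rfl

lemma continuous_flow (A : Matrix (Fin d) (Fin d) ℝ) (β : ℝ) : Continuous (flow A β) :=
  continuous_iff_continuousAt.2 fun t => (hasDerivAt_flow A β t).continuousAt

lemma flow_add (A : Matrix (Fin d) (Fin d) ℝ) (β s t : ℝ) (k : E d) :
    flow A β (s + t) k = flow A β s (flow A β t k) :=
  congrArg (fun L : E d →L[ℝ] E d => L k) (exp_neg_add_smul (act (A + β • 1)) s t)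

@[simp] lemma flow_zero (A : Matrix (Fin d) (Fin d) ℝ) (β : ℝ) (k : E d) : flow A β 0 k = k := by
  have h : flow A β 0 = ContinuousLinearMap.id ℝ (E d) := by
    unfold flow
    have : (-(0:ℝ)) • act (A + β • 1) = 0 := by ext; simp
    rw [this, NormedSpace.exp_zero]; rfl
  rw [h]; rfl

lemma norm_act_add_le (A : Matrix (Fin d) (Fin d) ℝ) (β : ℝ) :
    ‖act (A + β • (1 : Matrix (Fin d) (Fin d) ℝ))‖ ≤ ‖act A‖ + |β| := by
  have h : act (A + β • (1 : Matrix (Fin d) (Fin d) ℝ))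
      = act A + β • ContinuousLinearMap.id ℝ (E d) := by
    simp only [act, map_add, map_smul, map_one]; rfl
  rw [h]
  refine (norm_add_le _ _).trans ?_
  gcongr
  refine (norm_smul_clm _ _).le.trans ?_
  exact mul_le_of_le_one_right (abs_nonneg _) ContinuousLinearMap.norm_id_le

lemma norm_flow_le (A : Matrix (Fin d) (Fin d) ℝ) (β : ℝ) {τ : ℝ} (hτ : 0 ≤ τ) (k : E d) :
    ‖flow A β τ k‖ ≤ Real.exp ((‖act A‖ + |β|) * τ) * ‖k‖ := by
  refine (ContinuousLinearMap.le_opNorm _ _).trans ?_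
  gcongr
  refine (norm_exp_clm_le _).trans ?_
  gcongr
  refine (norm_smul_clm _ _).le.trans ?_
  rw [abs_neg, abs_of_nonneg hτ, mul_comm]
  gcongr
  exact norm_act_add_le A β

/-- The operator `φ ↦ ∫_0^∞ E_β(τ) Γ[φ] dτ`, whose fixed points are the stationary solutions. -/
def Tmap (g : ℝ → ℝ) (A : Matrix (Fin d) (Fin d) ℝ) (β : ℝ) (φ : E d → ℂ) (k : E d) : ℂ :=
  ∫ τ in Ioi (0 : ℝ), Eop A β τ (Gain g φ) k

/-- Averages of characteristic functions along the flow are characteristic functions. -/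
lemma integral_Eop_mem_charFcts (A : Matrix (Fin d) (Fin d) ℝ) (β : ℝ) {ψ : E d → ℂ}
    (hψ : ψ ∈ charFcts d) : (fun k => ∫ τ in Ioi (0 : ℝ), Eop A β τ ψ k) ∈ charFcts d := by
  obtain ⟨f, hf, hψ⟩ := hψ
  let ρ : ℝ → ENNReal := fun τ => ENNReal.ofReal (Real.exp (-τ))
  have hρ : Measurable ρ := by fun_prop
  let m : Measure ℝ := (volume.restrict (Ioi 0)).withDensity ρ
  have hm : IsProbabilityMeasure m := by
    refine ⟨?_⟩
    rw [withDensity_apply _ MeasurableSet.univ, Measure.restrict_univ,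
      ← ofReal_integral_eq_lintegral_ofReal (integrableOn_exp_neg_Ioi 0)
        (Filter.Eventually.of_forall fun τ => (Real.exp_pos _).le), integral_exp_neg_Ioi_zero,
      ENNReal.ofReal_one]
  have hfl := continuous_flow A β
  have hcont : Continuous fun x : ℝ × E d => (flow A β x.1).adjoint x.2 := by
    have h1 : Continuous fun x : ℝ × E d => (flow A β x.1).adjoint :=
      (ContinuousLinearMap.adjoint (𝕜 := ℝ) (E := E d) (F := E d)).continuous.comp
        (hfl.comp continuous_fst)
    exact h1.clm_apply continuous_snd
  refine mem_charFcts_of_integral (m.prod f) (X := fun x => (flow A β x.1).adjoint x.2)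
    hcont.measurable fun k => ?_
  rw [integral_prod, integral_withDensity_eq_integral_toReal_smul hρ
    (Filter.Eventually.of_forall fun x => ENNReal.ofReal_lt_top)]
  · congr 1; ext τ
    simp only [ρ, ENNReal.toReal_ofReal (Real.exp_pos _).le, Eop_eq, hψ, fourierMeas,
      ContinuousLinearMap.adjoint_inner_right, Complex.real_smul]
  · refine Integrable.of_bound (C := 1) (Continuous.aestronglyMeasurable (by fun_prop))
      (Filter.Eventually.of_forall fun x => ?_)
    rw [Complex.norm_exp]; simp

lemma Tmap_mem_charFcts (hd : 2 ≤ d) {g : ℝ → ℝ} (hg : IsKernel d g)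
    (A : Matrix (Fin d) (Fin d) ℝ) (β : ℝ) {φ : E d → ℂ} (hφ : φ ∈ charFcts d) :
    Tmap g A β φ ∈ charFcts d :=
  integral_Eop_mem_charFcts A β (Gain_mem_charFcts hd hg hφ)

/-! ### The gain operator near a quadratic expansion -/

/-- The action of the linearised gain operator on second moments. -/
def gainMoment (q : ℝ) (B : Matrix (Fin d) (Fin d) ℝ) : Matrix (Fin d) (Fin d) ℝ :=
  B - (q * d / (2 * ((d : ℝ) - 1))) • (B - (B.trace / d) • (1 : Matrix (Fin d) (Fin d) ℝ))

lemma qf_add (B C : Matrix (Fin d) (Fin d) ℝ) (k : E d) : qf (B + C) k = qf B k + qf C k := by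
  simp only [qf, Matrix.add_apply, add_mul, Finset.sum_add_distrib]

lemma qf_smul (c : ℝ) (B : Matrix (Fin d) (Fin d) ℝ) (k : E d) : qf (c • B) k = c * qf B k := by
  simp only [qf, Matrix.smul_apply, smul_eq_mul, Finset.mul_sum, mul_assoc]

lemma qf_sub (B C : Matrix (Fin d) (Fin d) ℝ) (k : E d) : qf (B - C) k = qf B k - qf C k := by
  rw [sub_eq_add_neg, ← neg_one_smul ℝ C, qf_add, qf_smul]; ring

lemma qf_one (k : E d) : qf (1 : Matrix (Fin d) (Fin d) ℝ) k = ‖k‖ ^ 2 := by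
  simp only [qf, Matrix.one_apply, EuclideanSpace.real_norm_sq_eq]
  refine Finset.sum_congr rfl fun j _ => ?_
  rw [Finset.sum_eq_single j]
  · simp; ring
  · intro l _ hl; simp [hl.symm]
  · simp

lemma qf_zero_left (k : E d) : qf (0 : Matrix (Fin d) (Fin d) ℝ) k = 0 := by simp [qf]

lemma qf_smul_right (B : Matrix (Fin d) (Fin d) ℝ) (r : ℝ) (k : E d) :
    qf B (r • k) = r ^ 2 * qf B k := by
  simp only [qf, PiLp.smul_apply, smul_eq_mul, Finset.mul_sum]
  exact Finset.sum_congr rfl fun j _ => Finset.sum_congr rfl fun l _ => by ring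

lemma qf_parallelogram (B : Matrix (Fin d) (Fin d) ℝ) (x y : E d) :
    qf B (x + y) + qf B (x - y) = 2 * qf B x + 2 * qf B y := by
  simp only [qf, PiLp.add_apply, PiLp.sub_apply, Finset.mul_sum, ← Finset.sum_add_distrib]
  exact Finset.sum_congr rfl fun j _ => Finset.sum_congr rfl fun l _ => by ring

lemma continuous_qf (B : Matrix (Fin d) (Fin d) ℝ) : Continuous (qf B) := by
  unfold qf; fun_prop

/-- The vector `k₊ = (k + |k| n)/2`. -/
def kp (k n : E d) : E d := (1 / 2 : ℝ) • (k + ‖k‖ • n)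

/-- The vector `k₋ = (k - |k| n)/2`. -/
def km (k n : E d) : E d := (1 / 2 : ℝ) • (k - ‖k‖ • n)

lemma continuous_kp : Continuous fun x : E d × E d => kp x.1 x.2 := by unfold kp; fun_prop

lemma continuous_km : Continuous fun x : E d × E d => km x.1 x.2 := by unfold km; fun_prop

lemma continuous_kp_right (k : E d) : Continuous fun n : Sph d => kp k n := by unfold kp; fun_prop

lemma continuous_km_right (k : E d) : Continuous fun n : Sph d => km k n := by unfold km; fun_prop

lemma norm_kp_sq {k : E d} {ω : Sph d} (hk : k = ‖k‖ • (ω : E d)) (n : Sph d) :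
    ‖kp k n‖ ^ 2 = ‖k‖ ^ 2 * ((1 + ⟪(ω : E d), (n : E d)⟫) / 2) := by
  have h : ⟪k, (n : E d)⟫ = ‖k‖ * ⟪(ω : E d), (n : E d)⟫ := by
    conv_lhs => rw [hk]
    rw [real_inner_smul_left]
  rw [kp, norm_smul, mul_pow, norm_add_sq_real, norm_smul, norm_norm, norm_coe_sph,
    real_inner_smul_right, h, Real.norm_eq_abs, sq_abs]
  ring

lemma norm_km_sq {k : E d} {ω : Sph d} (hk : k = ‖k‖ • (ω : E d)) (n : Sph d) :
    ‖km k n‖ ^ 2 = ‖k‖ ^ 2 * ((1 - ⟪(ω : E d), (n : E d)⟫) / 2) := by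
  have h : ⟪k, (n : E d)⟫ = ‖k‖ * ⟪(ω : E d), (n : E d)⟫ := by
    conv_lhs => rw [hk]
    rw [real_inner_smul_left]
  rw [km, norm_smul, mul_pow, norm_sub_sq_real, norm_smul, norm_norm, norm_coe_sph,
    real_inner_smul_right, h, Real.norm_eq_abs, sq_abs]
  ring

lemma norm_kp_le {k : E d} {ω : Sph d} (hk : k = ‖k‖ • (ω : E d)) (n : Sph d) :
    ‖kp k n‖ ≤ ‖k‖ := by
  have h := inner_mem_Icc ω n
  refine le_of_sq_le_sq ?_ (norm_nonneg _)
  rw [norm_kp_sq hk]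
  exact mul_le_of_le_one_right (sq_nonneg _) (by linarith [h.2])

lemma norm_km_le {k : E d} {ω : Sph d} (hk : k = ‖k‖ • (ω : E d)) (n : Sph d) :
    ‖km k n‖ ≤ ‖k‖ := by
  have h := inner_mem_Icc ω n
  refine le_of_sq_le_sq ?_ (norm_nonneg _)
  rw [norm_km_sq hk]
  exact mul_le_of_le_one_right (sq_nonneg _) (by linarith [h.1])

lemma integral_kernel_qf_pm (hd : 2 ≤ d) {g : ℝ → ℝ} (hg : IsKernel d g)
    (B : Matrix (Fin d) (Fin d) ℝ) {k : E d} {ω : Sph d} (hk : k = ‖k‖ • (ω : E d)) :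
    ∫ n : Sph d, g ⟪(ω : E d), (n : E d)⟫ * (qf B (kp k n) + qf B (km k n)) ∂(surf d)
      = qf (gainMoment (kernelQ d g) B) k := by
  have hd1 : (d : ℝ) - 1 ≠ 0 := by
    have : (2 : ℝ) ≤ d := by exact_mod_cast hd
    linarith
  have hd0 : (d : ℝ) ≠ 0 := by
    have : (2 : ℝ) ≤ d := by exact_mod_cast hd
    linarith
  have h1 : ∀ n : E d, qf B (kp k n) + qf B (km k n) = (1 / 2) * qf B k
      + (1 / 2) * ‖k‖ ^ 2 * qf B n := by
    intro n
    rw [kp, km, qf_smul_right, qf_smul_right, ← mul_add, qf_parallelogram, qf_smul_right]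
    ring
  have h2 : qf B k = ‖k‖ ^ 2 * qf B ω := by
    conv_lhs => rw [hk]
    rw [qf_smul_right]
  have h3 : ∫ n : Sph d, g ⟪(ω : E d), (n : E d)⟫ * (qf B (kp k n) + qf B (km k n)) ∂(surf d)
      = (1 / 2) * qf B k * (∫ n : Sph d, g ⟪(ω : E d), (n : E d)⟫ ∂(surf d))
        + (1 / 2) * ‖k‖ ^ 2 * ∫ n : Sph d, g ⟪(ω : E d), (n : E d)⟫ * qf B n ∂(surf d) := by
    rw [← integral_const_mul, ← integral_const_mul, ← integral_add]
    · congr 1; ext n; rw [h1]; ring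
    · exact (hg.integrable ω).const_mul _
    · exact (hg.integrable_mul ω ((continuous_qf B).comp continuous_subtype_val)).const_mul _
  rw [h3, hg.normalized, integral_kernel_qf hd hg, gainMoment, qf_sub, qf_smul, qf_sub, qf_smul,
    qf_one, h2]
  field_simp
  ring

/-- The function `x ↦ x^a + (1-x)^a` falls below `1` at least as much as a multiple of
`x (1 - x)`, by Bernoulli's inequality for `x^(a-1)`. -/
lemma rpow_add_rpow_one_sub_le {x a : ℝ} (hx0 : 0 ≤ x) (hx1 : x ≤ 1) (ha1 : 1 ≤ a)
    (ha2 : a ≤ 2) : x ^ a + (1 - x) ^ a ≤ 1 - 2 * (a - 1) * (x * (1 - x)) := by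
  have key : ∀ y : ℝ, 0 ≤ y → y ^ a ≤ y * (1 + (a - 1) * (y - 1)) := by
    intro y hy
    have h1 : y ^ a = y * y ^ (a - 1) := by
      rw [← Real.rpow_one_add' hy (by linarith)]; congr 1; ring
    rw [h1]
    gcongr
    have := rpow_one_add_le_one_add_mul_self (s := y - 1) (p := a - 1) (by linarith)
      (by linarith) (by linarith)
    rwa [add_sub_cancel] at this
  have h1 := key x hx0
  have h2 := key (1 - x) (by linarith)
  linarith

lemma rpow_eq_sq_rpow_half {x : ℝ} (hx : 0 ≤ x) (r : ℝ) : x ^ r = (x ^ 2) ^ (r / 2) := by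
  rw [← Real.rpow_natCast, ← Real.rpow_mul hx]; congr 1; push_cast; ring

/-- The contraction property of the gain operator on functions of order `|k|^r`, `2 ≤ r ≤ 4`; the
factor is below one for `r > 2` and depends on the kernel only through `q`. -/
lemma integral_kernel_rpow_pm (hd : 2 ≤ d) {g : ℝ → ℝ} (hg : IsKernel d g) {r : ℝ} (hr2 : 2 ≤ r)
    (hr4 : r ≤ 4) {k : E d} {ω : Sph d} (hk : k = ‖k‖ • (ω : E d)) :
    ∫ n : Sph d, g ⟪(ω : E d), (n : E d)⟫ * (‖kp k n‖ ^ r + ‖km k n‖ ^ r) ∂(surf d)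
      ≤ (1 - (r - 2) / 4 * kernelQ d g) * ‖k‖ ^ r := by
  have hcp := continuous_kp_right k
  have hcm := continuous_km_right k
  have hr0 : 0 ≤ r := by linarith
  have h1 : ∫ n : Sph d, g ⟪(ω : E d), (n : E d)⟫ *
        ((1 - (r - 2) / 4 * (1 - ⟪(ω : E d), (n : E d)⟫ ^ 2)) * ‖k‖ ^ r) ∂(surf d)
      = (1 - (r - 2) / 4 * kernelQ d g) * ‖k‖ ^ r := by
    have h2 : ∀ n : Sph d, g ⟪(ω : E d), (n : E d)⟫ *
        ((1 - (r - 2) / 4 * (1 - ⟪(ω : E d), (n : E d)⟫ ^ 2)) * ‖k‖ ^ r)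
        = ‖k‖ ^ r * g ⟪(ω : E d), (n : E d)⟫ - ‖k‖ ^ r * ((r - 2) / 4) *
          (g ⟪(ω : E d), (n : E d)⟫ * (1 - ⟪(ω : E d), (n : E d)⟫ ^ 2)) := fun n => by ring
    simp only [h2]
    rw [integral_sub ((hg.integrable ω).const_mul _)
      ((hg.integrable_mul ω (by fun_prop)).const_mul _), integral_const_mul, integral_const_mul,
      hg.normalized, kernelQ_eq hd]
    ring
  rw [← h1]
  refine integral_mono (hg.integrable_mul ω ?_) (hg.integrable_mul ω (by fun_prop)) fun n => ?_
  · exact (hcp.norm.rpow_const fun _ => Or.inr hr0).add (hcm.norm.rpow_const fun _ => Or.inr hr0)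
  refine mul_le_mul_of_nonneg_left ?_ (hg.nonneg' ω n)
  have hs := inner_mem_Icc ω n
  set s := ⟪(ω : E d), (n : E d)⟫
  rw [rpow_eq_sq_rpow_half (norm_nonneg (kp k n)), rpow_eq_sq_rpow_half (norm_nonneg (km k n)),
    norm_kp_sq hk, norm_km_sq hk, Real.mul_rpow (sq_nonneg _) (by linarith [hs.1]),
    Real.mul_rpow (sq_nonneg _) (by linarith [hs.2]), ← rpow_eq_sq_rpow_half (norm_nonneg k),
    ← mul_add, mul_comm]
  refine mul_le_mul_of_nonneg_right ?_ (by positivity)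
  have := rpow_add_rpow_one_sub_le (x := (1 + s) / 2) (a := r / 2) (by linarith [hs.1])
    (by linarith [hs.2]) (by linarith) (by linarith)
  rw [show 1 - (1 + s) / 2 = (1 - s) / 2 by ring] at this
  linarith

/-- The basic estimate for the gain operator: if `φ - ψ = -½ ∑ b_{jl} k_j k_l + y`, then
`Γ[φ] - Γ[ψ] = -½ ∑ (LB)_{jl} k_j k_l + y'` with `L = gainMoment q`. The part of `y` of order
`|k|^r` is contracted, and `s` measures the products of the quadratic form with `φ - 1` and `ψ - 1`.
The part of order `1 + |k|²` need not vanish at `k = 0`; it is at most doubled, and serves as the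
a priori bound from which the induction in `IsMildSolution.norm_sub_le` starts. -/
lemma norm_Gain_sub_le (hd : 2 ≤ d) {g : ℝ → ℝ} (hg : IsKernel d g) {φ ψ : E d → ℂ}
    (hφ : φ ∈ charFcts d) (hψ : ψ ∈ charFcts d) (B : Matrix (Fin d) (Fin d) ℝ)
    {r a b s : ℝ} (hr2 : 2 ≤ r) (hr4 : r ≤ 4) (ha : 0 ≤ a) (hb : 0 ≤ b) (hs : 0 ≤ s)
    (hy : ∀ k, ‖φ k - ψ k + (1 / 2 : ℂ) * (qf B k : ℂ)‖ ≤ a * ‖k‖ ^ r + b * (1 + ‖k‖ ^ 2))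
    (hφ1 : ∀ u v, |qf B u| * ‖φ v - 1‖ ≤ s * (‖u‖ ^ 2 * ‖v‖ ^ (r - 2)))
    (hψ1 : ∀ u v, |qf B u| * ‖ψ v - 1‖ ≤ s * (‖u‖ ^ 2 * ‖v‖ ^ (r - 2))) (k : E d) :
    ‖Gain g φ k - Gain g ψ k + (1 / 2 : ℂ) * (qf (gainMoment (kernelQ d g) B) k : ℂ)‖
      ≤ ((1 - (r - 2) / 4 * kernelQ d g) * a + s) * ‖k‖ ^ r + 2 * b * (1 + ‖k‖ ^ 2) := by
  obtain ⟨ω, -, hk⟩ := exists_dirV hd k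
  have hcp := continuous_kp_right k
  have hcm := continuous_km_right k
  have hr0 : 0 ≤ r := by linarith
  have hcφ := continuous_of_mem hφ
  have hcψ := continuous_of_mem hψ
  have hcq := continuous_qf B
  have hI : Gain g φ k - Gain g ψ k + (1 / 2 : ℂ) * (qf (gainMoment (kernelQ d g) B) k : ℂ)
      = ∫ n : Sph d, g ⟪(ω : E d), (n : E d)⟫ • (φ (kp k n) * φ (km k n)
        - ψ (kp k n) * ψ (km k n)
        + (1 / 2 : ℂ) * ((qf B (kp k n) + qf B (km k n) : ℝ) : ℂ)) ∂(surf d) := by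
    have h1 : (1 / 2 : ℂ) * (qf (gainMoment (kernelQ d g) B) k : ℂ)
        = ∫ n : Sph d, g ⟪(ω : E d), (n : E d)⟫ •
          ((1 / 2 : ℂ) * ((qf B (kp k n) + qf B (km k n) : ℝ) : ℂ)) ∂(surf d) := by
      rw [← integral_kernel_qf_pm hd hg B hk, ← integral_complex_ofReal, ← integral_const_mul]
      congr 1; ext n
      rw [Complex.real_smul]; push_cast; ring
    rw [Gain_eq hg φ hk, Gain_eq hg ψ hk, h1, ← integral_sub, ← integral_add]
    · congr 1; ext n
      simp only [← smul_sub, ← smul_add, kp, km]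
    · exact (hg.integrable_smul ω ((hcφ.comp hcp).mul (hcφ.comp hcm))).sub
        (hg.integrable_smul ω ((hcψ.comp hcp).mul (hcψ.comp hcm)))
    · exact hg.integrable_smul ω (by fun_prop)
    · exact hg.integrable_smul ω ((hcφ.comp hcp).mul (hcφ.comp hcm))
    · exact hg.integrable_smul ω ((hcψ.comp hcp).mul (hcψ.comp hcm))
  have hcr : Continuous fun n : Sph d => ‖kp k n‖ ^ r + ‖km k n‖ ^ r :=
    (hcp.norm.rpow_const fun _ => Or.inr hr0).add (hcm.norm.rpow_const fun _ => Or.inr hr0)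
  have hbound : ∀ n : Sph d, ‖φ (kp k n) * φ (km k n) - ψ (kp k n) * ψ (km k n)
        + (1 / 2 : ℂ) * ((qf B (kp k n) + qf B (km k n) : ℝ) : ℂ)‖
      ≤ a * (‖kp k n‖ ^ r + ‖km k n‖ ^ r) + (s * ‖k‖ ^ r + 2 * b * (1 + ‖k‖ ^ 2)) := by
    intro n
    set x := kp k n
    set z := km k n
    have hx : ‖x‖ ≤ ‖k‖ := norm_kp_le hk n
    have hz : ‖z‖ ≤ ‖k‖ := norm_km_le hk n
    have hxz : ‖x‖ ^ 2 + ‖z‖ ^ 2 = ‖k‖ ^ 2 := by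
      rw [norm_kp_sq hk, norm_km_sq hk]; ring
    have hsplit : φ x * φ z - ψ x * ψ z + (1 / 2 : ℂ) * ((qf B x + qf B z : ℝ) : ℂ)
        = (φ x - ψ x + (1 / 2 : ℂ) * (qf B x : ℂ)) * φ z
          + ψ x * (φ z - ψ z + (1 / 2 : ℂ) * (qf B z : ℂ))
          - (1 / 2 : ℂ) * (qf B x : ℂ) * (φ z - 1) - (1 / 2 : ℂ) * (qf B z : ℂ) * (ψ x - 1) := by
      push_cast; ring
    have hcross : ∀ u v : E d, ‖u‖ ≤ ‖k‖ → ‖v‖ ≤ ‖k‖ → ∀ w : ℂ,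
        |qf B u| * ‖w‖ ≤ s * (‖u‖ ^ 2 * ‖v‖ ^ (r - 2)) →
        ‖(1 / 2 : ℂ) * (qf B u : ℂ) * w‖ ≤ 1 / 2 * (s * ‖k‖ ^ r) := by
      intro u v hu hv w hw
      rw [norm_mul, norm_mul, Complex.norm_real, Real.norm_eq_abs]
      have h1 : ‖k‖ ^ r = ‖k‖ ^ 2 * ‖k‖ ^ (r - 2) := by
        rw [← Real.rpow_natCast, ← Real.rpow_add' (norm_nonneg _) (by push_cast; linarith)]
        congr 1; push_cast; ring
      have h2 : s * (‖u‖ ^ 2 * ‖v‖ ^ (r - 2)) ≤ s * (‖k‖ ^ 2 * ‖k‖ ^ (r - 2)) := by gcongr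
      have h5 : ‖(1 / 2 : ℂ)‖ = 1 / 2 := by norm_num
      rw [h5, h1]
      linarith
    have e1 : ‖(φ x - ψ x + (1 / 2 : ℂ) * (qf B x : ℂ)) * φ z‖
        ≤ a * ‖x‖ ^ r + b * (1 + ‖x‖ ^ 2) := by
      rw [norm_mul]
      exact (mul_le_of_le_one_right (norm_nonneg _) (norm_le_one_of_mem hφ z)).trans (hy x)
    have e2 : ‖ψ x * (φ z - ψ z + (1 / 2 : ℂ) * (qf B z : ℂ))‖
        ≤ a * ‖z‖ ^ r + b * (1 + ‖z‖ ^ 2) := by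
      rw [norm_mul]
      exact (mul_le_of_le_one_left (norm_nonneg _) (norm_le_one_of_mem hψ x)).trans (hy z)
    have e3 := hcross x z hx hz _ (hφ1 x z)
    have e4 := hcross z x hz hx _ (hψ1 z x)
    rw [hsplit]
    refine (norm_sub_le _ _).trans ((add_le_add_left ((norm_sub_le _ _).trans
      (add_le_add_left (norm_add_le _ _) _)) _).trans ?_)
    have h6 : b * (‖x‖ ^ 2 + ‖z‖ ^ 2) = b * ‖k‖ ^ 2 := by rw [hxz]
    nlinarith [mul_nonneg hb (sq_nonneg ‖k‖)]
  rw [hI]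
  refine (norm_integral_le_of_norm_le (g := fun n : Sph d => g ⟪(ω : E d), (n : E d)⟫ *
    (a * (‖kp k n‖ ^ r + ‖km k n‖ ^ r) + (s * ‖k‖ ^ r + 2 * b * (1 + ‖k‖ ^ 2))))
    (hg.integrable_mul ω ((continuous_const.mul hcr).add continuous_const))
    (Filter.Eventually.of_forall fun n => ?_)).trans ?_
  · rw [norm_smul, Real.norm_of_nonneg (hg.nonneg' ω n)]
    exact mul_le_mul_of_nonneg_left (hbound n) (hg.nonneg' ω n)
  · have h7 : ∀ n : Sph d, g ⟪(ω : E d), (n : E d)⟫ *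
        (a * (‖kp k n‖ ^ r + ‖km k n‖ ^ r) + (s * ‖k‖ ^ r + 2 * b * (1 + ‖k‖ ^ 2)))
        = a * (g ⟪(ω : E d), (n : E d)⟫ * (‖kp k n‖ ^ r + ‖km k n‖ ^ r))
          + (s * ‖k‖ ^ r + 2 * b * (1 + ‖k‖ ^ 2)) * g ⟪(ω : E d), (n : E d)⟫ :=
      fun n => by ring
    simp only [h7]
    rw [integral_add ((hg.integrable_mul ω hcr).const_mul _) ((hg.integrable ω).const_mul _),
      integral_const_mul, integral_const_mul, hg.normalized]
    have := mul_le_mul_of_nonneg_left (integral_kernel_rpow_pm hd hg hr2 hr4 hk) ha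
    linarith

lemma norm_Gain_le_one (hd : 2 ≤ d) {g : ℝ → ℝ} (hg : IsKernel d g) {φ : E d → ℂ}
    (hφ : φ ∈ charFcts d) (k : E d) : ‖Gain g φ k‖ ≤ 1 :=
  norm_le_one_of_mem (Gain_mem_charFcts hd hg hφ) k

lemma measurable_Gain (hd : 2 ≤ d) {g : ℝ → ℝ} (hg : IsKernel d g) {X : Type*}
    [MeasurableSpace X] {φ : X → E d → ℂ} (hφ : Measurable (Function.uncurry φ)) {κ : X → E d}
    (hκ : Measurable κ) : Measurable fun x => Gain g (φ x) (κ x) := by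
  have h : ∀ x, Gain g (φ x) (κ x) = ∫ n : Sph d, g ⟪dirV (κ x), (n : E d)⟫ •
      (φ x (kp (κ x) n) * φ x (km (κ x) n)) ∂(surf d) := by
    intro x
    obtain ⟨ω, h1, h2⟩ := exists_dirV hd (κ x)
    rw [Gain_eq hg (φ x) h2, h1]
    rfl
  simp only [h]
  refine StronglyMeasurable.measurable ?_
  refine StronglyMeasurable.integral_prod_right
    (f := fun x (n : Sph d) => g ⟪dirV (κ x), (n : E d)⟫ •
      (φ x (kp (κ x) n) * φ x (km (κ x) n))) ?_
  refine Measurable.stronglyMeasurable ?_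
  have h1 : Measurable fun x : X × Sph d => (κ x.1, (x.2 : E d)) :=
    (hκ.comp measurable_fst).prodMk (measurable_subtype_coe.comp measurable_snd)
  have h2 : Measurable fun x : X × Sph d => φ x.1 (kp (κ x.1) x.2) :=
    hφ.comp (measurable_fst.prodMk (continuous_kp.measurable.comp h1))
  have h3 : Measurable fun x : X × Sph d => φ x.1 (km (κ x.1) x.2) :=
    hφ.comp (measurable_fst.prodMk (continuous_km.measurable.comp h1))
  have h4 : Measurable fun x : X × Sph d => g ⟪dirV (κ x.1), (x.2 : E d)⟫ :=
    hg.measurable.comp (Measurable.inner (measurable_dirV.comp (hκ.comp measurable_fst))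
      (measurable_subtype_coe.comp measurable_snd))
  exact h4.smul (h2.mul h3)

/-! ### Perturbation of a simple leading eigenvalue in a Hilbert space -/

section Spectral

variable {V : Type*} [NormedAddCommGroup V] [InnerProductSpace ℝ V]

/-- The operator `-c (1 - P) + K`, where `P` is the orthogonal projection on the unit vector `e`. -/
def pertOp (c : ℝ) (e : V) (K : V →L[ℝ] V) : V →L[ℝ] V :=
  K - c • (ContinuousLinearMap.id ℝ V - (innerSL ℝ e).smulRight e)

lemma pertOp_apply (c : ℝ) (e : V) (K : V →L[ℝ] V) (x : V) :
    pertOp c e K x = K x - c • (x - ⟪e, x⟫ • e) := by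
  simp [pertOp]

/-- For a small perturbation `K`, the operator `pertOp c e K` has an eigenvector `e + X` with `X`
small and orthogonal to `e`: `X` is the fixed point of a contraction. -/
lemma exists_eigenvector_pertOp [CompleteSpace V] {c ρ : ℝ} (hc : 0 < c) (hρ : 0 < ρ)
    (hρ1 : ρ ≤ 1) {e : V} (he : ‖e‖ = 1) {K : V →L[ℝ] V} (hK : 12 * ‖K‖ ≤ ρ * c) :
    ∃ (β : ℝ) (X : V), ‖X‖ ≤ ρ ∧ ⟪e, X⟫ = 0 ∧ |β| ≤ 2 * ‖K‖ ∧
      pertOp c e K (e + X) = β • (e + X) := by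
  set η := ‖K‖ with hη
  have hη0 : 0 ≤ η := norm_nonneg _
  have hηc : 12 * η ≤ c := hK.trans (mul_le_of_le_one_left hc.le hρ1)
  let b : V → ℝ := fun X => ⟪e, K (e + X)⟫
  let F : V → V := fun X => c⁻¹ • (K (e + X) - b X • (e + X))
  have hKn : ∀ x, ‖K x‖ ≤ η * ‖x‖ := K.le_opNorm
  have hin : ∀ x, |⟪e, x⟫| ≤ ‖x‖ := fun x => by
    simpa [he] using abs_real_inner_le_norm e x
  have heX : ∀ X : V, ‖X‖ ≤ ρ → ‖e + X‖ ≤ 2 := fun X hX => by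
    refine (norm_add_le _ _).trans ?_
    rw [he]; linarith
  have hKe : ∀ X : V, ‖X‖ ≤ ρ → ‖K (e + X)‖ ≤ 2 * η := fun X hX => by
    refine (hKn _).trans ?_
    nlinarith [heX X hX]
  have hb : ∀ X : V, ‖X‖ ≤ ρ → |b X| ≤ 2 * η := fun X hX => (hin _).trans (hKe X hX)
  have hmaps : MapsTo F (Metric.closedBall 0 ρ) (Metric.closedBall 0 ρ) := by
    intro X hX
    rw [mem_closedBall_zero_iff] at hX ⊢
    have h1 : ‖K (e + X) - b X • (e + X)‖ ≤ 6 * η := by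
      refine (norm_sub_le _ _).trans ?_
      rw [norm_smul, Real.norm_eq_abs]
      have := mul_le_mul (hb X hX) (heX X hX) (norm_nonneg _) (by positivity)
      linarith [hKe X hX]
    rw [norm_smul, norm_inv, Real.norm_of_nonneg hc.le, inv_mul_le_iff₀ hc]
    linarith
  have hlip : LipschitzOnWith (1 / 2) F (Metric.closedBall 0 ρ) := by
    refine LipschitzOnWith.of_dist_le_mul fun X hX Y hY => ?_
    rw [mem_closedBall_zero_iff] at hX hY
    rw [dist_eq_norm, dist_eq_norm]
    have h1 : K (e + X) - K (e + Y) = K (X - Y) := by rw [← map_sub]; congr 1; abel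
    have h2 : F X - F Y = c⁻¹ • (K (X - Y) - ⟪e, K (X - Y)⟫ • (e + X) - b Y • (X - Y)) := by
      simp only [F]
      rw [← smul_sub]
      congr 1
      have h3 : b X - b Y = ⟪e, K (X - Y)⟫ := by simp only [b]; rw [← inner_sub_right, h1]
      rw [← h3, ← h1]
      module
    have h4 : ‖K (X - Y)‖ ≤ η * ‖X - Y‖ := hKn _
    have h5 : ‖⟪e, K (X - Y)⟫ • (e + X)‖ ≤ 2 * (η * ‖X - Y‖) := by
      rw [norm_smul, Real.norm_eq_abs, mul_comm]
      exact mul_le_mul (heX X hX) ((hin _).trans h4) (abs_nonneg _) (by norm_num)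
    have h6 : ‖b Y • (X - Y)‖ ≤ 2 * η * ‖X - Y‖ := by
      rw [norm_smul, Real.norm_eq_abs]
      exact mul_le_mul_of_nonneg_right (hb Y hY) (norm_nonneg _)
    rw [h2, norm_smul, norm_inv, Real.norm_of_nonneg hc.le, inv_mul_le_iff₀ hc]
    refine (norm_sub_le _ _).trans ((add_le_add_left (norm_sub_le _ _) _).trans ?_)
    have h7 : 12 * η * ‖X - Y‖ ≤ c * ‖X - Y‖ := mul_le_mul_of_nonneg_right hηc (norm_nonneg _)
    push_cast
    have h8 : 0 ≤ η * ‖X - Y‖ := by positivity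
    linarith
  have hcw : ContractingWith (1 / 2) (hmaps.restrict F _ _) :=
    ⟨by norm_num, hlip.mapsToRestrict hmaps⟩
  obtain ⟨X, hX, hfix, -⟩ := hcw.exists_fixedPoint' (s := Metric.closedBall 0 ρ)
    Metric.isClosed_closedBall.isComplete hmaps (x := 0) (by simp [hρ.le]) (edist_ne_top _ _)
  rw [mem_closedBall_zero_iff] at hX
  have hfix : F X = X := hfix
  have hee : ⟪e, e⟫ = 1 := by rw [real_inner_self_eq_norm_sq, he]; norm_num
  have hcX : K (e + X) - b X • (e + X) = c • X := by
    conv_rhs => rw [← hfix]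
    simp only [F]
    rw [smul_smul, mul_inv_cancel₀ hc.ne', one_smul]
  have horth : ⟪e, X⟫ = 0 := by
    have h1 : b X - b X * (1 + ⟪e, X⟫) = c * ⟪e, X⟫ := by
      have := congrArg (fun v => ⟪e, v⟫) hcX
      simp only [inner_sub_right, real_inner_smul_right] at this
      rw [inner_add_right, hee] at this
      exact this
    have h2 : (c + b X) * ⟪e, X⟫ = 0 := by linarith
    rcases mul_eq_zero.1 h2 with h3 | h3
    · have := (abs_le.1 (hb X hX)).1
      linarith
    · exact h3
  refine ⟨b X, X, hX, horth, hb X hX, ?_⟩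
  rw [pertOp_apply, inner_add_right, hee, horth, add_zero, one_smul, add_sub_cancel_left, ← hcX]
  abel

/-- The spectral picture for `M = pertOp c e K` with small `K`: a simple leading eigenvalue `β`
near `0` with right and left eigenvectors `N`, `N'` near `e`, and `M ≤ -c/2` on the invariant
complement `N'^⊥`. -/
lemma exists_spectral_pertOp [CompleteSpace V] {c ρ : ℝ} (hc : 0 < c) (hρ : 0 < ρ)
    (hρ2 : ρ ≤ 1 / 2) {e : V} (he : ‖e‖ = 1) {K : V →L[ℝ] V} (hK : 12 * ‖K‖ ≤ ρ * c) :
    ∃ (β : ℝ) (N N' : V), ‖N - e‖ ≤ ρ ∧ ‖N' - e‖ ≤ ρ ∧ ⟪e, N⟫ = 1 ∧ |β| ≤ 2 * ‖K‖ ∧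
      pertOp c e K N = β • N ∧ (∀ x, ⟪N', pertOp c e K x⟫ = β * ⟪N', x⟫) ∧
      1 / 2 ≤ ⟪N', N⟫ ∧
      ∀ D, ⟪N', D⟫ = 0 → ⟪D, pertOp c e K D⟫ ≤ -(c / 2) * ‖D‖ ^ 2 := by
  obtain ⟨β, X, hX, hX0, hβ, hN⟩ := exists_eigenvector_pertOp hc hρ (by linarith) he hK
  obtain ⟨β', X', hX', hX0', hβ', hN'⟩ := exists_eigenvector_pertOp hc hρ (by linarith) he
    (K := K.adjoint) (by rwa [LinearIsometryEquiv.norm_map])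
  have hee : ⟪e, e⟫ = 1 := by rw [real_inner_self_eq_norm_sq, he]; norm_num
  have hadj : ∀ x y, ⟪pertOp c e K.adjoint x, y⟫ = ⟪x, pertOp c e K y⟫ := fun x y => by
    simp only [pertOp_apply, inner_sub_left, inner_sub_right, real_inner_smul_left,
      real_inner_smul_right, ContinuousLinearMap.adjoint_inner_left]
    rw [real_inner_comm x e]; ring
  have hNN : 1 / 2 ≤ ⟪e + X', e + X⟫ := by
    rw [inner_add_left, inner_add_right, inner_add_right, hee, hX0, real_inner_comm, hX0']
    have := (abs_le.1 (abs_real_inner_le_norm X' X)).1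
    have h2 : ‖X'‖ * ‖X‖ ≤ (1 / 2) * (1 / 2) :=
      mul_le_mul (hX'.trans hρ2) (hX.trans hρ2) (norm_nonneg _) (by norm_num)
    linarith
  have hββ : β' = β := by
    have h1 := hadj (e + X') (e + X)
    rw [hN', hN, real_inner_smul_left, real_inner_smul_right] at h1
    exact mul_right_cancel₀ (by linarith : ⟪e + X', e + X⟫ ≠ 0) h1
  refine ⟨β, e + X, e + X', by simpa using hX, by simpa using hX', ?_, hβ, hN, fun x => ?_, hNN,
    fun D hD => ?_⟩
  · rw [inner_add_right, hee, hX0, add_zero]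
  · rw [← hadj, hN', real_inner_smul_left, hββ]
  · have h1 : |⟪e, D⟫| ≤ 1 / 2 * ‖D‖ := by
      have h2 : ⟪e, D⟫ = -⟪X', D⟫ := by rw [inner_add_left] at hD; linarith
      rw [h2, abs_neg]
      exact (abs_real_inner_le_norm _ _).trans
        (mul_le_mul_of_nonneg_right (hX'.trans hρ2) (norm_nonneg _))
    have h2 : ⟪e, D⟫ ^ 2 ≤ 1 / 4 * ‖D‖ ^ 2 := by
      rw [← sq_abs]
      nlinarith [abs_nonneg ⟪e, D⟫, norm_nonneg D]
    have h3 : ⟪D, K D⟫ ≤ ‖K‖ * ‖D‖ ^ 2 := by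
      refine (real_inner_le_norm _ _).trans ?_
      nlinarith [K.le_opNorm D, norm_nonneg D]
    have h4 : ‖K‖ ≤ c / 24 := by nlinarith [norm_nonneg K]
    rw [pertOp_apply, inner_sub_right, real_inner_smul_right, inner_sub_right,
      real_inner_smul_right, real_inner_self_eq_norm_sq, real_inner_comm e D]
    nlinarith [mul_le_mul_of_nonneg_right h4 (sq_nonneg ‖D‖), mul_le_mul_of_nonneg_left h2 hc.le,
      mul_nonneg hc.le (sq_nonneg ‖D‖)]

/-- On the complement of the left eigenvector the flow of `2 (M - β)` decays exponentially, by the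
energy identity. -/
lemma exists_decaying_flow [CompleteSpace V] (M : V →L[ℝ] V) {β δ : ℝ} {N' : V}
    (hN' : ∀ x, ⟪N', M x⟫ = β * ⟪N', x⟫)
    (hδ : ∀ D, ⟪N', D⟫ = 0 → ⟪D, M D⟫ ≤ -δ * ‖D‖ ^ 2) {D₀ : V} (hD₀ : ⟪N', D₀⟫ = 0) :
    ∃ D : ℝ → V, D 0 = D₀ ∧ (∀ t, HasDerivAt D ((2 : ℝ) • (M (D t) - β • D t)) t) ∧
      ∀ t, 0 ≤ t → ‖D t‖ ≤ Real.exp (-(2 * (δ + β)) * t) * ‖D₀‖ := by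
  let L : V →L[ℝ] V := (2 : ℝ) • (M - β • ContinuousLinearMap.id ℝ V)
  let D : ℝ → V := fun t => NormedSpace.exp (t • L) D₀
  have hder : ∀ t, HasDerivAt D ((2 : ℝ) • (M (D t) - β • D t)) t := by
    intro t
    have h := (hasDerivAt_exp_smul_const' (𝕂 := ℝ) L t).clm_apply (hasDerivAt_const t D₀)
    convert h using 1
    simp [L, D]
  have hD0 : D 0 = D₀ := by simp [D]
  have horth : ∀ t, ⟪N', D t⟫ = 0 := by
    have hdiff : ∀ t, HasDerivAt (fun t => ⟪N', D t⟫) 0 t := by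
      intro t
      have h := (hasDerivAt_const t N').inner ℝ (hder t)
      have h0 : ⟪N', (2 : ℝ) • (M (D t) - β • D t)⟫ + ⟪(0 : V), D t⟫ = 0 := by
        simp [inner_sub_right, real_inner_smul_right, hN']
      rw [h0] at h
      exact h
    intro t
    have := is_const_of_deriv_eq_zero (fun t => (hdiff t).differentiableAt)
      (fun t => (hdiff t).deriv) t 0
    rw [this, hD0, hD₀]
  refine ⟨D, hD0, hder, fun t ht => ?_⟩
  set γ := 2 * (δ + β)
  have hE : ∀ t, HasDerivAt (fun t => Real.exp (2 * γ * t) * ‖D t‖ ^ 2)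
      (Real.exp (2 * γ * t) * (2 * γ) * ‖D t‖ ^ 2
        + Real.exp (2 * γ * t) * (2 * ⟪D t, (2 : ℝ) • (M (D t) - β • D t)⟫)) t := by
    intro t
    have h1 : HasDerivAt (fun t => Real.exp (2 * γ * t)) (Real.exp (2 * γ * t) * (2 * γ)) t := by
      simpa using ((hasDerivAt_id t).const_mul (2 * γ)).exp
    exact h1.mul (hder t).norm_sq
  have hanti : Antitone fun t => Real.exp (2 * γ * t) * ‖D t‖ ^ 2 := by
    refine antitone_of_hasDerivAt_nonpos hE fun t => ?_
    have h1 := hδ _ (horth t)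
    rw [real_inner_smul_right, inner_sub_right, real_inner_smul_right, real_inner_self_eq_norm_sq]
    have h2 : Real.exp (2 * γ * t) * (2 * γ) * ‖D t‖ ^ 2 + Real.exp (2 * γ * t) *
        (2 * (2 * (⟪D t, M (D t)⟫ - β * ‖D t‖ ^ 2)))
        = 4 * Real.exp (2 * γ * t) * (⟪D t, M (D t)⟫ - (-δ * ‖D t‖ ^ 2)) := by
      simp only [γ]; ring
    rw [h2]
    exact mul_nonpos_of_nonneg_of_nonpos (by positivity) (by linarith)
  have h3 := hanti ht
  simp only [mul_zero, Real.exp_zero, one_mul, hD0] at h3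
  refine le_of_sq_le_sq ?_ (by positivity)
  rw [mul_pow, ← Real.exp_nat_mul]
  calc ‖D t‖ ^ 2 = Real.exp (-(2 * γ * t)) * (Real.exp (2 * γ * t) * ‖D t‖ ^ 2) := by
        rw [← mul_assoc, ← Real.exp_add, neg_add_cancel, Real.exp_zero, one_mul]
    _ ≤ Real.exp (-(2 * γ * t)) * ‖D₀‖ ^ 2 := by gcongr
    _ = _ := by congr 2; push_cast; ring

end Spectral

/-! ### The second-moment eigenvalue problem -/

/-- Real matrices as a Euclidean space, with the Frobenius inner product. -/
def matVec : Matrix (Fin d) (Fin d) ℝ ≃ₗ[ℝ] EuclideanSpace ℝ (Fin d × Fin d) where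
  toFun B := WithLp.toLp 2 fun x => B x.1 x.2
  invFun v := Matrix.of fun i j => v (i, j)
  map_add' _ _ := rfl
  map_smul' _ _ := rfl
  left_inv _ := rfl
  right_inv _ := rfl

/-- The Frobenius inner product. -/
def frob (B C : Matrix (Fin d) (Fin d) ℝ) : ℝ := ⟪matVec B, matVec C⟫

lemma frob_eq_sum (B C : Matrix (Fin d) (Fin d) ℝ) : frob B C = ∑ i, ∑ j, B i j * C i j := by
  simp only [frob, PiLp.inner_apply, Fintype.sum_prod_type]
  exact Finset.sum_congr rfl fun i _ => Finset.sum_congr rfl fun j _ => mul_comm _ _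

lemma norm_matVec_sq (B : Matrix (Fin d) (Fin d) ℝ) : ‖matVec B‖ ^ 2 = frob B B :=
  (real_inner_self_eq_norm_sq _).symm

lemma frob_comm (B C : Matrix (Fin d) (Fin d) ℝ) : frob B C = frob C B := real_inner_comm _ _

lemma abs_entry_le_norm_matVec (B : Matrix (Fin d) (Fin d) ℝ) (i j : Fin d) :
    |B i j| ≤ ‖matVec B‖ := by
  simpa using! PiLp.norm_apply_le (matVec B) (i, j)

lemma norm_matVec_le {B : Matrix (Fin d) (Fin d) ℝ} {M : ℝ} (hM : 0 ≤ M)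
    (h : ∀ i j, |B i j| ≤ M) : ‖matVec B‖ ≤ d * M := by
  refine le_of_sq_le_sq ?_ (by positivity)
  rw [norm_matVec_sq, frob_eq_sum]
  calc ∑ i, ∑ j, B i j * B i j ≤ ∑ _i : Fin d, ∑ _j : Fin d, M ^ 2 := by
        refine Finset.sum_le_sum fun i _ => Finset.sum_le_sum fun j _ => ?_
        rw [← sq, ← sq_abs]
        exact pow_le_pow_left₀ (abs_nonneg _) (h i j) 2
    _ = _ := by simp; ring

/-- A quadratic form is bounded by the Frobenius norm. -/
lemma abs_qf_le (B : Matrix (Fin d) (Fin d) ℝ) (k : E d) : |qf B k| ≤ ‖matVec B‖ * ‖k‖ ^ 2 := by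
  have h1 : qf B k = ⟪matVec B, matVec (Matrix.of fun i j => k i * k j)⟫ := by
    change _ = frob _ _
    rw [frob_eq_sum, qf]
    exact Finset.sum_congr rfl fun j _ => Finset.sum_congr rfl fun l _ => by
      simp only [Matrix.of_apply]; ring
  have h2 : ‖matVec (Matrix.of fun i j => k i * k j)‖ ^ 2 = (‖k‖ ^ 2) ^ 2 := by
    rw [norm_matVec_sq, frob_eq_sum, EuclideanSpace.real_norm_sq_eq, sq (∑ i, k i ^ 2),
      Finset.sum_mul_sum]
    exact Finset.sum_congr rfl fun j _ => Finset.sum_congr rfl fun l _ => by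
      simp only [Matrix.of_apply]; ring
  have h3 : ‖matVec (Matrix.of fun i j => k i * k j)‖ = ‖k‖ ^ 2 :=
    (pow_left_inj₀ (norm_nonneg _) (by positivity) two_ne_zero).1 h2
  rw [h1, ← h3]
  exact abs_real_inner_le_norm _ _

lemma act_apply (A : Matrix (Fin d) (Fin d) ℝ) (k : E d) (i : Fin d) :
    act A k i = ∑ j, A i j * k j := by
  simp [act, Matrix.mulVec, dotProduct]

lemma abs_entry_le_norm_act (A : Matrix (Fin d) (Fin d) ℝ) (i j : Fin d) :
    |A i j| ≤ ‖act A‖ := by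
  have h1 : act A (EuclideanSpace.single j 1) i = A i j := by
    rw [act_apply, Finset.sum_eq_single j] <;> simp +contextual
  rw [← h1, ← Real.norm_eq_abs]
  refine (PiLp.norm_apply_le _ _).trans ((ContinuousLinearMap.le_opNorm _ _).trans ?_)
  simp

/-- The contribution `-½ (BA + AᵀB)` of the shear to the second-moment operator. -/
def shearMoment (A : Matrix (Fin d) (Fin d) ℝ) :
    Matrix (Fin d) (Fin d) ℝ →ₗ[ℝ] Matrix (Fin d) (Fin d) ℝ where
  toFun B := (-(1 / 2) : ℝ) • (B * A + A.transpose * B)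
  map_add' B C := by rw [add_mul, mul_add]; module
  map_smul' r B := by
    rw [Matrix.smul_mul, Matrix.mul_smul, RingHom.id_apply]; module

lemma shearMoment_apply (A B : Matrix (Fin d) (Fin d) ℝ) :
    shearMoment A B = (-(1 / 2) : ℝ) • (B * A + A.transpose * B) := rfl

/-- `shearMoment` as an operator on the Euclidean space of matrices. -/
def shearOp (A : Matrix (Fin d) (Fin d) ℝ) :
    EuclideanSpace ℝ (Fin d × Fin d) →L[ℝ] EuclideanSpace ℝ (Fin d × Fin d) :=
  LinearMap.toContinuousLinearMap
    (matVec.toLinearMap ∘ₗ shearMoment A ∘ₗ matVec.symm.toLinearMap)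

lemma shearOp_matVec (A B : Matrix (Fin d) (Fin d) ℝ) :
    shearOp A (matVec B) = matVec (shearMoment A B) := rfl

lemma norm_shearOp_le (A : Matrix (Fin d) (Fin d) ℝ) : ‖shearOp A‖ ≤ (d : ℝ) ^ 2 * ‖act A‖ := by
  refine ContinuousLinearMap.opNorm_le_bound _ (by positivity) fun v => ?_
  obtain ⟨B, rfl⟩ := matVec.surjective v
  rw [shearOp_matVec]
  have hprod : ∀ (P Q : Matrix (Fin d) (Fin d) ℝ) (a b : ℝ), (∀ i j, |P i j| ≤ a) →
      (∀ i j, |Q i j| ≤ b) → ∀ i j, |(P * Q) i j| ≤ d * (a * b) := by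
    intro P Q a b hP hQ i j
    rw [Matrix.mul_apply]
    refine (Finset.abs_sum_le_sum_abs _ _).trans ?_
    calc ∑ m, |P i m * Q m j| ≤ ∑ _m : Fin d, a * b := by
          refine Finset.sum_le_sum fun m _ => ?_
          rw [abs_mul]
          exact mul_le_mul (hP i m) (hQ m j) (abs_nonneg _) ((abs_nonneg _).trans (hP i m))
      _ = d * (a * b) := by simp
  refine (norm_matVec_le (M := d * (‖matVec B‖ * ‖act A‖)) (by positivity) fun i j => ?_).trans
    (le_of_eq (by ring))
  have h1 := hprod B A _ _ (abs_entry_le_norm_matVec B) (abs_entry_le_norm_act A) i j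
  have h2 := hprod A.transpose B _ _ (fun i j => abs_entry_le_norm_act A j i)
    (abs_entry_le_norm_matVec B) i j
  rw [shearMoment_apply, Matrix.smul_apply, Matrix.add_apply, smul_eq_mul, abs_mul]
  have h3 : |(-(1 / 2) : ℝ)| = 1 / 2 := by norm_num
  rw [h3]
  have := abs_add_le ((B * A) i j) ((A.transpose * B) i j)
  rw [mul_comm ‖act A‖] at h2
  linarith

/-- The real second-moment operator on all matrices; on symmetric ones it is the restriction of
`momentOp`. -/
def realMoment (A : Matrix (Fin d) (Fin d) ℝ) (q : ℝ) (B : Matrix (Fin d) (Fin d) ℝ) :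
    Matrix (Fin d) (Fin d) ℝ :=
  shearMoment A B - (1 / 2 : ℝ) • (B - gainMoment q B)

/-- The spectral gap `q d / (4 (d - 1))` of the second-moment operator at `A = 0`. -/
def gap (d : ℕ) (q : ℝ) : ℝ := q * d / (4 * ((d : ℝ) - 1))

/-- The normalised identity matrix, the leading eigenvector at `A = 0`. -/
def idVec (d : ℕ) : EuclideanSpace ℝ (Fin d × Fin d) := matVec ((√d)⁻¹ • 1)

lemma inner_idVec (B : Matrix (Fin d) (Fin d) ℝ) : ⟪idVec d, matVec B⟫ = (√d)⁻¹ * B.trace := by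
  change frob _ _ = _
  rw [frob_eq_sum, Matrix.trace, Finset.mul_sum]
  refine Finset.sum_congr rfl fun i _ => ?_
  rw [Finset.sum_eq_single i]
  · simp
  · intro j _ hj; simp [hj.symm]
  · simp

lemma norm_idVec (hd : 2 ≤ d) : ‖idVec d‖ = 1 := by
  have hd0 : (0 : ℝ) < d := by exact_mod_cast (by omega : 0 < d)
  have h : ‖idVec d‖ ^ 2 = 1 := by
    rw [← real_inner_self_eq_norm_sq]
    conv_lhs => rw [idVec]
    change ⟪idVec d, _⟫ = _
    rw [inner_idVec, Matrix.trace_smul, Matrix.trace_one, smul_eq_mul, ← mul_assoc, ← mul_inv,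
      Fintype.card_fin, Real.mul_self_sqrt hd0.le, inv_mul_cancel₀ hd0.ne']
  exact (pow_eq_one_iff_of_nonneg (norm_nonneg _) two_ne_zero).1 h

lemma matVec_realMoment (hd : 2 ≤ d) (A : Matrix (Fin d) (Fin d) ℝ) (q : ℝ)
    (B : Matrix (Fin d) (Fin d) ℝ) :
    matVec (realMoment A q B) = pertOp (gap d q) (idVec d) (shearOp A) (matVec B) := by
  have hd0 : (0 : ℝ) < d := by exact_mod_cast (by omega : 0 < d)
  have hd1 : (d : ℝ) - 1 ≠ 0 := by
    have : (2 : ℝ) ≤ d := by exact_mod_cast hd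
    linarith
  rw [pertOp_apply, shearOp_matVec, inner_idVec, idVec, ← map_smul, ← map_sub, ← map_smul,
    ← map_sub]
  congr 1
  rw [realMoment, gainMoment, smul_smul, gap]
  congr 1
  have h1 : (√d)⁻¹ * B.trace * (√d)⁻¹ = B.trace / d := by
    rw [mul_right_comm, ← mul_inv, Real.mul_self_sqrt hd0.le]; ring
  rw [h1, sub_sub_cancel, smul_smul]
  congr 1
  field_simp
  ring

lemma realMoment_transpose (A : Matrix (Fin d) (Fin d) ℝ) (q : ℝ)
    (B : Matrix (Fin d) (Fin d) ℝ) :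
    realMoment A q B.transpose = (realMoment A q B).transpose := by
  simp only [realMoment, gainMoment, shearMoment_apply, Matrix.transpose_sub,
    Matrix.transpose_smul, Matrix.transpose_add, Matrix.transpose_mul, Matrix.transpose_transpose,
    Matrix.transpose_one, Matrix.trace_transpose]
  rw [add_comm (B.transpose * A)]

lemma realMoment_add (A : Matrix (Fin d) (Fin d) ℝ) (q : ℝ) (B C : Matrix (Fin d) (Fin d) ℝ) :
    realMoment A q (B + C) = realMoment A q B + realMoment A q C := by
  simp only [realMoment, gainMoment, map_add, Matrix.trace_add, add_div]; module

lemma realMoment_smul (A : Matrix (Fin d) (Fin d) ℝ) (q r : ℝ) (B : Matrix (Fin d) (Fin d) ℝ) :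
    realMoment A q (r • B) = r • realMoment A q B := by
  simp only [realMoment, gainMoment, map_smul, Matrix.trace_smul, smul_eq_mul, mul_div_assoc]
  module

/-- The spectral data of the second-moment operator for small `A`: a leading eigenvalue `β` with a
symmetric positive definite eigenvector `N`, `|N|² = d`, a left eigenvector `N'` that is nonnegative
on positive semidefinite matrices, and decay on the complement of `N'`. -/
structure SpectralData (A : Matrix (Fin d) (Fin d) ℝ) (q β : ℝ)
    (N N' : Matrix (Fin d) (Fin d) ℝ) : Prop where
  eig : realMoment A q N = β • N
  symm : N.transpose = N
  posDef : ∀ k : E d, k ≠ 0 → 0 < qf N k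
  norm_sq : frob N N = d
  left : ∀ B, frob N' (realMoment A q B) = β * frob N' B
  pairing : 1 / 4 ≤ frob N' N
  norm_left : ‖matVec N'‖ ≤ 2
  nonneg : ∀ B : Matrix (Fin d) (Fin d) ℝ, B.transpose = B → (∀ k : E d, 0 ≤ qf B k) →
    0 ≤ frob N' B
  coercive : ∀ D, frob N' D = 0 → frob D (realMoment A q D) ≤ -(gap d q / 2) * frob D D
  gap_lt : |β| < gap d q / 2

/-- The eigenspace of an eigenvalue above the spectrum on the complement of the left eigenvector is
one-dimensional. -/
lemma eigenvector_eq_smul {A : Matrix (Fin d) (Fin d) ℝ} {q β δ : ℝ}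
    {N N' : Matrix (Fin d) (Fin d) ℝ} (hN : realMoment A q N = β • N) (hp : 0 < frob N' N)
    (hδ : ∀ D, frob N' D = 0 → frob D (realMoment A q D) ≤ -δ * frob D D) (hβ : -δ < β)
    {X : Matrix (Fin d) (Fin d) ℝ} (hX : realMoment A q X = β • X) :
    X = (frob N' X / frob N' N) • N := by
  set a := frob N' X / frob N' N with ha
  set D := X + (-a) • N with hD
  have h1 : frob N' D = 0 := by
    rw [hD, frob, map_add, map_smul, inner_add_right, real_inner_smul_right]
    change frob N' X + -a * frob N' N = 0
    rw [ha]; field_simp; ring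
  have h2 : realMoment A q D = β • D := by
    rw [hD, realMoment_add, realMoment_smul, hX, hN]; module
  have h3 := hδ D h1
  rw [h2, frob, map_smul, real_inner_smul_right] at h3
  change β * frob D D ≤ _ at h3
  have h4 : frob D D = 0 := by
    have h5 : 0 ≤ frob D D := by rw [← norm_matVec_sq]; positivity
    nlinarith
  have h7 : D = 0 := by
    rw [← norm_matVec_sq, sq_eq_zero_iff, norm_eq_zero] at h4
    exact matVec.map_eq_zero_iff.1 h4
  have h8 : X - a • N = 0 := by rw [← h7, hD]; module
  exact sub_eq_zero.1 h8

lemma SpectralData.eq_smul {A : Matrix (Fin d) (Fin d) ℝ} {q β : ℝ}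
    {N N' : Matrix (Fin d) (Fin d) ℝ} (h : SpectralData A q β N N')
    {X : Matrix (Fin d) (Fin d) ℝ} (hX : realMoment A q X = β • X) :
    X = (frob N' X / frob N' N) • N :=
  eigenvector_eq_smul h.eig (by linarith [h.pairing]) h.coercive (abs_lt.1 h.gap_lt).1 hX

/-- The entries of a positive semidefinite matrix are bounded by its trace. -/
lemma abs_entry_le_trace {B : Matrix (Fin d) (Fin d) ℝ} (hs : B.transpose = B)
    (hB : ∀ k : E d, 0 ≤ qf B k) (i j : Fin d) : |B i j| ≤ B.trace := by
  have hqs : ∀ x : E d, qf B x = ∑ a, ∑ b, B a b * x a * x b := fun _ => rfl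
  have hdiag : ∀ i, 0 ≤ B i i := by
    intro i
    have := hB (EuclideanSpace.single i 1)
    rw [hqs, Finset.sum_eq_single i] at this
    · rw [Finset.sum_eq_single i] at this
      · simpa using this
      · intro l _ hl; simp [hl]
      · simp
    · intro l _ hl; simp [hl]
    · simp
  have htr : ∀ i, B i i ≤ B.trace := fun i =>
    Finset.single_le_sum (f := fun i => B i i) (fun i _ => hdiag i) (Finset.mem_univ i)
  by_cases hij : i = j
  · subst hij; rw [abs_of_nonneg (hdiag i)]; exact htr i
  have htr2 : B i i + B j j ≤ B.trace := by
    have : ∑ a ∈ ({i, j} : Finset (Fin d)), B a a ≤ B.trace :=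
      Finset.sum_le_sum_of_subset_of_nonneg (Finset.subset_univ _) fun a _ _ => hdiag a
    rwa [Finset.sum_pair hij] at this
  have hji : B j i = B i j := by conv_lhs => rw [← hs, Matrix.transpose_apply]
  have hval : ∀ s : ℝ, qf B (EuclideanSpace.single i 1 + s • EuclideanSpace.single j 1)
      = B i i + s * (2 * B i j) + s ^ 2 * B j j := by
    intro s
    have hc : ∀ a, (EuclideanSpace.single i (1 : ℝ) + s • EuclideanSpace.single j (1 : ℝ) : E d) a
        = (if a = i then 1 else 0) + s * (if a = j then 1 else 0) := fun a => by
      simp [PiLp.single_apply]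
    rw [hqs]
    simp only [hc, mul_add, add_mul, Finset.sum_add_distrib]
    simp [mul_comm]
    rw [hji]; ring
  have hp := hB (EuclideanSpace.single i 1 + (1 : ℝ) • EuclideanSpace.single j 1)
  have hm := hB (EuclideanSpace.single i 1 + (-1 : ℝ) • EuclideanSpace.single j 1)
  rw [hval] at hp hm
  rw [abs_le]
  constructor <;> nlinarith [hdiag i, hdiag j]

/-- Perturbation of `A = 0`, where `β = 0`, `N = I` and `N'` is a multiple of `I`. The bound for
`|β|` makes the flow `e^{-τ A_β}` slow for small `A`. -/
theorem exists_spectralData (hd : 2 ≤ d) {q : ℝ} (hq : 0 < q) :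
    ∃ ε₁ : ℝ, 0 < ε₁ ∧ ∀ A : Matrix (Fin d) (Fin d) ℝ, ‖act A‖ ≤ ε₁ →
      ∃ (β : ℝ) (N N' : Matrix (Fin d) (Fin d) ℝ), |β| ≤ 2 * (d : ℝ) ^ 2 * ‖act A‖ ∧
        SpectralData A q β N N' := by
  have hd2 : (2 : ℝ) ≤ d := by exact_mod_cast hd
  have hd0 : (0 : ℝ) < d := by linarith
  have hc : 0 < gap d q := by
    unfold gap
    exact div_pos (by positivity) (by linarith)
  set c := gap d q with hcdef
  -- with this distance from the normalised identity, `N` is positive definite and `N'` is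
  -- nonnegative on positive semidefinite matrices
  set ρ : ℝ := 1 / (2 * d ^ 2) with hρdef
  have hρ : 0 < ρ := by positivity
  have hsq1 : 1 ≤ √d := by rw [Real.one_le_sqrt]; linarith
  have hsqd : √d ≤ d := by
    rw [Real.sqrt_le_left hd0.le]; nlinarith
  have hρs : 2 * (ρ * d) ≤ (√d)⁻¹ := by
    have h1 : 2 * (ρ * d) = (d : ℝ)⁻¹ := by rw [hρdef]; field_simp
    rw [h1]
    exact inv_anti₀ (by linarith) hsqd
  have hρd : ρ ≤ ρ * d := by nlinarith
  have hρ2 : ρ ≤ 1 / 2 := by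
    have : (√d)⁻¹ ≤ 1 := inv_le_one_of_one_le₀ hsq1
    linarith
  refine ⟨ρ * c / (12 * d ^ 2), by positivity, fun A hA => ?_⟩
  have hK : 12 * ‖shearOp A‖ ≤ ρ * c := by
    have h1 := norm_shearOp_le A
    rw [le_div_iff₀ (by positivity)] at hA
    linarith
  obtain ⟨β, n, n', hn, hn', hen, hβ, heig, hleft, hpair, hcoer⟩ :=
    exists_spectral_pertOp hc hρ hρ2 (norm_idVec hd) hK
  obtain ⟨N, rfl⟩ := matVec.surjective n
  obtain ⟨N', rfl⟩ := matVec.surjective n'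
  have hβc : |β| < c / 2 := by
    have : ρ * c ≤ 1 / 2 * c := mul_le_mul_of_nonneg_right hρ2 hc.le
    linarith
  have hnN : ‖matVec N‖ ≤ 3 / 2 := by
    have := norm_add_le (matVec N - idVec d) (idVec d)
    rw [sub_add_cancel, norm_idVec hd] at this; linarith
  have hnN1 : 1 ≤ ‖matVec N‖ := by
    have := real_inner_le_norm (idVec d) (matVec N)
    rwa [hen, norm_idVec hd, one_mul] at this
  have hnN' : ‖matVec N'‖ ≤ 2 := by
    have := norm_add_le (matVec N' - idVec d) (idVec d)
    rw [sub_add_cancel, norm_idVec hd] at this; linarith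
  -- the factor that normalises `N`
  set s : ℝ := √d / ‖matVec N‖ with hs
  have hs0 : 0 < s := by positivity
  have heig' : realMoment A q N = β • N := by
    apply matVec.injective
    rw [matVec_realMoment hd, heig, map_smul]
  have hposN : ∀ k : E d, k ≠ 0 → 0 < qf N k := by
    intro k hk
    have hk2 : 0 < ‖k‖ ^ 2 := by positivity
    have h1 := abs_qf_le (N - (√d)⁻¹ • 1) k
    have h2 : ‖matVec (N - (√d)⁻¹ • (1 : Matrix (Fin d) (Fin d) ℝ))‖ ≤ ρ := by
      rw [map_sub]; exact hn
    rw [qf_sub, qf_smul, qf_one] at h1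
    have h3 := (abs_le.1 h1).1
    have h4 := mul_le_mul_of_nonneg_right h2 hk2.le
    have h5 : ρ < (√d)⁻¹ := by linarith
    have h6 := mul_lt_mul_of_pos_right h5 hk2
    linarith
  have hcoer' : ∀ D, frob N' D = 0 → frob D (realMoment A q D) ≤ -(c / 2) * frob D D := by
    intro D hD
    rw [frob, matVec_realMoment hd, ← norm_matVec_sq]
    exact hcoer _ hD
  have hpair' : 1 / 4 ≤ frob N' (s • N) := by
    rw [frob, map_smul, real_inner_smul_right]
    have : 1 / 2 ≤ s := by
      rw [hs, le_div_iff₀ (by linarith)]; linarith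
    nlinarith
  have hfin : ∀ hsym : (s • N).transpose = s • N, SpectralData A q β (s • N) N' := by
    intro hsym
    refine ⟨by rw [realMoment_smul, heig', smul_comm], hsym, fun k hk => ?_, ?_, fun B => ?_, hpair',
      hnN', fun B hB hB0 => ?_, hcoer', hβc⟩
    · rw [qf_smul]; exact mul_pos hs0 (hposN k hk)
    · rw [← norm_matVec_sq, map_smul, norm_smul, Real.norm_of_nonneg hs0.le, hs,
        div_mul_cancel₀ _ (by linarith), Real.sq_sqrt hd0.le]
    · rw [frob, matVec_realMoment hd, hleft]; rfl
    · have htr0 : 0 ≤ B.trace := (abs_nonneg _).trans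
        (abs_entry_le_trace hB hB0 ⟨0, by omega⟩ ⟨0, by omega⟩)
      have h1 : ‖matVec B‖ ≤ d * B.trace := norm_matVec_le htr0 (abs_entry_le_trace hB hB0)
      have h2 : frob N' B = (√d)⁻¹ * B.trace + ⟪matVec N' - idVec d, matVec B⟫ := by
        rw [inner_sub_left, inner_idVec, frob]; ring
      have h3 := (abs_le.1 (abs_real_inner_le_norm (matVec N' - idVec d) (matVec B))).1
      have h4 : ‖matVec N' - idVec d‖ * ‖matVec B‖ ≤ ρ * (d * B.trace) := by gcongr
      have h5 := mul_le_mul_of_nonneg_right hρs htr0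
      rw [h2]
      nlinarith [mul_nonneg (mul_nonneg hρ.le hd0.le) htr0]
  refine ⟨β, s • N, N', ?_, hfin ?_⟩
  · have := norm_shearOp_le A
    linarith
  -- the eigenvalue is simple and `Nᵀ` is another eigenvector with the same trace
  · have hN'N : 1 / 2 ≤ frob N' N := hpair
    have h8 := eigenvector_eq_smul heig' (by linarith) hcoer' (abs_lt.1 hβc).1 (X := N.transpose)
      (by rw [realMoment_transpose, heig', Matrix.transpose_smul])
    have h9 : N.trace ≠ 0 := by
      intro h0
      rw [inner_idVec, h0, mul_zero] at hen
      exact zero_ne_one hen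
    have h10 : frob N' N.transpose / frob N' N = 1 := by
      have := congrArg Matrix.trace h8
      rw [Matrix.trace_transpose, Matrix.trace_smul, smul_eq_mul] at this
      exact (mul_right_cancel₀ h9 (by rw [one_mul]; exact this)).symm
    rw [Matrix.transpose_smul, h8, h10, one_smul]

/-! ### The complex eigenvalue problem -/

lemma momentForm_eq_realMoment (A : Matrix (Fin d) (Fin d) ℝ) (q : ℝ)
    {B : Matrix (Fin d) (Fin d) ℝ} (hB : B.transpose = B) :
    momentForm A q B = (-2 : ℝ) • realMoment A q B := by
  rw [momentForm, realMoment, shearMoment_apply, gainMoment, Matrix.transpose_mul, hB]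
  module

lemma momentOp_map_re (A : Matrix (Fin d) (Fin d) ℝ) (q : ℝ) (x : symmMat d) :
    (momentOp A q x).1.map Complex.re = realMoment A q (x.1.map Complex.re) := by
  have hx : x.1.transpose = x.1 := x.2
  have hc : (q : ℂ) * d / (2 * ((d : ℂ) - 1)) = ((q * d / (2 * ((d : ℝ) - 1)) : ℝ) : ℂ) := by
    push_cast; ring
  have hcoe : (momentOp A q x).1
      = (-(1 / 2) : ℂ) • momentForm (A.map ((↑) : ℝ → ℂ)) (q : ℂ) x.1 := rfl
  have htr : (x.1.trace / d).re = (x.1.map Complex.re).trace / d := by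
    have : x.1.trace / d = x.1.trace / ((d : ℝ) : ℂ) := by push_cast; rfl
    rw [this, Complex.div_ofReal_re, Matrix.trace, Complex.re_sum]; rfl
  have hh : (-(1 / 2) : ℂ) = ((-(1 / 2) : ℝ) : ℂ) := by push_cast; ring
  rw [hcoe, realMoment, shearMoment_apply, gainMoment, momentForm, Matrix.transpose_mul, hx, hc, hh]
  ext i j
  simp only [Matrix.map_apply, Matrix.smul_apply, Matrix.add_apply, Matrix.sub_apply, smul_eq_mul,
    Complex.re_ofReal_mul, Complex.add_re, Complex.sub_re, Matrix.mul_apply, Complex.re_sum,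
    Complex.re_mul_ofReal, Matrix.transpose_apply, ← htr]
  by_cases hij : i = j
  · subst hij; simp only [Matrix.one_apply_eq, mul_one]; ring
  · simp only [Matrix.one_apply_ne hij, mul_zero, Complex.zero_re]; ring

lemma momentOp_map_im (A : Matrix (Fin d) (Fin d) ℝ) (q : ℝ) (x : symmMat d) :
    (momentOp A q x).1.map Complex.im = realMoment A q (x.1.map Complex.im) := by
  have h := momentOp_map_re A q ((-Complex.I) • x)
  have h1 : ∀ B : Matrix (Fin d) (Fin d) ℂ, ((-Complex.I) • B).map Complex.re = B.map Complex.im :=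
    fun B => by ext i j; simp
  rwa [map_smul, Submodule.coe_smul, Submodule.coe_smul, h1, h1] at h

lemma symmMat_ext {x y : symmMat d} (hre : x.1.map Complex.re = y.1.map Complex.re)
    (him : x.1.map Complex.im = y.1.map Complex.im) : x = y := by
  ext i j
  exact Complex.ext (congrFun (congrFun hre i) j) (congrFun (congrFun him i) j)

lemma map_re_smul (z : ℂ) (x : symmMat d) : (z • x).1.map Complex.re
    = z.re • x.1.map Complex.re + (-z.im) • x.1.map Complex.im := by
  ext i j; simp [Complex.mul_re]; ring

lemma map_im_smul (z : ℂ) (x : symmMat d) : (z • x).1.map Complex.im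
    = z.im • x.1.map Complex.re + z.re • x.1.map Complex.im := by
  ext i j; simp [Complex.mul_im]; ring

/-- A real symmetric matrix as a complex one. -/
def toSymmMat (N : Matrix (Fin d) (Fin d) ℝ) (hN : N.transpose = N) : symmMat d :=
  ⟨N.map ((↑) : ℝ → ℂ), by
    change (N.map _).transpose = _
    rw [← Matrix.transpose_map, hN]⟩

lemma toSymmMat_re (N : Matrix (Fin d) (Fin d) ℝ) (hN : N.transpose = N) :
    (toSymmMat N hN).1.map Complex.re = N := by ext i j; simp [toSymmMat]

lemma toSymmMat_im (N : Matrix (Fin d) (Fin d) ℝ) (hN : N.transpose = N) :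
    (toSymmMat N hN).1.map Complex.im = 0 := by ext i j; simp [toSymmMat]

lemma frob_add_right (B C D : Matrix (Fin d) (Fin d) ℝ) : frob B (C + D) = frob B C + frob B D := by
  rw [frob, map_add, inner_add_right]; rfl

lemma frob_smul_right (r : ℝ) (B C : Matrix (Fin d) (Fin d) ℝ) : frob B (r • C) = r * frob B C := by
  rw [frob, map_smul, real_inner_smul_right]; rfl

lemma frob_self_nonneg (B : Matrix (Fin d) (Fin d) ℝ) : 0 ≤ frob B B := by
  rw [← norm_matVec_sq]; positivity

lemma frob_self_eq_zero {B : Matrix (Fin d) (Fin d) ℝ} (h : frob B B = 0) : B = 0 := by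
  rw [← norm_matVec_sq, sq_eq_zero_iff, norm_eq_zero] at h
  exact matVec.map_eq_zero_iff.1 h

section

variable {A : Matrix (Fin d) (Fin d) ℝ} {q β : ℝ} {N N' : Matrix (Fin d) (Fin d) ℝ}

lemma SpectralData.momentOp_eig (h : SpectralData A q β N N') :
    momentOp A q (toSymmMat N h.symm) = (β : ℂ) • toSymmMat N h.symm := by
  apply symmMat_ext
  · rw [momentOp_map_re, map_re_smul, toSymmMat_re, toSymmMat_im, h.eig]; simp
  · rw [momentOp_map_im, map_im_smul, toSymmMat_re, toSymmMat_im]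
    simp [realMoment, gainMoment]

lemma SpectralData.ne_zero (h : SpectralData A q β N N') : toSymmMat N h.symm ≠ 0 := by
  intro h0
  have h1 := toSymmMat_re N h.symm
  rw [h0] at h1
  have h2 := h.pairing
  have h3 : N = 0 := by rw [← h1]; ext i j; simp
  rw [h3, frob, map_zero, inner_zero_right] at h2
  linarith

lemma SpectralData.mem_span_of_eig (h : SpectralData A q β N N') {x : symmMat d}
    (hx : momentOp A q x = (β : ℂ) • x) : x ∈ Submodule.span ℂ {toSymmMat N h.symm} := by
  have h1 := momentOp_map_re A q x
  have h2 := momentOp_map_im A q x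
  rw [hx, map_re_smul] at h1
  rw [hx, map_im_smul] at h2
  simp only [Complex.ofReal_re, Complex.ofReal_im, neg_zero, zero_smul, add_zero, zero_add] at h1 h2
  have h3 := h.eq_smul h1.symm
  have h4 := h.eq_smul h2.symm
  rw [Submodule.mem_span_singleton]
  refine ⟨⟨frob N' (x.1.map Complex.re) / frob N' N, frob N' (x.1.map Complex.im) / frob N' N⟩, ?_⟩
  apply symmMat_ext
  · rw [map_re_smul, toSymmMat_re, toSymmMat_im, smul_zero, add_zero]
    exact h3.symm
  · rw [map_im_smul, toSymmMat_re, toSymmMat_im, smul_zero, add_zero]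
    exact h4.symm

/-- The algebraic simplicity of `β`: the left eigenvector annihilates the range of `M - β` but not
`N`, so there are no Jordan chains. -/
lemma SpectralData.maxGenEigenspace_eq (h : SpectralData A q β N N') :
    (momentOp A q).maxGenEigenspace (β : ℂ) = Submodule.span ℂ {toSymmMat N h.symm} := by
  apply le_antisymm
  · intro x hx
    rw [Module.End.mem_maxGenEigenspace] at hx
    obtain ⟨k, hk⟩ := hx
    induction k generalizing x with
    | zero => simp at hk; simp [hk]
    | succ k ih =>
      rw [pow_succ] at hk
      have h1 := ih hk
      rw [Submodule.mem_span_singleton] at h1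
      obtain ⟨z, hz⟩ := h1
      have hz : z • toSymmMat N h.symm = momentOp A q x - (β : ℂ) • x := hz
      have hre := congrArg (fun y : symmMat d => y.1.map Complex.re) (eq_sub_iff_add_eq.1 hz)
      have him := congrArg (fun y : symmMat d => y.1.map Complex.im) (eq_sub_iff_add_eq.1 hz)
      have hadd : ∀ (f : ℂ →+ ℝ) (y z : symmMat d), (y + z).1.map f = y.1.map f + z.1.map f :=
        fun f y z => by ext i j; simp
      have hre' : (z • toSymmMat N h.symm + (β : ℂ) • x).1.map Complex.re
        = (z • toSymmMat N h.symm).1.map Complex.re + ((β : ℂ) • x).1.map Complex.re :=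
        hadd Complex.reAddGroupHom _ _
      have him' : (z • toSymmMat N h.symm + (β : ℂ) • x).1.map Complex.im
        = (z • toSymmMat N h.symm).1.map Complex.im + ((β : ℂ) • x).1.map Complex.im :=
        hadd Complex.imAddGroupHom _ _
      simp only [hre', him', momentOp_map_re, momentOp_map_im, map_re_smul, map_im_smul,
        toSymmMat_re, toSymmMat_im, Complex.ofReal_re, Complex.ofReal_im, neg_zero, zero_smul,
        add_zero, zero_add, smul_zero] at hre him
      have hp : frob N' N ≠ 0 := by linarith [h.pairing]
      have hzero : ∀ (s : ℝ) (X : Matrix (Fin d) (Fin d) ℝ), s • N + β • X = realMoment A q X →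
          s = 0 := by
        intro s X hs
        have := congrArg (frob N') hs
        rw [frob_add_right, frob_smul_right, frob_smul_right, h.left] at this
        have h0 : s * frob N' N = 0 := by linarith
        exact (mul_eq_zero.1 h0).resolve_right hp
      have hz0 : z = 0 := Complex.ext (hzero _ _ hre) (hzero _ _ him)
      rw [hz0, zero_smul] at hz
      exact h.mem_span_of_eig (sub_eq_zero.1 hz.symm)
  · rw [Submodule.span_singleton_le_iff_mem, Module.End.mem_maxGenEigenspace]
    refine ⟨1, ?_⟩
    rw [pow_one]
    change momentOp A q (toSymmMat N h.symm) - (β : ℂ) • toSymmMat N h.symm = 0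
    rw [h.momentOp_eig, sub_self]

/-- For an eigenvalue `μ ≠ β` with eigenvector `X + iY`, both `X` and `Y` are annihilated by the left
eigenvector, so that adding the coercivity inequalities of `X` and `Y` bounds `Re μ`. -/
lemma SpectralData.isLeadingEigenvalue (h : SpectralData A q β N N') :
    IsLeadingEigenvalue A q β := by
  refine ⟨?_, ?_, fun μ hμ hne => ?_⟩
  · exact Module.End.hasEigenvalue_of_hasEigenvector
      (Module.End.hasEigenvector_iff.2 ⟨Module.End.mem_eigenspace_iff.2 h.momentOp_eig, h.ne_zero⟩)
  · rw [h.maxGenEigenspace_eq]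
    exact finrank_span_singleton h.ne_zero
  · obtain ⟨x, hx⟩ := hμ.exists_hasEigenvector
    have hx1 := hx.apply_eq_smul
    have hx0 := hx.2
    set X := x.1.map Complex.re with hX
    set Y := x.1.map Complex.im with hY
    have h1 : realMoment A q X = μ.re • X + (-μ.im) • Y := by
      rw [hX, ← momentOp_map_re, hx1, map_re_smul]
    have h2 : realMoment A q Y = μ.im • X + μ.re • Y := by
      rw [hY, ← momentOp_map_im, hx1, map_im_smul]
    have h3 := h.left X
    have h4 := h.left Y
    rw [h1, frob_add_right, frob_smul_right, frob_smul_right] at h3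
    rw [h2, frob_add_right, frob_smul_right, frob_smul_right] at h4
    have hD : 0 < (μ.re - β) ^ 2 + μ.im ^ 2 := by
      by_contra hcon
      have ha : μ.re - β = 0 := by nlinarith [sq_nonneg (μ.re - β), sq_nonneg μ.im]
      have hb : μ.im = 0 := by nlinarith [sq_nonneg (μ.re - β), sq_nonneg μ.im]
      exact hne (Complex.ext (by simpa [sub_eq_zero] using ha) (by simpa using hb))
    have h5 : frob N' X = 0 := by
      have : ((μ.re - β) ^ 2 + μ.im ^ 2) * frob N' X = 0 := by
        linear_combination (μ.re - β) * h3 + μ.im * h4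
      exact (mul_eq_zero.1 this).resolve_left hD.ne'
    have h6 : frob N' Y = 0 := by
      have : ((μ.re - β) ^ 2 + μ.im ^ 2) * frob N' Y = 0 := by
        linear_combination (μ.re - β) * h4 - μ.im * h3
      exact (mul_eq_zero.1 this).resolve_left hD.ne'
    have h7 := h.coercive X h5
    have h8 := h.coercive Y h6
    rw [h1, frob_add_right, frob_smul_right, frob_smul_right] at h7
    rw [h2, frob_add_right, frob_smul_right, frob_smul_right, frob_comm Y X] at h8
    have h9 : 0 < frob X X + frob Y Y := by
      rcases (frob_self_nonneg X).eq_or_lt with h10 | h10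
      · rcases (frob_self_nonneg Y).eq_or_lt with h11 | h11
        · exfalso
          apply hx0
          apply symmMat_ext
          · rw [← hX, frob_self_eq_zero h10.symm]; ext i j; simp
          · rw [← hY, frob_self_eq_zero h11.symm]; ext i j; simp
        · linarith [frob_self_nonneg X]
      · linarith [frob_self_nonneg Y]
    have h12 := (abs_lt.1 h.gap_lt).1
    by_contra hcon
    have h13 : β ≤ μ.re := not_lt.1 hcon
    nlinarith

lemma IsLeadingEigenvalue.unique {β' : ℝ} (h : IsLeadingEigenvalue A q β)
    (h' : IsLeadingEigenvalue A q β') : β = β' := by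
  by_contra hne
  have h1 := h.largest _ h'.eigen (fun hh => hne (by exact_mod_cast hh.symm))
  have h2 := h'.largest _ h.eigen (fun hh => hne (by exact_mod_cast hh))
  simp only [Complex.ofReal_re] at h1 h2
  linarith

lemma posDef_iff_qf {M : Matrix (Fin d) (Fin d) ℝ} :
    M.PosDef ↔ M.transpose = M ∧ ∀ k : E d, k ≠ 0 → 0 < qf M k := by
  rw [Matrix.posDef_iff_dotProduct_mulVec]
  refine and_congr (by rw [Matrix.IsHermitian, Matrix.conjTranspose_eq_transpose_of_trivial]) ?_
  constructor
  · intro h k hk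
    rw [qf_eq_dotProduct]
    simpa using! h (x := k.ofLp) (by simpa using hk)
  · intro h x hx
    have := h (WithLp.toLp 2 x) (by simpa using hx)
    rw [qf_eq_dotProduct] at this
    simpa using! this

lemma SpectralData.isPosDef (h : SpectralData A q β N N') : N.PosDef :=
  posDef_iff_qf.2 ⟨h.symm, h.posDef⟩

lemma trace_transpose_mul_self (B : Matrix (Fin d) (Fin d) ℝ) :
    (B.transpose * B).trace = frob B B := by
  rw [frob_eq_sum, Finset.sum_comm]
  simp only [Matrix.trace, Matrix.diag, Matrix.mul_apply, Matrix.transpose_apply]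

lemma SpectralData.norm_eq (hd : 2 ≤ d) (h : SpectralData A q β N N') :
    (1 / (d : ℝ)) * (N.transpose * N).trace = 1 := by
  have hd0 : (d : ℝ) ≠ 0 := by exact_mod_cast (by omega : d ≠ 0)
  rw [trace_transpose_mul_self, h.norm_sq]
  field_simp

lemma SpectralData.eigenvector (h : SpectralData A q β N N') :
    (2 * β) • N + momentForm A q N = 0 := by
  rw [momentForm_eq_realMoment A q h.symm, h.eig]; module

/-- The normalised positive definite eigenvector is unique. -/
lemma SpectralData.eigenvector_unique (hd : 2 ≤ d) (h : SpectralData A q β N N')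
    {M : Matrix (Fin d) (Fin d) ℝ} (hM : (2 * β) • M + momentForm A q M = 0) (hpos : M.PosDef)
    (hn : (1 / (d : ℝ)) * (M.transpose * M).trace = 1) : M = N := by
  have hd0 : (d : ℝ) ≠ 0 := by exact_mod_cast (by omega : d ≠ 0)
  obtain ⟨hs, hp⟩ := posDef_iff_qf.1 hpos
  have h1 : realMoment A q M = β • M := by
    rw [momentForm_eq_realMoment A q hs] at hM
    have h2 : (-2 : ℝ) • (realMoment A q M - β • M) = 0 := by rw [← hM]; module
    exact sub_eq_zero.1 ((smul_eq_zero.1 h2).resolve_left (by norm_num))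
  have h2 := h.eq_smul h1
  set a := frob N' M / frob N' N
  have he : (e₁Sph hd : E d) ≠ 0 := by
    intro h0
    have := norm_coe_sph (e₁Sph hd)
    rw [h0, norm_zero] at this
    exact zero_ne_one this
  have h3 : 0 < a := by
    have h4 := hp _ he
    rw [h2, qf_smul] at h4
    exact (pos_iff_pos_of_mul_pos h4).2 (h.posDef _ he)
  have h5 : a ^ 2 = 1 := by
    rw [trace_transpose_mul_self, h2, frob_smul_right, frob_comm, frob_smul_right, h.norm_sq] at hn
    field_simp at hn
    exact hn
  have h6 : a = 1 := (pow_eq_one_iff_of_nonneg h3.le two_ne_zero).1 h5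
  rw [h2, h6, one_smul]

end

/-! ### Second moments along the flow -/

lemma sum_mul_mul_eq_dotProduct (D : Matrix (Fin d) (Fin d) ℝ) (u v : Fin d → ℝ) :
    ∑ j, ∑ l, D j l * u j * v l = dotProduct u (D.mulVec v) := by
  simp only [dotProduct, Matrix.mulVec, Finset.mul_sum]
  exact Finset.sum_congr rfl fun j _ => Finset.sum_congr rfl fun l _ => by ring

lemma ofLp_act (A : Matrix (Fin d) (Fin d) ℝ) (x : E d) : (act A x).ofLp = A.mulVec x.ofLp := by
  ext i; rw [act_apply]; rfl

lemma qf_transpose_mul (A D : Matrix (Fin d) (Fin d) ℝ) (x : E d) :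
    qf (A.transpose * D) x = ∑ j, ∑ l, D j l * act A x j * x l := by
  rw [sum_mul_mul_eq_dotProduct, qf_eq_dotProduct, ← Matrix.mulVec_mulVec,
    Matrix.dotProduct_mulVec, Matrix.vecMul_transpose, ofLp_act]

lemma qf_mul (A D : Matrix (Fin d) (Fin d) ℝ) (x : E d) :
    qf (D * A) x = ∑ j, ∑ l, D j l * x j * act A x l := by
  rw [sum_mul_mul_eq_dotProduct, qf_eq_dotProduct, ← Matrix.mulVec_mulVec, ofLp_act]

lemma qf_realMoment (A : Matrix (Fin d) (Fin d) ℝ) (q : ℝ) (D : Matrix (Fin d) (Fin d) ℝ)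
    (x : E d) : qf (realMoment A q D) x = -(1 / 2) * (qf (D * A) x + qf (A.transpose * D) x)
      - (1 / 2) * (qf D x - qf (gainMoment q D) x) := by
  rw [realMoment, shearMoment_apply, qf_sub, qf_smul, qf_smul, qf_add, qf_sub]

lemma hasDerivAt_flow_apply (A : Matrix (Fin d) (Fin d) ℝ) (β τ : ℝ) (k : E d) (i : Fin d) :
    HasDerivAt (fun s => flow A β s k i) (-(act A (flow A β τ k) i + β * flow A β τ k i)) τ := by
  have h1 := (hasDerivAt_flow A β τ).clm_apply (hasDerivAt_const τ k)
  have h2 := (EuclideanSpace.proj (𝕜 := ℝ) i).hasFDerivAt.comp_hasDerivAt τ h1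
  refine h2.congr_deriv ?_
  rw [map_zero, add_zero]
  change (-(act (A + β • (1 : Matrix (Fin d) (Fin d) ℝ)) (flow A β τ k))) i = _
  rw [PiLp.neg_apply, act_apply, act_apply]
  congr 1
  simp only [Matrix.add_apply, Matrix.smul_apply, add_mul, Finset.sum_add_distrib]
  congr 1
  rw [Finset.sum_eq_single i]
  · simp
  · intro j _ hj; simp [hj.symm]
  · simp

/-- Matrix curves that evolve by the second-moment equation `D' = 2 (M - β) D`. -/
def IsMomentFlow (A : Matrix (Fin d) (Fin d) ℝ) (q β : ℝ)
    (D : ℝ → Matrix (Fin d) (Fin d) ℝ) : Prop :=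
  ∀ i j t, HasDerivAt (fun s => D s i j) (2 * (realMoment A q (D t) i j - β * D t i j)) t

lemma isMomentFlow_const {A : Matrix (Fin d) (Fin d) ℝ} {q β : ℝ} {N : Matrix (Fin d) (Fin d) ℝ}
    (hN : realMoment A q N = β • N) : IsMomentFlow A q β fun _ => N := by
  intro i j t
  rw [hN, Matrix.smul_apply, smul_eq_mul, sub_self, mul_zero]
  exact hasDerivAt_const _ _

lemma IsMomentFlow.continuous {A : Matrix (Fin d) (Fin d) ℝ} {q β : ℝ}
    {D : ℝ → Matrix (Fin d) (Fin d) ℝ} (hD : IsMomentFlow A q β D) : Continuous D :=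
  continuous_matrix fun i j => continuous_iff_continuousAt.2 fun t => (hD i j t).continuousAt

/-- The derivative of a moment flow transported along the linear flow; its integral over `[0, t]` is
the mild form of the second-moment equation. -/
lemma IsMomentFlow.hasDerivAt {A : Matrix (Fin d) (Fin d) ℝ} {q β : ℝ}
    {D : ℝ → Matrix (Fin d) (Fin d) ℝ} (hD : IsMomentFlow A q β D) (t τ : ℝ) (k : E d) :
    HasDerivAt (fun s => Real.exp (-s) * qf (D (t - s)) (flow A β s k))
      (-(Real.exp (-τ) * qf (gainMoment q (D (t - τ))) (flow A β τ k))) τ := by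
  have hx := hasDerivAt_flow_apply A β τ k
  have hDs : ∀ i j, HasDerivAt (fun s => D (t - s) i j)
      (-(2 * (realMoment A q (D (t - τ)) i j - β * D (t - τ) i j))) τ := fun i j => by
    have := (hD i j (t - τ)).scomp τ ((hasDerivAt_id τ).const_sub t)
    simpa [Function.comp_def] using this
  set x := flow A β τ k with hxdef
  set C := D (t - τ) with hC
  have hq : HasDerivAt (fun s => qf (D (t - s)) (flow A β s k))
      (∑ i, ∑ j, ((-(2 * (realMoment A q C i j - β * C i j)) * x i
        + C i j * (-(act A x i + β * x i))) * x j + C i j * x i * (-(act A x j + β * x j)))) τ := by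
    unfold qf
    refine HasDerivAt.fun_sum fun i _ => HasDerivAt.fun_sum fun j _ => ?_
    exact ((hDs i j).fun_mul (hx i)).fun_mul (hx j)
  have he : HasDerivAt (fun s => Real.exp (-s)) (-Real.exp (-τ)) τ := by
    simpa using (hasDerivAt_neg τ).exp
  refine (he.fun_mul hq).congr_deriv ?_
  have hsum : ∑ i, ∑ j, ((-(2 * (realMoment A q C i j - β * C i j)) * x i
        + C i j * (-(act A x i + β * x i))) * x j + C i j * x i * (-(act A x j + β * x j)))
      = -2 * qf (realMoment A q C) x - qf (A.transpose * C) x - qf (C * A) x := by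
    rw [qf_transpose_mul, qf_mul, qf, Finset.mul_sum, ← Finset.sum_sub_distrib,
      ← Finset.sum_sub_distrib]
    refine Finset.sum_congr rfl fun i _ => ?_
    rw [Finset.mul_sum, ← Finset.sum_sub_distrib, ← Finset.sum_sub_distrib]
    exact Finset.sum_congr rfl fun j _ => by ring
  rw [hsum, qf_realMoment]
  ring

lemma continuous_flow_apply (A : Matrix (Fin d) (Fin d) ℝ) (β : ℝ) (k : E d) :
    Continuous fun τ => flow A β τ k :=
  (continuous_flow A β).clm_apply continuous_const

lemma continuous_qf_comp {X : Type*} [TopologicalSpace X] {D : X → Matrix (Fin d) (Fin d) ℝ}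
    (hD : Continuous D) {κ : X → E d} (hκ : Continuous κ) :
    Continuous fun x => qf (D x) (κ x) := by
  unfold qf
  refine continuous_finsetSum _ fun i _ => continuous_finsetSum _ fun j _ => ?_
  have h1 : Continuous fun x => D x i j := hD.matrix_elem i j
  fun_prop

lemma continuous_gainMoment (q : ℝ) : Continuous (gainMoment (d := d) q) := by
  unfold gainMoment
  have h : Continuous fun B : Matrix (Fin d) (Fin d) ℝ => B.trace / d :=
    continuous_id.matrix_trace.div_const _
  fun_prop

lemma IsMomentFlow.integral_eq {A : Matrix (Fin d) (Fin d) ℝ} {q β : ℝ}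
    {D : ℝ → Matrix (Fin d) (Fin d) ℝ} (hD : IsMomentFlow A q β D) (t : ℝ) (k : E d) :
    ∫ τ in (0 : ℝ)..t, Real.exp (-τ) * qf (gainMoment q (D (t - τ))) (flow A β τ k)
      = qf (D t) k - Real.exp (-t) * qf (D 0) (flow A β t k) := by
  have hcont : Continuous fun τ =>
      Real.exp (-τ) * qf (gainMoment q (D (t - τ))) (flow A β τ k) :=
    (by fun_prop : Continuous fun τ : ℝ => Real.exp (-τ)).mul
      (continuous_qf_comp ((continuous_gainMoment q).comp (hD.continuous.comp (by fun_prop)))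
        (continuous_flow_apply A β k))
  have h := intervalIntegral.integral_eq_sub_of_hasDerivAt (fun τ _ => hD.hasDerivAt t τ k)
    (hcont.neg.intervalIntegrable 0 t)
  rw [intervalIntegral.integral_neg] at h
  simp only [sub_self, sub_zero, neg_zero, Real.exp_zero, one_mul, flow_zero] at h
  linarith

/-! ### Averages along the flow -/

lemma norm_flow_rpow_le (A : Matrix (Fin d) (Fin d) ℝ) (β : ℝ) {τ r : ℝ} (hτ : 0 ≤ τ) (hr : 0 ≤ r)
    (k : E d) :
    ‖flow A β τ k‖ ^ r ≤ Real.exp (r * (‖act A‖ + |β|) * τ) * ‖k‖ ^ r := by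
  refine (Real.rpow_le_rpow (norm_nonneg _) (norm_flow_le A β hτ k) hr).trans_eq ?_
  rw [Real.mul_rpow (Real.exp_pos _).le (norm_nonneg _), ← Real.exp_mul]
  congr 2; ring

lemma norm_flow_sq_le (A : Matrix (Fin d) (Fin d) ℝ) (β : ℝ) {τ : ℝ} (hτ : 0 ≤ τ) (k : E d) :
    ‖flow A β τ k‖ ^ 2 ≤ Real.exp (2 * (‖act A‖ + |β|) * τ) * ‖k‖ ^ 2 := by
  have := norm_flow_rpow_le A β hτ (r := 2) (by norm_num) k
  simpa only [Real.rpow_two] using this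

lemma measurable_Eop_Gain (hd : 2 ≤ d) {g : ℝ → ℝ} (hg : IsKernel d g)
    (A : Matrix (Fin d) (Fin d) ℝ) (β : ℝ) {φ : ℝ → E d → ℂ}
    (hφ : Measurable (Function.uncurry φ)) (k : E d) :
    Measurable fun τ => Eop A β τ (Gain g (φ τ)) k := by
  simp only [Eop_eq]
  exact (by fun_prop : Measurable fun τ : ℝ => (Real.exp (-τ) : ℂ)).mul
    (measurable_Gain hd hg hφ (continuous_flow_apply A β k).measurable)

lemma norm_Eop_Gain_le (hd : 2 ≤ d) {g : ℝ → ℝ} (hg : IsKernel d g)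
    (A : Matrix (Fin d) (Fin d) ℝ) (β τ : ℝ) {φ : E d → ℂ} (hφ : φ ∈ charFcts d) (k : E d) :
    ‖Eop A β τ (Gain g φ) k‖ ≤ Real.exp (-τ) := by
  rw [Eop_eq, norm_mul, Complex.norm_real, Real.norm_of_nonneg (Real.exp_pos _).le]
  exact mul_le_of_le_one_right (Real.exp_pos _).le (norm_Gain_le_one hd hg hφ _)

lemma integrableOn_Eop_Gain (hd : 2 ≤ d) {g : ℝ → ℝ} (hg : IsKernel d g)
    (A : Matrix (Fin d) (Fin d) ℝ) (β : ℝ) {φ : E d → ℂ} (hφ : φ ∈ charFcts d) (k : E d) :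
    IntegrableOn (fun τ => Eop A β τ (Gain g φ) k) (Ioi 0) := by
  have hm : Measurable (Function.uncurry fun (_ : ℝ) => φ) :=
    (continuous_of_mem hφ).measurable.comp measurable_snd
  exact (integrableOn_exp_neg_Ioi 0).mono'
    (measurable_Eop_Gain hd hg A β hm k).aestronglyMeasurable
    (Filter.Eventually.of_forall fun τ => norm_Eop_Gain_le hd hg A β τ hφ k)

/-- A stationary second moment is reproduced by the average along the flow. -/
lemma integral_Ioi_qf_gainMoment {A : Matrix (Fin d) (Fin d) ℝ} {q β : ℝ}
    {N : Matrix (Fin d) (Fin d) ℝ} (hN : realMoment A q N = β • N)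
    (hε : 2 * (‖act A‖ + |β|) < 1) (k : E d) :
    IntegrableOn (fun τ => Real.exp (-τ) * qf (gainMoment q N) (flow A β τ k)) (Ioi 0) ∧
    ∫ τ in Ioi (0 : ℝ), Real.exp (-τ) * qf (gainMoment q N) (flow A β τ k) = qf N k := by
  set ε := ‖act A‖ + |β| with hεdef
  have hbound : ∀ B : Matrix (Fin d) (Fin d) ℝ, ∀ τ, 0 ≤ τ →
      ‖Real.exp (-τ) * qf B (flow A β τ k)‖
        ≤ ‖matVec B‖ * ‖k‖ ^ 2 * Real.exp ((2 * ε - 1) * τ) := by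
    intro B τ hτ
    rw [norm_mul, Real.norm_of_nonneg (Real.exp_pos _).le, Real.norm_eq_abs]
    calc _ ≤ Real.exp (-τ) * (‖matVec B‖ * (Real.exp (2 * ε * τ) * ‖k‖ ^ 2)) := by
          gcongr
          refine (abs_qf_le _ _).trans ?_
          gcongr
          exact norm_flow_sq_le A β hτ k
      _ = _ := by
          have : Real.exp ((2 * ε - 1) * τ) = Real.exp (-τ) * Real.exp (2 * ε * τ) := by
            rw [← Real.exp_add]; congr 1; ring
          rw [this]; ring
  have hcont : ∀ B : Matrix (Fin d) (Fin d) ℝ, Continuous fun τ =>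
      Real.exp (-τ) * qf B (flow A β τ k) := fun B =>
    (by fun_prop : Continuous fun τ : ℝ => Real.exp (-τ)).mul
      (continuous_qf_comp continuous_const (continuous_flow_apply A β k))
  have hint : IntegrableOn (fun τ => Real.exp (-τ) * qf (gainMoment q N) (flow A β τ k))
      (Ioi 0) := by
    refine Integrable.mono' ((integrableOn_exp_mul_Ioi (by linarith : 2 * ε - 1 < 0) 0).const_mul
      (‖matVec (gainMoment q N)‖ * ‖k‖ ^ 2)) (hcont _).aestronglyMeasurable ?_
    exact (ae_restrict_mem measurableSet_Ioi).mono fun τ hτ => hbound _ τ (le_of_lt hτ)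
  refine ⟨hint, ?_⟩
  have hlim : Filter.Tendsto (fun τ => Real.exp (-τ) * qf N (flow A β τ k)) Filter.atTop
      (nhds 0) := by
    have h1 : Filter.Tendsto (fun τ : ℝ => ‖matVec N‖ * ‖k‖ ^ 2 * Real.exp ((2 * ε - 1) * τ))
        Filter.atTop (nhds 0) := by
      rw [← mul_zero (‖matVec N‖ * ‖k‖ ^ 2)]
      refine Filter.Tendsto.const_mul _ (Real.tendsto_exp_atBot.comp ?_)
      exact Filter.tendsto_id.const_mul_atTop_of_neg (by linarith)
    refine squeeze_zero_norm' ?_ h1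
    filter_upwards [Filter.eventually_ge_atTop 0] with τ hτ using hbound N τ hτ
  have h := integral_Ioi_of_hasDerivAt_of_tendsto' (a := 0)
    (fun τ _ => (isMomentFlow_const hN).hasDerivAt 0 τ k) hint.neg hlim
  rw [integral_neg] at h
  simp only [neg_zero, Real.exp_zero, one_mul, flow_zero] at h
  linarith

/-- The estimate for `Tmap` that follows from an estimate for the gain operator. -/
lemma norm_Tmap_sub_le (hd : 2 ≤ d) {g : ℝ → ℝ} (hg : IsKernel d g)
    {A : Matrix (Fin d) (Fin d) ℝ} {β : ℝ} {φ ψ : E d → ℂ}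
    (hφ : φ ∈ charFcts d) (hψ : ψ ∈ charFcts d) {q : ℝ} {N : Matrix (Fin d) (Fin d) ℝ}
    (hN : realMoment A q N = β • N) {r a : ℝ} (hr : 2 ≤ r)
    (hε : r * (‖act A‖ + |β|) < 1)
    (h : ∀ k, ‖Gain g φ k - Gain g ψ k + (1 / 2 : ℂ) * (qf (gainMoment q N) k : ℂ)‖
      ≤ a * ‖k‖ ^ r) (k : E d) :
    ‖Tmap g A β φ k - Tmap g A β ψ k + (1 / 2 : ℂ) * (qf N k : ℂ)‖
      ≤ a / (1 - r * (‖act A‖ + |β|)) * ‖k‖ ^ r := by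
  set ε := ‖act A‖ + |β| with hεdef
  have hε0 : 0 ≤ ε := by positivity
  have ha : ∀ k : E d, 0 ≤ a * ‖k‖ ^ r := fun k => (norm_nonneg _).trans (h k)
  obtain ⟨hi, hv⟩ := integral_Ioi_qf_gainMoment hN (by nlinarith) k
  have h1 : Tmap g A β φ k - Tmap g A β ψ k + (1 / 2 : ℂ) * (qf N k : ℂ)
      = ∫ τ in Ioi (0 : ℝ), (Real.exp (-τ) : ℂ) * (Gain g φ (flow A β τ k)
        - Gain g ψ (flow A β τ k)
        + (1 / 2 : ℂ) * (qf (gainMoment q N) (flow A β τ k) : ℂ)) := by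
    rw [← hv, ← integral_complex_ofReal, ← integral_const_mul, Tmap, Tmap,
      ← integral_sub (integrableOn_Eop_Gain hd hg A β hφ k) (integrableOn_Eop_Gain hd hg A β hψ k),
      ← integral_add]
    · congr 1; ext τ; simp only [Eop_eq]; push_cast; ring
    · exact (integrableOn_Eop_Gain hd hg A β hφ k).sub (integrableOn_Eop_Gain hd hg A β hψ k)
    · exact (hi.ofReal (𝕜 := ℂ)).const_mul _
  rw [h1]
  have hlt : r * ε - 1 < 0 := by linarith
  refine (norm_integral_le_of_norm_le (g := fun τ => a * ‖k‖ ^ r * Real.exp ((r * ε - 1) * τ))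
    ((integrableOn_exp_mul_Ioi hlt 0).const_mul _) ?_).trans_eq ?_
  · refine (ae_restrict_mem measurableSet_Ioi).mono fun τ hτ => ?_
    have hτ : 0 ≤ τ := le_of_lt hτ
    rw [norm_mul, Complex.norm_real, Real.norm_of_nonneg (Real.exp_pos _).le]
    have h2 := h (flow A β τ k)
    have h3 := norm_flow_rpow_le A β hτ (by linarith : 0 ≤ r) k
    rcases (norm_nonneg k).eq_or_lt with hk | hk
    · have hk0 : k = 0 := norm_eq_zero.1 hk.symm
      rw [hk0, map_zero] at h2 ⊢
      rw [norm_zero, Real.zero_rpow (by linarith), mul_zero] at h2 ⊢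
      rw [zero_mul]
      exact mul_nonpos_of_nonneg_of_nonpos (Real.exp_pos _).le h2
    · have ha0 : 0 ≤ a := nonneg_of_mul_nonneg_left (ha k) (Real.rpow_pos_of_pos hk r)
      calc _ ≤ Real.exp (-τ) * (a * (Real.exp (r * ε * τ) * ‖k‖ ^ r)) := by
            gcongr
            exact h2.trans (by gcongr)
        _ = _ := by
            have : Real.exp ((r * ε - 1) * τ) = Real.exp (-τ) * Real.exp (r * ε * τ) := by
              rw [← Real.exp_add]; congr 1; ring
            rw [this]; ring
  · rw [integral_const_mul, integral_exp_mul_Ioi hlt, mul_zero, Real.exp_zero]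
    have h5 : 1 - r * ε ≠ 0 := by linarith
    have h6 : r * ε - 1 ≠ 0 := by linarith
    field_simp
    ring

/-! ### Stationary solutions -/

lemma kernelQ_le_one (hd : 2 ≤ d) {g : ℝ → ℝ} (hg : IsKernel d g) : kernelQ d g ≤ 1 := by
  set ω := e₁Sph hd
  have hc : Continuous fun n : Sph d => 1 - ⟪(ω : E d), (n : E d)⟫ ^ 2 := by fun_prop
  rw [← kernelQ_eq hd g ω]
  refine (integral_mono (hg.integrable_mul ω hc) (hg.integrable ω) fun n => ?_).trans_eq
    (hg.normalized ω)
  exact mul_le_of_le_one_right (hg.nonneg' ω n)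
    (by linarith [sq_nonneg ⟪(ω : E d), (n : E d)⟫])

/-- `Tmap` is a contraction for the distance `sup |φ - ψ| / |k|^r`, `2 < r ≤ 4`. -/
lemma norm_Tmap_sub_le_of_norm_sub_le (hd : 2 ≤ d) {g : ℝ → ℝ} (hg : IsKernel d g)
    {A : Matrix (Fin d) (Fin d) ℝ} {β r : ℝ} (hr2 : 2 ≤ r) (hr4 : r ≤ 4)
    (hε : r * (‖act A‖ + |β|) ≤ (r - 2) / 16 * kernelQ d g) {φ ψ : E d → ℂ}
    (hφ : φ ∈ charFcts d) (hψ : ψ ∈ charFcts d) {a : ℝ} (ha : 0 ≤ a)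
    (h : ∀ k, ‖φ k - ψ k‖ ≤ a * ‖k‖ ^ r) (k : E d) :
    ‖Tmap g A β φ k - Tmap g A β ψ k‖ ≤ (1 - (r - 2) / 8 * kernelQ d g) * a * ‖k‖ ^ r := by
  have hq := kernelQ_pos hd hg
  have hq1 := kernelQ_le_one hd hg
  have h0 : realMoment A (kernelQ d g) 0 = β • 0 := by
    have := realMoment_smul A (kernelQ d g) 0 0
    simpa using this
  have hμ : (r - 2) / 16 * kernelQ d g ≤ 1 / 8 := by nlinarith
  have hgm : ∀ k : E d, qf (gainMoment (kernelQ d g) (0 : Matrix (Fin d) (Fin d) ℝ)) k = 0 := by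
    intro k; simp [gainMoment, qf_zero_left]
  have hG := norm_Gain_sub_le hd hg hφ hψ 0 hr2 hr4 ha le_rfl le_rfl
    (fun k => by simpa [qf_zero_left] using h k) (fun u v => by simp [qf_zero_left])
    (fun u v => by simp [qf_zero_left])
  have hT := norm_Tmap_sub_le (a := (1 - (r - 2) / 4 * kernelQ d g) * a) hd hg hφ hψ h0 hr2
    (by linarith) (fun k => by simpa using hG k) k
  rw [qf_zero_left, Complex.ofReal_zero, mul_zero, add_zero] at hT
  refine hT.trans ?_
  gcongr
  rw [div_le_iff₀ (by linarith), mul_right_comm]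
  gcongr
  nlinarith [mul_nonneg (sub_nonneg.2 hr2) hq.le, mul_nonneg (mul_nonneg (sub_nonneg.2 hr2) hq.le)
    (mul_nonneg (sub_nonneg.2 hr2) hq.le)]

lemma IsStationary.tmap_eq {g : ℝ → ℝ} {A : Matrix (Fin d) (Fin d) ℝ} {β : ℝ} {Ψ : E d → ℂ}
    (h : IsStationary g A β Ψ) : Tmap g A β Ψ = Ψ := funext fun k => (h k).symm

lemma tendsto_contraction_pow (hd : 2 ≤ d) {g : ℝ → ℝ} (hg : IsKernel d g) {r : ℝ}
    (hr2 : 2 < r) (hr4 : r ≤ 4) (a b : ℝ) :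
    Filter.Tendsto (fun n : ℕ => a * (1 - (r - 2) / 8 * kernelQ d g) ^ n * b) Filter.atTop
      (nhds 0) := by
  have hq := kernelQ_pos hd hg
  have hq1 := kernelQ_le_one hd hg
  have hμ : 0 < (r - 2) / 8 * kernelQ d g := by
    have : 0 < r - 2 := by linarith
    positivity
  have := tendsto_pow_atTop_nhds_zero_of_lt_one
    (r := 1 - (r - 2) / 8 * kernelQ d g) (by nlinarith) (by linarith)
  simpa using (this.const_mul a).mul_const b

lemma IsStationary.eq_of_norm_sub_le (hd : 2 ≤ d) {g : ℝ → ℝ} (hg : IsKernel d g)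
    {A : Matrix (Fin d) (Fin d) ℝ} {β r : ℝ} (hr2 : 2 < r) (hr4 : r ≤ 4)
    (hε : r * (‖act A‖ + |β|) ≤ (r - 2) / 16 * kernelQ d g) {φ ψ : E d → ℂ}
    (hφ : φ ∈ charFcts d) (hψ : ψ ∈ charFcts d) (hφs : IsStationary g A β φ)
    (hψs : IsStationary g A β ψ) {a : ℝ} (ha : 0 ≤ a)
    (h : ∀ k, ‖φ k - ψ k‖ ≤ a * ‖k‖ ^ r) : φ = ψ := by
  have hρ : 0 ≤ 1 - (r - 2) / 8 * kernelQ d g := by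
    nlinarith [kernelQ_pos hd hg, kernelQ_le_one hd hg]
  have key : ∀ n : ℕ, ∀ k, ‖φ k - ψ k‖ ≤ a * (1 - (r - 2) / 8 * kernelQ d g) ^ n * ‖k‖ ^ r := by
    intro n
    induction n with
    | zero => simpa using h
    | succ n ih =>
      intro k
      have := norm_Tmap_sub_le_of_norm_sub_le hd hg hr2.le hr4 hε hφ hψ (by positivity) ih k
      rw [hφs.tmap_eq, hψs.tmap_eq] at this
      exact this.trans_eq (by ring)
  ext k
  refine sub_eq_zero.1 (norm_le_zero_iff.1 ?_)
  exact ge_of_tendsto' (tendsto_contraction_pow hd hg hr2 hr4 a (‖k‖ ^ r)) fun n => key n k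

lemma Gain_one (hd : 2 ≤ d) {g : ℝ → ℝ} (hg : IsKernel d g) (k : E d) :
    Gain g (fun _ => 1) k = 1 := by
  obtain ⟨ω, -, h⟩ := exists_dirV hd k
  rw [Gain_eq hg _ h]
  simp only [mul_one, Complex.real_smul, mul_one]
  rw [integral_complex_ofReal, hg.normalized, Complex.ofReal_one]

lemma Tmap_one (hd : 2 ≤ d) {g : ℝ → ℝ} (hg : IsKernel d g) (A : Matrix (Fin d) (Fin d) ℝ)
    (β : ℝ) (k : E d) : Tmap g A β (fun _ => 1) k = 1 := by
  simp only [Tmap, Eop_eq, Gain_one hd hg, mul_one]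
  rw [integral_complex_ofReal, integral_exp_neg_Ioi_zero, Complex.ofReal_one]

lemma isStationary_one (hd : 2 ≤ d) {g : ℝ → ℝ} (hg : IsKernel d g)
    (A : Matrix (Fin d) (Fin d) ℝ) (β : ℝ) : IsStationary g A β fun _ => 1 :=
  fun k => (Tmap_one hd hg A β k).symm

lemma abs_exp_neg_sub_le {x a : ℝ} (hx : 0 ≤ x) (ha1 : 1 ≤ a) (ha2 : a ≤ 2) :
    |Real.exp (-x) - 1 + x| ≤ x ^ a := by
  have h1 : 0 ≤ Real.exp (-x) - 1 + x := by linarith [Real.add_one_le_exp (-x)]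
  rw [abs_of_nonneg h1]
  rcases le_total x 1 with h | h
  · have h2 : Real.exp (-x) - 1 + x ≤ x ^ 2 := by
      have := Real.abs_exp_sub_one_sub_id_le (x := -x) (by rwa [abs_neg, abs_of_nonneg hx])
      have := (abs_le.1 this).2
      linarith [neg_sq x]
    refine h2.trans ?_
    rw [← Real.rpow_two]
    rcases hx.eq_or_lt with rfl | hx
    · rw [Real.zero_rpow (by norm_num), Real.zero_rpow (by linarith)]
    · exact Real.rpow_le_rpow_of_exponent_ge hx h ha2
  · have h2 : Real.exp (-x) ≤ 1 := Real.exp_le_one_iff.2 (by linarith)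
    calc _ ≤ x := by linarith
      _ = x ^ (1 : ℝ) := (Real.rpow_one x).symm
      _ ≤ x ^ a := Real.rpow_le_rpow_of_exponent_le h ha1

/-- A quantity bounded by `min 1 x` is bounded by every power `x ^ a` with `0 ≤ a ≤ 1`. -/
lemma le_rpow_of_le {y x a : ℝ} (hx : 0 ≤ x) (hy1 : y ≤ 1) (hyx : y ≤ x) (ha0 : 0 ≤ a)
    (ha1 : a ≤ 1) : y ≤ x ^ a := by
  rcases le_total x 1 with h | h
  · rcases hx.eq_or_lt with rfl | hx
    · exact hyx.trans (Real.rpow_nonneg le_rfl _)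
    · calc y ≤ x ^ (1 : ℝ) := by rwa [Real.rpow_one]
        _ ≤ x ^ a := Real.rpow_le_rpow_of_exponent_ge hx h ha1
  · exact hy1.trans (Real.one_le_rpow h ha0)

lemma sq_rpow_half {x : ℝ} (hx : 0 ≤ x) (r : ℝ) : (x ^ 2) ^ (r / 2) = x ^ r := by
  rw [← Real.rpow_two, ← Real.rpow_mul hx]; congr 1; ring

/-- A stationary solution with second moment `N` exists, with a remainder estimate that depends on
the shear and on `N` only through a bound `M` of `N`. The map `Tmap` is iterated from the Gaussian
with second moment `N`. -/
lemma exists_isStationary (hd : 2 ≤ d) {g : ℝ → ℝ} (hg : IsKernel d g) {r : ℝ} (hr2 : 2 < r)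
    (hr4 : r ≤ 4) {M : ℝ} (hM : 0 ≤ M) :
    ∃ K : ℝ, 0 ≤ K ∧ ∀ (A : Matrix (Fin d) (Fin d) ℝ) (β : ℝ) (N : Matrix (Fin d) (Fin d) ℝ),
      r * (‖act A‖ + |β|) ≤ (r - 2) / 16 * kernelQ d g →
      realMoment A (kernelQ d g) N = β • N → N.PosSemidef → (∀ k : E d, qf N k ≤ M * ‖k‖ ^ 2) →
      ∃ Ψ ∈ charFcts d, IsStationary g A β Ψ ∧
        ∀ k, ‖Ψ k - 1 + (1 / 2 : ℂ) * (qf N k : ℂ)‖ ≤ K * ‖k‖ ^ r := by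
  have hq := kernelQ_pos hd hg
  have hq1 := kernelQ_le_one hd hg
  set ρ := 1 - (r - 2) / 8 * kernelQ d g with hρ
  have hρ0 : 0 ≤ ρ := by nlinarith
  have hρ1 : ρ < 1 := by
    have : 0 < (r - 2) / 8 * kernelQ d g := mul_pos (by linarith) hq
    linarith
  have hρ2 : 0 < 1 - ρ := by linarith
  set a := (M / 2) ^ (r / 2) with ha
  set s := M * (M / 2) ^ ((r - 2) / 2) with hs
  have ha0 : 0 ≤ a := by positivity
  have hs0 : 0 ≤ s := by positivity
  set K₁ := 2 * (a + s) + a with hK₁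
  have hK₁0 : 0 ≤ K₁ := by positivity
  refine ⟨K₁ / (1 - ρ) + a, by positivity, fun A β N hε hN hpos hNM => ?_⟩
  have hμ : (r - 2) / 16 * kernelQ d g ≤ 1 / 8 := by nlinarith
  have hx0 : ∀ k : E d, 0 ≤ qf N k := fun k => by
    rw [qf_eq_dotProduct]; simpa using hpos.dotProduct_mulVec_nonneg k.ofLp
  set γ : E d → ℂ := fun k => ((Real.exp (-(qf N k / 2)) : ℝ) : ℂ) with hγ
  have hγm : γ ∈ charFcts d := gaussian_mem_charFcts hpos
  have hγ2 : ∀ k, ‖γ k - 1 + (1 / 2 : ℂ) * (qf N k : ℂ)‖ ≤ a * ‖k‖ ^ r := by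
    intro k
    have h1 : γ k - 1 + (1 / 2 : ℂ) * (qf N k : ℂ)
        = ((Real.exp (-(qf N k / 2)) - 1 + qf N k / 2 : ℝ) : ℂ) := by
      simp only [hγ]; push_cast; ring
    rw [h1, Complex.norm_real, Real.norm_eq_abs]
    refine (abs_exp_neg_sub_le (a := r / 2) (by linarith [hx0 k]) (by linarith)
      (by linarith)).trans ?_
    rw [ha, ← sq_rpow_half (norm_nonneg k) r, ← Real.mul_rpow (by positivity) (by positivity)]
    exact Real.rpow_le_rpow (by linarith [hx0 k]) (by linarith [hNM k]) (by linarith)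
  have hγ1 : ∀ k, ‖γ k - 1‖ ≤ (M / 2) ^ ((r - 2) / 2) * ‖k‖ ^ (r - 2) := by
    intro k
    have h1 : γ k - 1 = ((Real.exp (-(qf N k / 2)) - 1 : ℝ) : ℂ) := by
      simp only [hγ]; push_cast; ring
    have h2 : Real.exp (-(qf N k / 2)) ≤ 1 := Real.exp_le_one_iff.2 (by linarith [hx0 k])
    rw [h1, Complex.norm_real, Real.norm_eq_abs, abs_of_nonpos (by linarith)]
    refine (le_rpow_of_le (x := qf N k / 2) (a := (r - 2) / 2) (by linarith [hx0 k])
      (by linarith [Real.exp_pos (-(qf N k / 2))])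
      (by linarith [Real.add_one_le_exp (-(qf N k / 2))]) (by linarith) (by linarith)).trans ?_
    rw [← sq_rpow_half (norm_nonneg k) (r - 2), ← Real.mul_rpow (by positivity) (by positivity)]
    exact Real.rpow_le_rpow (by linarith [hx0 k]) (by linarith [hNM k]) (by linarith)
  have hfirst : ∀ k, ‖Tmap g A β γ k - γ k‖ ≤ K₁ * ‖k‖ ^ r := by
    intro k
    have hG := norm_Gain_sub_le hd hg hγm one_mem_charFcts N hr2.le hr4 ha0 le_rfl hs0
      (fun k => by simpa using hγ2 k)
      (fun u v => by
        rw [abs_of_nonneg (hx0 u)]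
        calc _ ≤ (M * ‖u‖ ^ 2) * ((M / 2) ^ ((r - 2) / 2) * ‖v‖ ^ (r - 2)) :=
              mul_le_mul (hNM u) (hγ1 v) (norm_nonneg _) (by positivity)
          _ = _ := by rw [hs]; ring)
      (fun u v => by simp only [sub_self, norm_zero, mul_zero]; positivity)
    have hT := norm_Tmap_sub_le (a := (1 - (r - 2) / 4 * kernelQ d g) * a + s) hd hg hγm
      one_mem_charFcts hN hr2.le (by linarith) (fun k => by simpa using hG k) k
    rw [Tmap_one hd hg] at hT
    have h1 : ((1 - (r - 2) / 4 * kernelQ d g) * a + s) / (1 - r * (‖act A‖ + |β|))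
        ≤ 2 * (a + s) := by
      rw [div_le_iff₀ (by linarith)]
      have h2 : 0 ≤ (r - 2) / 4 * kernelQ d g := mul_nonneg (by linarith) hq.le
      nlinarith [mul_nonneg h2 ha0]
    have h3 : Tmap g A β γ k - γ k = (Tmap g A β γ k - 1 + (1 / 2 : ℂ) * (qf N k : ℂ))
        - (γ k - 1 + (1 / 2 : ℂ) * (qf N k : ℂ)) := by ring
    rw [h3]
    refine (norm_sub_le _ _).trans ((add_le_add hT (hγ2 k)).trans ?_)
    rw [hK₁, add_mul (2 * (a + s))]
    gcongr
  set u : ℕ → E d → ℂ := fun n => (Tmap g A β)^[n] γ with hu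
  have hus : ∀ n, u (n + 1) = Tmap g A β (u n) := fun n => Function.iterate_succ_apply' _ _ _
  have hum : ∀ n, u n ∈ charFcts d := by
    intro n
    induction n with
    | zero => exact hγm
    | succ n ih => rw [hus]; exact Tmap_mem_charFcts hd hg A β ih
  have hstep : ∀ n k, ‖u (n + 1) k - u n k‖ ≤ K₁ * ρ ^ n * ‖k‖ ^ r := by
    intro n
    induction n with
    | zero =>
      intro k
      rw [hus]
      simpa using! hfirst k
    | succ n ih =>
      intro k
      rw [hus (n + 1)]
      nth_rewrite 2 [hus n]
      refine (norm_Tmap_sub_le_of_norm_sub_le hd hg hr2.le hr4 hε (hum _) (hum _)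
        (by positivity) ih k).trans_eq ?_
      rw [pow_succ]; ring
  have hdist : ∀ k n, dist (u n k) (u (n + 1) k) ≤ K₁ * ‖k‖ ^ r * ρ ^ n := fun k n => by
    rw [dist_comm, dist_eq_norm]
    exact (hstep n k).trans_eq (by ring)
  choose Ψ hΨ using fun k => cauchySeq_tendsto_of_complete
    (cauchySeq_of_le_geometric ρ _ hρ1 (hdist k))
  have hΨd : ∀ n k, ‖u n k - Ψ k‖ ≤ K₁ / (1 - ρ) * ρ ^ n * ‖k‖ ^ r := by
    intro n k
    rw [← dist_eq_norm]
    refine (dist_le_of_le_geometric_of_tendsto ρ _ hρ1 (hdist k) (hΨ k) n).trans_eq ?_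
    field_simp
  have hΨ0 : ∀ k, ‖Ψ k - γ k‖ ≤ K₁ / (1 - ρ) * ‖k‖ ^ r := by
    intro k
    rw [norm_sub_rev]
    simpa using! hΨd 0 k
  have hcont : ContinuousAt Ψ 0 := by
    have hr0 : (0 : ℝ) ^ r = 0 := Real.zero_rpow (by linarith)
    have h1 : Filter.Tendsto (fun k : E d => K₁ / (1 - ρ) * ‖k‖ ^ r) (nhds 0) (nhds 0) := by
      have : Continuous fun k : E d => K₁ / (1 - ρ) * ‖k‖ ^ r :=
        continuous_const.mul (continuous_norm.rpow_const fun _ => Or.inr (by linarith))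
      simpa [hr0] using this.tendsto 0
    have h2 := squeeze_zero_norm hΨ0 h1
    have h3 := h2.add ((continuous_of_mem hγm).tendsto 0)
    have h4 : Ψ 0 = γ 0 := by
      have := hΨ0 0
      rw [norm_zero, hr0, mul_zero] at this
      exact sub_eq_zero.1 (norm_le_zero_iff.1 this)
    rw [ContinuousAt, h4]
    simpa using h3
  have hΨm : Ψ ∈ charFcts d := mem_charFcts_of_tendsto hum hcont hΨ
  refine ⟨Ψ, hΨm, fun k => ?_, fun k => ?_⟩
  · -- both `Tmap Ψ` and `Ψ` are limits of the iterates
    have h1 : ∀ n : ℕ, ‖Tmap g A β Ψ k - Ψ k‖ ≤ 2 * (K₁ / (1 - ρ)) * ρ ^ n * ‖k‖ ^ r := by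
      intro n
      have h2 := norm_Tmap_sub_le_of_norm_sub_le hd hg hr2.le hr4 hε (hum n) hΨm
        (by positivity) (hΨd n) k
      have h3 := hΨd (n + 1) k
      rw [← hus, ← hρ, norm_sub_rev] at h2
      have h4 : Tmap g A β Ψ k - Ψ k = (Tmap g A β Ψ k - u (n + 1) k) + (u (n + 1) k - Ψ k) := by
        ring
      rw [h4]
      have h5 : K₁ / (1 - ρ) * ρ ^ (n + 1) * ‖k‖ ^ r ≤ K₁ / (1 - ρ) * ρ ^ n * ‖k‖ ^ r := by
        gcongr ?_ * ?_ * ?_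
        exact pow_le_pow_of_le_one hρ0 hρ1.le n.le_succ
      have h6 : ρ * (K₁ / (1 - ρ) * ρ ^ n) * ‖k‖ ^ r = K₁ / (1 - ρ) * ρ ^ (n + 1) * ‖k‖ ^ r := by
        rw [pow_succ]; ring
      refine (norm_add_le _ _).trans ?_
      linarith
    refine (sub_eq_zero.1 (norm_le_zero_iff.1 ?_)).symm
    exact ge_of_tendsto' (tendsto_contraction_pow hd hg hr2 hr4 _ (‖k‖ ^ r)) h1
  · have h3 : Ψ k - 1 + (1 / 2 : ℂ) * (qf N k : ℂ)
        = (Ψ k - γ k) + (γ k - 1 + (1 / 2 : ℂ) * (qf N k : ℂ)) := by ring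
    rw [h3, add_mul]
    exact (norm_add_le _ _).trans (add_le_add (hΨ0 k) (hγ2 k))

lemma Gain_comp_smul (hd : 2 ≤ d) {g : ℝ → ℝ} (hg : IsKernel d g) (φ : E d → ℂ) {c : ℝ}
    (hc : 0 ≤ c) (k : E d) : Gain g (fun k => φ (c • k)) k = Gain g φ (c • k) := by
  obtain ⟨ω, -, h⟩ := exists_dirV hd k
  have hn : ‖c • k‖ = c * ‖k‖ := by rw [norm_smul, Real.norm_of_nonneg hc]
  have h' : c • k = ‖c • k‖ • (ω : E d) := by
    rw [hn, mul_smul, ← h]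
  rw [Gain_eq hg _ h, Gain_eq hg _ h', hn]
  congr 1; ext n
  rw [smul_comm c, smul_comm c, smul_add, smul_sub, smul_smul]

/-- The stationary equation is invariant under dilations. -/
lemma IsStationary.comp_smul (hd : 2 ≤ d) {g : ℝ → ℝ} (hg : IsKernel d g)
    {A : Matrix (Fin d) (Fin d) ℝ} {β : ℝ} {Ψ : E d → ℂ} (h : IsStationary g A β Ψ) {c : ℝ}
    (hc : 0 ≤ c) : IsStationary g A β fun k => Ψ (c • k) := by
  intro k
  simp only [Eop_eq, Gain_comp_smul hd hg Ψ hc]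
  rw [h (c • k)]
  simp only [Eop_eq, map_smul]

/-- A stationary solution solves the evolution equation in mild form. -/
lemma IsStationary.mild (hd : 2 ≤ d) {g : ℝ → ℝ} (hg : IsKernel d g)
    {A : Matrix (Fin d) (Fin d) ℝ} {β : ℝ} {Ψ : E d → ℂ} (hΨ : Ψ ∈ charFcts d)
    (h : IsStationary g A β Ψ) {t : ℝ} (ht : 0 ≤ t) (k : E d) :
    Ψ k = Eop A β t Ψ k + ∫ τ in (0 : ℝ)..t, Eop A β τ (Gain g Ψ) k := by
  have hi := integrableOn_Eop_Gain hd hg A β hΨ k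
  have h1 : Eop A β t Ψ k = ∫ τ in Ioi t, Eop A β τ (Gain g Ψ) k := by
    have h2 := (measurePreserving_add_right volume t).setIntegral_preimage_emb
      (measurableEmbedding_addRight t) (fun τ => Eop A β τ (Gain g Ψ) k) (Ioi t)
    have h3 : (fun x : ℝ => x + t) ⁻¹' Ioi t = Ioi 0 := by ext x; simp
    rw [← h2, h3, Eop_eq, h, ← integral_const_mul]
    congr 1; ext τ
    rw [Eop_eq, Eop_eq, flow_add, neg_add, Real.exp_add, Complex.ofReal_mul]
    ring
  rw [h1, add_comm, intervalIntegral.integral_interval_add_Ioi hi (hi.mono_set (Ioi_subset_Ioi ht)),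
    ← h k]

/-! ### The comparison estimate for the evolution -/

lemma integral_exp_neg_mul {m : ℝ} (hm : m ≠ 0) (t : ℝ) :
    ∫ τ in (0 : ℝ)..t, Real.exp (-m * τ) = (1 - Real.exp (-m * t)) / m := by
  have h : ∀ τ : ℝ, HasDerivAt (fun s => -Real.exp (-m * s) / m) (Real.exp (-m * τ)) τ := by
    intro τ
    have := ((((hasDerivAt_id τ).const_mul (-m)).exp).neg).div_const m
    refine this.congr_deriv ?_
    simp only [id]
    field_simp
  rw [intervalIntegral.integral_eq_sub_of_hasDerivAt (fun τ _ => h τ)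
    (Continuous.intervalIntegrable (by fun_prop) 0 t)]
  rw [mul_zero, Real.exp_zero]; ring

lemma IsMildSolution.intervalIntegrable (hd : 2 ≤ d) {g : ℝ → ℝ} (hg : IsKernel d g)
    {A : Matrix (Fin d) (Fin d) ℝ} {β : ℝ} {φ₀ : E d → ℂ} {φ : ℝ → E d → ℂ}
    (hφ : IsMildSolution g A β φ₀ φ) {t : ℝ} (ht : 0 ≤ t) (k : E d) :
    IntervalIntegrable (fun τ => Eop A β τ (Gain g (φ (t - τ))) k) volume 0 t := by
  have hc : Continuous (Function.uncurry fun τ => φ (max (t - τ) 0)) := by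
    have h1 : Continuous fun x : ℝ × E d => (max (t - x.1) 0, x.2) := by fun_prop
    exact hφ.cont.comp_continuous h1 fun x => ⟨le_max_right (t - x.1) 0, mem_univ _⟩
  have h1 : IntervalIntegrable (fun τ => Eop A β τ (Gain g (φ (max (t - τ) 0))) k) volume 0 t := by
    refine IntervalIntegrable.mono_fun' (g := fun τ => Real.exp (-τ))
      (Continuous.intervalIntegrable (by fun_prop) 0 t)
      (measurable_Eop_Gain hd hg A β hc.measurable k).aestronglyMeasurable
      (Filter.Eventually.of_forall fun τ => ?_)
    exact norm_Eop_Gain_le hd hg A β τ (hφ.mem _ (le_max_right _ _)) k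
  refine h1.congr fun τ hτ => ?_
  rw [uIoc_of_le ht] at hτ
  rw [max_eq_left (by linarith [hτ.2])]

/-- The deviation of a mild solution from a stationary solution, corrected by a moment flow, solves
an integral equation. -/
lemma IsMildSolution.sub_eq (hd : 2 ≤ d) {g : ℝ → ℝ} (hg : IsKernel d g)
    {A : Matrix (Fin d) (Fin d) ℝ} {β : ℝ} {φ₀ : E d → ℂ} {φ : ℝ → E d → ℂ}
    (hφ : IsMildSolution g A β φ₀ φ) {ψ : E d → ℂ} (hψ : ψ ∈ charFcts d)
    (hψs : IsStationary g A β ψ) {q : ℝ} {D : ℝ → Matrix (Fin d) (Fin d) ℝ}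
    (hD : IsMomentFlow A q β D) {t : ℝ} (ht : 0 ≤ t) (k : E d) :
    φ t k - ψ k + (1 / 2 : ℂ) * (qf (D t) k : ℂ)
      = Eop A β t (fun k => φ₀ k - ψ k + (1 / 2 : ℂ) * (qf (D 0) k : ℂ)) k
        + ∫ τ in (0 : ℝ)..t, Eop A β τ (fun k => Gain g (φ (t - τ)) k - Gain g ψ k
          + (1 / 2 : ℂ) * (qf (gainMoment q (D (t - τ))) k : ℂ)) k := by
  have hi1 := hφ.intervalIntegrable hd hg ht k
  have hi2 : IntervalIntegrable (fun τ => Eop A β τ (Gain g ψ) k) volume 0 t :=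
    (intervalIntegrable_iff_integrableOn_Ioc_of_le ht).2
      ((integrableOn_Eop_Gain hd hg A β hψ k).mono_set Ioc_subset_Ioi_self)
  have hc : Continuous fun τ => Real.exp (-τ) * qf (gainMoment q (D (t - τ))) (flow A β τ k) :=
    (by fun_prop : Continuous fun τ : ℝ => Real.exp (-τ)).mul
      (continuous_qf_comp ((continuous_gainMoment q).comp (hD.continuous.comp (by fun_prop)))
        (continuous_flow_apply A β k))
  have hi3 : IntervalIntegrable (fun τ => (1 / 2 : ℂ) * ((Real.exp (-τ) *
      qf (gainMoment q (D (t - τ))) (flow A β τ k) : ℝ) : ℂ)) volume 0 t :=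
    Continuous.intervalIntegrable (by fun_prop) 0 t
  have h3 := hD.integral_eq t k
  have h4 : ∫ τ in (0 : ℝ)..t, Eop A β τ (fun k => Gain g (φ (t - τ)) k - Gain g ψ k
          + (1 / 2 : ℂ) * (qf (gainMoment q (D (t - τ))) k : ℂ)) k
      = (∫ τ in (0 : ℝ)..t, Eop A β τ (Gain g (φ (t - τ))) k)
        - (∫ τ in (0 : ℝ)..t, Eop A β τ (Gain g ψ) k)
        + (1 / 2 : ℂ) * ((qf (D t) k - Real.exp (-t) * qf (D 0) (flow A β t k) : ℝ) : ℂ) := by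
    rw [← h3, ← intervalIntegral.integral_ofReal, ← intervalIntegral.integral_const_mul,
      ← intervalIntegral.integral_sub hi1 hi2, ← intervalIntegral.integral_add (hi1.sub hi2) hi3]
    refine intervalIntegral.integral_congr fun τ _ => ?_
    simp only [Eop_eq]
    push_cast
    ring
  have h5 := hφ.eqn t ht k
  have h6 := hψs.mild hd hg hψ ht k
  rw [h4]
  have h7 : Eop A β t (fun k => φ₀ k - ψ k + (1 / 2 : ℂ) * (qf (D 0) k : ℂ)) k
      = Eop A β t φ₀ k - Eop A β t ψ k
        + (1 / 2 : ℂ) * ((Real.exp (-t) * qf (D 0) (flow A β t k) : ℝ) : ℂ) := by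
    simp only [Eop_eq]; push_cast; ring
  rw [h7, Complex.ofReal_sub]
  linear_combination h5 - h6

/-- The comparison estimate. A bound `H e^{-θt} |k|^r` of the corrected deviation holds up to an
error `C 2^{-n} e^{4t} (1 + |k|²)` for every `n`, by induction on `n` through the integral
equation. -/
theorem IsMildSolution.norm_sub_le (hd : 2 ≤ d) {g : ℝ → ℝ} (hg : IsKernel d g)
    {A : Matrix (Fin d) (Fin d) ℝ} {β : ℝ} {φ₀ : E d → ℂ} {φ : ℝ → E d → ℂ}
    (hφ : IsMildSolution g A β φ₀ φ) {ψ : E d → ℂ} (hψ : ψ ∈ charFcts d)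
    (hψs : IsStationary g A β ψ) {D : ℝ → Matrix (Fin d) (Fin d) ℝ}
    (hD : IsMomentFlow A (kernelQ d g) β D) {r θ M S H : ℝ} (hr2 : 2 ≤ r) (hr4 : r ≤ 4)
    (hM : 0 ≤ M) (hS : 0 ≤ S) (hH : 0 ≤ H)
    (hDM : ∀ t, 0 ≤ t → ∀ k : E d, |qf (D t) k| ≤ M * ‖k‖ ^ 2)
    (h0 : ∀ k, ‖φ₀ k - ψ k + (1 / 2 : ℂ) * (qf (D 0) k : ℂ)‖ ≤ H * ‖k‖ ^ r)
    (hφ1 : ∀ t, 0 ≤ t → ∀ u v : E d, |qf (D t) u| * ‖φ t v - 1‖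
      ≤ S * Real.exp (-θ * t) * (‖u‖ ^ 2 * ‖v‖ ^ (r - 2)))
    (hψ1 : ∀ t, 0 ≤ t → ∀ u v : E d, |qf (D t) u| * ‖ψ v - 1‖
      ≤ S * Real.exp (-θ * t) * (‖u‖ ^ 2 * ‖v‖ ^ (r - 2)))
    (hε : 2 * (‖act A‖ + |β|) ≤ 1) (hm : 0 < 1 - r * (‖act A‖ + |β|) - θ)
    (hHS : (1 - (r - 2) / 4 * kernelQ d g) * H + S ≤ (1 - r * (‖act A‖ + |β|) - θ) * H)
    {t : ℝ} (ht : 0 ≤ t) (k : E d) :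
    ‖φ t k - ψ k + (1 / 2 : ℂ) * (qf (D t) k : ℂ)‖ ≤ H * Real.exp (-θ * t) * ‖k‖ ^ r := by
  set ε := ‖act A‖ + |β| with hεdef
  have hε0 : 0 ≤ ε := by positivity
  set m := 1 - r * ε - θ with hmdef
  have key : ∀ n : ℕ, ∀ t, 0 ≤ t → ∀ k, ‖φ t k - ψ k + (1 / 2 : ℂ) * (qf (D t) k : ℂ)‖
      ≤ H * Real.exp (-θ * t) * ‖k‖ ^ r
        + (2 + M) * (1 / 2) ^ n * Real.exp (4 * t) * (1 + ‖k‖ ^ 2) := by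
    intro n
    induction n with
    | zero =>
      intro t ht k
      have h1 := norm_le_one_of_mem (hφ.mem t ht) k
      have h2 := norm_le_one_of_mem hψ k
      have h3 : ‖(1 / 2 : ℂ) * (qf (D t) k : ℂ)‖ ≤ M * ‖k‖ ^ 2 := by
        rw [norm_mul, Complex.norm_real, Real.norm_eq_abs]
        have : ‖(1 / 2 : ℂ)‖ = 1 / 2 := by norm_num
        rw [this]
        linarith [hDM t ht k, abs_nonneg (qf (D t) k)]
      have h4 : 1 ≤ Real.exp (4 * t) := Real.one_le_exp (by linarith)
      have h5 : (2 + M) * (1 + ‖k‖ ^ 2) ≤ (2 + M) * (1 + ‖k‖ ^ 2) * Real.exp (4 * t) :=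
        le_mul_of_one_le_right (by positivity) h4
      have h6 : 0 ≤ H * Real.exp (-θ * t) * ‖k‖ ^ r := by positivity
      have h7 := norm_add_le (φ t k - ψ k) ((1 / 2 : ℂ) * (qf (D t) k : ℂ))
      have h8 := _root_.norm_sub_le (φ t k) (ψ k)
      rw [pow_zero, mul_one]
      nlinarith [sq_nonneg ‖k‖]
    | succ n ih =>
      intro t ht k
      rw [hφ.sub_eq hd hg hψ hψs hD ht k]
      set b := (2 + M) * (1 / 2) ^ n with hb
      have hb0 : 0 ≤ b := by positivity
      have hfirst : ‖Eop A β t (fun k => φ₀ k - ψ k + (1 / 2 : ℂ) * (qf (D 0) k : ℂ)) k‖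
          ≤ H * ‖k‖ ^ r * Real.exp (-θ * t) * Real.exp (-m * t) := by
        rw [Eop_eq, norm_mul, Complex.norm_real, Real.norm_of_nonneg (Real.exp_pos _).le]
        calc _ ≤ Real.exp (-t) * (H * (Real.exp (r * ε * t) * ‖k‖ ^ r)) := by
              refine mul_le_mul_of_nonneg_left ((h0 _).trans ?_) (Real.exp_pos _).le
              exact mul_le_mul_of_nonneg_left (norm_flow_rpow_le A β ht (by linarith) k) hH
          _ = _ := by
              have : Real.exp (-θ * t) * Real.exp (-m * t)
                  = Real.exp (-t) * Real.exp (r * ε * t) := by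
                rw [← Real.exp_add, ← Real.exp_add]; congr 1; rw [hmdef]; ring
              linear_combination (-H * ‖k‖ ^ r) * this
      have hsecond : ∀ τ ∈ Ioc 0 t, ‖Eop A β τ (fun k => Gain g (φ (t - τ)) k - Gain g ψ k
          + (1 / 2 : ℂ) * (qf (gainMoment (kernelQ d g) (D (t - τ))) k : ℂ)) k‖
          ≤ m * H * ‖k‖ ^ r * Real.exp (-θ * t) * Real.exp (-m * τ)
            + 2 * b * Real.exp (4 * t) * (1 + ‖k‖ ^ 2) * Real.exp (-4 * τ) := by
        intro τ hτ
        have hτ0 : 0 ≤ τ := hτ.1.le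
        have hs : 0 ≤ t - τ := by linarith [hτ.2]
        have hG := norm_Gain_sub_le hd hg (hφ.mem _ hs) hψ (D (t - τ)) hr2 hr4
          (a := H * Real.exp (-θ * (t - τ))) (b := b * Real.exp (4 * (t - τ)))
          (s := S * Real.exp (-θ * (t - τ))) (by positivity) (by positivity) (by positivity)
          (ih (t - τ) hs) (hφ1 _ hs) (hψ1 _ hs) (flow A β τ k)
        rw [Eop_eq, norm_mul, Complex.norm_real, Real.norm_of_nonneg (Real.exp_pos _).le]
        have hx := norm_flow_rpow_le A β hτ0 (by linarith : 0 ≤ r) k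
        have hx2 := norm_flow_sq_le A β hτ0 k
        rw [← hεdef] at hx hx2
        have hx3 : 1 + ‖flow A β τ k‖ ^ 2 ≤ Real.exp τ * (1 + ‖k‖ ^ 2) := by
          have h1 : Real.exp (2 * ε * τ) ≤ Real.exp τ :=
            Real.exp_le_exp.2 (by nlinarith)
          have h2 : 1 ≤ Real.exp τ := Real.one_le_exp hτ0
          nlinarith [sq_nonneg ‖k‖]
        have hcoef : (1 - (r - 2) / 4 * kernelQ d g) * (H * Real.exp (-θ * (t - τ)))
            + S * Real.exp (-θ * (t - τ)) ≤ m * H * Real.exp (-θ * (t - τ)) := by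
          rw [← mul_assoc, ← add_mul]
          exact mul_le_mul_of_nonneg_right hHS (Real.exp_pos _).le
        calc _ ≤ Real.exp (-τ) * (m * H * Real.exp (-θ * (t - τ)) * (Real.exp (r * ε * τ) * ‖k‖ ^ r)
              + 2 * (b * Real.exp (4 * (t - τ))) * (Real.exp τ * (1 + ‖k‖ ^ 2))) := by
              refine mul_le_mul_of_nonneg_left (hG.trans (add_le_add ?_ ?_)) (Real.exp_pos _).le
              · exact mul_le_mul hcoef hx (by positivity) (by positivity)
              · exact mul_le_mul_of_nonneg_left hx3 (by positivity)
          _ = _ := by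
              have e1 : Real.exp (-τ) * (Real.exp (-θ * (t - τ)) * Real.exp (r * ε * τ))
                  = Real.exp (-θ * t) * Real.exp (-m * τ) := by
                rw [← Real.exp_add, ← Real.exp_add, ← Real.exp_add]; congr 1; rw [hmdef]; ring
              have e2 : Real.exp (-τ) * (Real.exp (4 * (t - τ)) * Real.exp τ)
                  = Real.exp (4 * t) * Real.exp (-4 * τ) := by
                rw [← Real.exp_add, ← Real.exp_add, ← Real.exp_add]; congr 1; ring
              linear_combination (m * H * ‖k‖ ^ r) * e1 + (2 * b * (1 + ‖k‖ ^ 2)) * e2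
      refine (norm_add_le _ _).trans ((add_le_add hfirst
        (intervalIntegral.norm_integral_le_of_norm_le ht
          (Filter.Eventually.of_forall hsecond)
          (Continuous.intervalIntegrable (by fun_prop) 0 t))).trans ?_)
      rw [intervalIntegral.integral_add (Continuous.intervalIntegrable (by fun_prop) 0 t)
        (Continuous.intervalIntegrable (by fun_prop) 0 t), intervalIntegral.integral_const_mul,
        intervalIntegral.integral_const_mul, integral_exp_neg_mul hm.ne',
        integral_exp_neg_mul (by norm_num)]
      have e3 : m * H * ‖k‖ ^ r * Real.exp (-θ * t) * ((1 - Real.exp (-m * t)) / m)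
          = H * ‖k‖ ^ r * Real.exp (-θ * t) * (1 - Real.exp (-m * t)) := by
        field_simp
      rw [e3, pow_succ (1 / 2 : ℝ) n, ← mul_assoc (2 + M), ← hb]
      have e4 : 0 ≤ b * Real.exp (4 * t) * (1 + ‖k‖ ^ 2) * Real.exp (-4 * t) := by positivity
      linarith
  have hlim : Filter.Tendsto (fun n : ℕ => H * Real.exp (-θ * t) * ‖k‖ ^ r
        + (2 + M) * (1 / 2) ^ n * Real.exp (4 * t) * (1 + ‖k‖ ^ 2)) Filter.atTop
      (nhds (H * Real.exp (-θ * t) * ‖k‖ ^ r)) := by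
    have h1 := tendsto_pow_atTop_nhds_zero_of_lt_one (r := (1 / 2 : ℝ)) (by norm_num) (by norm_num)
    have h2 := (((h1.const_mul (2 + M)).mul_const (Real.exp (4 * t))).mul_const
      (1 + ‖k‖ ^ 2)).const_add (H * Real.exp (-θ * t) * ‖k‖ ^ r)
    simpa using h2
  exact ge_of_tendsto' hlim fun n => key n t ht k

/-- The quadratic growth at the origin of a solution with finite second moment. -/
lemma IsMildSolution.norm_sub_one_le (hd : 2 ≤ d) {g : ℝ → ℝ} (hg : IsKernel d g)
    {A : Matrix (Fin d) (Fin d) ℝ} {β : ℝ} {φ₀ : E d → ℂ} {φ : ℝ → E d → ℂ}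
    (hφ : IsMildSolution g A β φ₀ φ) {H : ℝ} (hH : 0 ≤ H) (h0 : ∀ k, ‖φ₀ k - 1‖ ≤ H * ‖k‖ ^ 2)
    (hε : 2 * (‖act A‖ + |β|) ≤ 1) {t : ℝ} (ht : 0 ≤ t) (k : E d) :
    ‖φ t k - 1‖ ≤ H * Real.exp (2 * (‖act A‖ + |β|) * t) * ‖k‖ ^ 2 := by
  have hD : IsMomentFlow A (kernelQ d g) β fun _ => 0 := isMomentFlow_const <| by
    simpa using realMoment_smul A (kernelQ d g) 0 0
  have := hφ.norm_sub_le hd hg one_mem_charFcts (isStationary_one hd hg A β) hD (r := 2)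
    (θ := -(2 * (‖act A‖ + |β|))) (M := 0) (S := 0) (H := H) le_rfl (by norm_num) le_rfl le_rfl hH
    (fun t _ k => by simp [qf_zero_left]) (fun k => by simpa [qf_zero_left] using h0 k)
    (fun t _ u v => by simp [qf_zero_left]) (fun t _ u v => by simp [qf_zero_left]) hε
    (by linarith) (by linarith) ht k
  simpa [qf_zero_left] using this

/-! ### The second moment of the initial datum -/

lemma nonpos_of_forall_le_rpow {x C a : ℝ} (ha : 0 < a) (h : ∀ s : ℝ, 0 < s → x ≤ C * s ^ a) :
    x ≤ 0 := by
  have h1 : Filter.Tendsto (fun s : ℝ => C * s ^ a) (nhdsWithin 0 (Ioi 0)) (nhds 0) := by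
    have h2 : Filter.Tendsto (fun s : ℝ => C * s ^ a) (nhds 0) (nhds (C * 0 ^ a)) :=
      ((Real.continuousAt_rpow_const 0 a (Or.inr ha.le)).tendsto).const_mul C
    rw [Real.zero_rpow ha.ne', mul_zero] at h2
    exact h2.mono_left nhdsWithin_le_nhds
  exact ge_of_tendsto h1 (eventually_mem_nhdsWithin.mono fun s hs => h s hs)

/-- The quadratic part of a characteristic function is real and nonpositive. -/
lemma exists_secondMoment {φ : E d → ℂ} (hφ : φ ∈ charFcts d) {c : Fin d → Fin d → ℂ} {C p : ℝ}
    (hp : 2 < p) (h : ∀ k : E d,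
      ‖φ k - (1 + ∑ j, ∑ l, c j l * (k j : ℂ) * (k l : ℂ))‖ ≤ C * ‖k‖ ^ p) :
    ∃ B : Matrix (Fin d) (Fin d) ℝ, B.transpose = B ∧ (∀ k : E d, 0 ≤ qf B k) ∧
      ∀ k : E d, ‖φ k - 1 + (1 / 2 : ℂ) * (qf B k : ℂ)‖ ≤ C * ‖k‖ ^ p := by
  set z : E d → ℂ := fun k => ∑ j, ∑ l, c j l * (k j : ℂ) * (k l : ℂ) with hz
  have hzs : ∀ (s : ℝ) k, z (s • k) = (s : ℂ) ^ 2 * z k := by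
    intro s k
    simp only [hz, PiLp.smul_apply, smul_eq_mul, Complex.ofReal_mul, Finset.mul_sum]
    exact Finset.sum_congr rfl fun j _ => Finset.sum_congr rfl fun l _ => by ring
  have hs : ∀ (k : E d) (s : ℝ), 0 < s →
      ‖φ (s • k) - (1 + (s : ℂ) ^ 2 * z k)‖ ≤ s ^ 2 * (C * ‖k‖ ^ p * s ^ (p - 2)) := by
    intro k s hs
    have h1 := h (s • k)
    change ‖φ (s • k) - (1 + z (s • k))‖ ≤ _ at h1
    rw [hzs, norm_smul, Real.norm_of_nonneg hs.le, Real.mul_rpow hs.le (norm_nonneg _)] at h1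
    refine h1.trans_eq ?_
    have h2 : s ^ p = s ^ 2 * s ^ (p - 2) := by
      rw [← Real.rpow_two, ← Real.rpow_add hs]; congr 1; ring
    rw [h2]; ring
  have hre : ∀ k, (z k).re ≤ 0 := by
    intro k
    refine nonpos_of_forall_le_rpow (a := p - 2) (C := C * ‖k‖ ^ p) (by linarith) fun s hs0 => ?_
    have h1 := (abs_le.1 (Complex.abs_re_le_norm _)).1.trans' (neg_le_neg (hs k s hs0))
    have h2 := (Complex.re_le_norm (φ (s • k))).trans (norm_le_one_of_mem hφ _)
    rw [← Complex.ofReal_pow, Complex.sub_re, Complex.add_re, Complex.re_ofReal_mul,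
      Complex.one_re] at h1
    have h3 : s ^ 2 * (z k).re ≤ s ^ 2 * (C * ‖k‖ ^ p * s ^ (p - 2)) := by linarith
    exact le_of_mul_le_mul_left h3 (by positivity)
  have him : ∀ k, (z k).im = 0 := by
    intro k
    -- compare the expansions at `s k` and `-s k`, where `φ` takes conjugate values
    have key : ∀ s : ℝ, 0 < s → |(z k).im| ≤ C * ‖k‖ ^ p * s ^ (p - 2) := by
      intro s hs0
      have h1 := (Complex.abs_im_le_norm _).trans (hs k s hs0)
      have h2 := (Complex.abs_im_le_norm _).trans (hs (-k) s hs0)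
      have hz' : z (-k) = z k := by
        have := hzs (-1) k
        simpa using this
      rw [smul_neg, apply_neg_of_mem hφ, hz', norm_neg] at h2
      rw [← Complex.ofReal_pow] at h1 h2
      simp only [Complex.sub_im, Complex.add_im, Complex.im_ofReal_mul, Complex.one_im,
        Complex.conj_im, zero_add] at h1 h2
      have h3 : s ^ 2 * |(z k).im| ≤ s ^ 2 * (C * ‖k‖ ^ p * s ^ (p - 2)) := by
        rw [← abs_of_pos (show 0 < s ^ 2 by positivity), ← abs_mul, abs_of_pos (show 0 < s ^ 2 by
          positivity)]
        rw [abs_le] at h1 h2 ⊢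
        constructor <;> linarith [h1.1, h1.2, h2.1, h2.2]
      exact le_of_mul_le_mul_left h3 (by positivity)
    exact abs_nonpos_iff.1 (nonpos_of_forall_le_rpow (by linarith) key)
  set B : Matrix (Fin d) (Fin d) ℝ := Matrix.of fun j l => -((c j l).re + (c l j).re) with hB
  have hqf : ∀ k, qf B k = -(2 * (z k).re) := by
    intro k
    have h1 : (z k).re = ∑ j, ∑ l, (c j l).re * k j * k l := by
      simp only [hz, Complex.re_sum]
      refine Finset.sum_congr rfl fun j _ => Finset.sum_congr rfl fun l _ => ?_
      rw [mul_assoc, ← Complex.ofReal_mul, Complex.re_mul_ofReal, mul_assoc]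
    have h2 : ∑ j, ∑ l, (c l j).re * k j * k l = (z k).re := by
      rw [h1, Finset.sum_comm]
      exact Finset.sum_congr rfl fun j _ => Finset.sum_congr rfl fun l _ => by ring
    have h3 : qf B k = -(∑ j, ∑ l, (c j l).re * k j * k l + ∑ j, ∑ l, (c l j).re * k j * k l) := by
      simp only [qf, hB, Matrix.of_apply, ← Finset.sum_add_distrib, ← Finset.sum_neg_distrib]
      exact Finset.sum_congr rfl fun j _ => Finset.sum_congr rfl fun l _ => by ring
    rw [h3, h2, ← h1]; ring
  refine ⟨B, ?_, fun k => by rw [hqf]; linarith [hre k], fun k => ?_⟩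
  · ext i j; simp only [hB, Matrix.transpose_apply, Matrix.of_apply]; ring
  · have h1 : z k = (((z k).re : ℝ) : ℂ) := Complex.ext rfl (by simp [him])
    have h2 : φ k - 1 + (1 / 2 : ℂ) * (qf B k : ℂ) = φ k - (1 + z k) := by
      rw [hqf, h1]; push_cast; ring_nf; simp
    rw [h2]
    exact h k

/-! ### The self-similar profile -/

lemma half_mul_qf_eq_sum (B : Matrix (Fin d) (Fin d) ℝ) (k : E d) :
    (1 / 2 : ℂ) * ∑ j, ∑ l, ((B j l * k j * k l : ℝ) : ℂ) = (1 / 2 : ℂ) * (qf B k : ℂ) := by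
  rw [qf]; push_cast; rfl

lemma mem_Fclass_iff {r : ℝ} {B : Matrix (Fin d) (Fin d) ℝ} {Ψ : E d → ℂ} :
    Ψ ∈ Fclass r B ↔ Ψ ∈ charFcts d ∧
      ∃ K : ℝ, ∀ k, ‖Ψ k - 1 + (1 / 2 : ℂ) * (qf B k : ℂ)‖ ≤ K * ‖k‖ ^ r := by
  simp only [Fclass, half_mul_qf_eq_sum, Set.mem_ofPred_eq, sub_add]

lemma SpectralData.qf_le {A : Matrix (Fin d) (Fin d) ℝ} {q β : ℝ}
    {N N' : Matrix (Fin d) (Fin d) ℝ} (h : SpectralData A q β N N') (k : E d) :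
    qf N k ≤ √d * ‖k‖ ^ 2 := by
  have h1 : ‖matVec N‖ = √d := by
    rw [← Real.sqrt_sq (norm_nonneg (matVec N)), norm_matVec_sq, h.norm_sq]
  rw [← h1]
  exact (le_abs_self _).trans (abs_qf_le N k)

lemma IsStationary.eq_of_mem_Fclass (hd : 2 ≤ d) {g : ℝ → ℝ} (hg : IsKernel d g)
    {A N : Matrix (Fin d) (Fin d) ℝ} {β r : ℝ} (hr2 : 2 < r) (hr4 : r ≤ 4)
    (hε : r * (‖act A‖ + |β|) ≤ (r - 2) / 16 * kernelQ d g) {φ ψ : E d → ℂ}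
    (hφs : IsStationary g A β φ) (hψs : IsStationary g A β ψ)
    (hφ : φ ∈ Fclass r N) (hψ : ψ ∈ Fclass r N) : φ = ψ := by
  rw [mem_Fclass_iff] at hφ hψ
  obtain ⟨hφ, K₁, h₁⟩ := hφ
  obtain ⟨hψ, K₂, h₂⟩ := hψ
  refine IsStationary.eq_of_norm_sub_le hd hg hr2 hr4 hε hφ hψ hφs hψs
    (a := |K₁| + |K₂|) (by positivity) fun k => ?_
  have h3 : φ k - ψ k = (φ k - 1 + (1 / 2 : ℂ) * (qf N k : ℂ))
      - (ψ k - 1 + (1 / 2 : ℂ) * (qf N k : ℂ)) := by ring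
  rw [h3, add_mul]
  refine (norm_sub_le _ _).trans (add_le_add ((h₁ k).trans ?_) ((h₂ k).trans ?_)) <;>
  · gcongr
    exact le_abs_self _

lemma IsProfile.eq_of_spectralData (hd : 2 ≤ d) {g : ℝ → ℝ} {p β β' : ℝ}
    {A M N N' : Matrix (Fin d) (Fin d) ℝ} {Ψ : E d → ℂ}
    (h : SpectralData A (kernelQ d g) β N N') (hΨ : IsProfile g p A β' M Ψ) :
    β' = β ∧ M = N := by
  obtain rfl : β' = β := IsLeadingEigenvalue.unique hΨ.leading h.isLeadingEigenvalue
  exact ⟨rfl, h.eigenvector_unique hd hΨ.eigenvector hΨ.posDef hΨ.norm_eq⟩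

lemma SpectralData.posSemidef {A : Matrix (Fin d) (Fin d) ℝ} {q β : ℝ}
    {N N' : Matrix (Fin d) (Fin d) ℝ} (h : SpectralData A q β N N') : N.PosSemidef :=
  h.isPosDef.posSemidef

lemma SpectralData.existsUnique_isProfile (hd : 2 ≤ d) {g : ℝ → ℝ} (hg : IsKernel d g) {p β : ℝ}
    (hp : 2 < p) {A N N' : Matrix (Fin d) (Fin d) ℝ} (h : SpectralData A (kernelQ d g) β N N')
    (hε : min p 4 * (‖act A‖ + |β|) ≤ (min p 4 - 2) / 16 * kernelQ d g) :
    ∃! x : ℝ × Matrix (Fin d) (Fin d) ℝ × (E d → ℂ), IsProfile g p A x.1 x.2.1 x.2.2 := by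
  have hr2 : 2 < min p 4 := lt_min hp (by norm_num)
  have hr4 : min p 4 ≤ 4 := min_le_right _ _
  obtain ⟨K, -, hK⟩ := exists_isStationary hd hg hr2 hr4 (M := √d) (Real.sqrt_nonneg _)
  obtain ⟨Ψ, hΨ, hΨs, hΨK⟩ := hK A β N hε h.eig h.posSemidef h.qf_le
  refine ⟨(β, N, Ψ), ⟨h.isLeadingEigenvalue, h.eigenvector, h.isPosDef, h.norm_eq hd,
    mem_Fclass_iff.2 ⟨hΨ, K, hΨK⟩, hΨs⟩, ?_⟩
  rintro ⟨β', M, Ψ'⟩ h'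
  obtain ⟨rfl, rfl⟩ := IsProfile.eq_of_spectralData hd h h'
  obtain rfl : Ψ' = Ψ := IsStationary.eq_of_mem_Fclass hd hg hr2 hr4 hε h'.stationary hΨs h'.mem
    (mem_Fclass_iff.2 ⟨hΨ, K, hΨK⟩)
  rfl

lemma exists_spectralData_of_pos (hd : 2 ≤ d) {q η : ℝ} (hq : 0 < q) (hη : 0 < η) :
    ∃ ε₀ : ℝ, 0 < ε₀ ∧ ∀ A : Matrix (Fin d) (Fin d) ℝ, ‖act A‖ ≤ ε₀ →
      ∃ (β : ℝ) (N N' : Matrix (Fin d) (Fin d) ℝ), ‖act A‖ + |β| ≤ η ∧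
        SpectralData A q β N N' := by
  obtain ⟨ε₁, hε₁, h⟩ := exists_spectralData hd hq
  refine ⟨min ε₁ (η / (1 + 2 * (d : ℝ) ^ 2)), by positivity, fun A hA => ?_⟩
  obtain ⟨β, N, N', hβ, hN⟩ := h A (hA.trans (min_le_left _ _))
  refine ⟨β, N, N', ?_, hN⟩
  have h2 := hA.trans (min_le_right _ _)
  rw [le_div_iff₀ (by positivity)] at h2
  linarith

/-! ### Convergence to the profile -/

lemma norm_sub_one_le_sq {χ : E d → ℂ} (hχ : χ ∈ charFcts d) {B : Matrix (Fin d) (Fin d) ℝ}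
    {r C b : ℝ} (hr : 2 ≤ r) (hC : 0 ≤ C) (hb : 0 ≤ b)
    (h : ∀ k, ‖χ k - 1 + (1 / 2 : ℂ) * (qf B k : ℂ)‖ ≤ C * ‖k‖ ^ r)
    (hB : ∀ k : E d, |qf B k| ≤ b * ‖k‖ ^ 2) (k : E d) : ‖χ k - 1‖ ≤ (C + b + 2) * ‖k‖ ^ 2 := by
  rcases le_total ‖k‖ 1 with hk | hk
  · have h1 : χ k - 1 = (χ k - 1 + (1 / 2 : ℂ) * (qf B k : ℂ)) - (1 / 2 : ℂ) * (qf B k : ℂ) := by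
      ring
    have h2 : ‖(1 / 2 : ℂ) * (qf B k : ℂ)‖ ≤ b * ‖k‖ ^ 2 := by
      rw [norm_mul, Complex.norm_real, Real.norm_eq_abs]
      have : ‖(1 / 2 : ℂ)‖ = 1 / 2 := by norm_num
      rw [this]
      linarith [hB k, abs_nonneg (qf B k)]
    have h3 : ‖k‖ ^ r ≤ ‖k‖ ^ 2 := by
      rcases (norm_nonneg k).eq_or_lt with h0 | h0
      · rw [← h0, Real.zero_rpow (by linarith)]; norm_num
      · rw [← Real.rpow_two]; exact Real.rpow_le_rpow_of_exponent_ge h0 hk hr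
    have h4 := mul_le_mul_of_nonneg_left h3 hC
    rw [h1]
    refine (norm_sub_le _ _).trans ((add_le_add (h k) h2).trans ?_)
    nlinarith [sq_nonneg ‖k‖]
  · have h1 := norm_sub_le (χ k) 1
    have h2 := norm_le_one_of_mem hχ k
    rw [norm_one] at h1
    have h3 : 1 ≤ ‖k‖ ^ 2 := one_le_pow₀ hk
    nlinarith

lemma norm_sub_one_le_rpow {χ : E d → ℂ} (hχ : χ ∈ charFcts d) {h a : ℝ} (hh : 0 ≤ h)
    (ha0 : 0 < a) (ha2 : a ≤ 2) {k : E d} (hk : ‖χ k - 1‖ ≤ h * ‖k‖ ^ 2) :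
    ‖χ k - 1‖ ≤ (2 + h) * ‖k‖ ^ a := by
  rcases le_total ‖k‖ 1 with hk1 | hk1
  · have h3 : ‖k‖ ^ 2 ≤ ‖k‖ ^ a := by
      rcases (norm_nonneg k).eq_or_lt with h0 | h0
      · rw [← h0, Real.zero_rpow ha0.ne']; norm_num
      · rw [← Real.rpow_two]; exact Real.rpow_le_rpow_of_exponent_ge h0 hk1 ha2
    have h4 : 0 ≤ ‖k‖ ^ a := by positivity
    nlinarith [mul_le_mul_of_nonneg_left h3 hh]
  · have h1 := norm_sub_le (χ k) 1
    have h2 := norm_le_one_of_mem hχ k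
    rw [norm_one] at h1
    have h3 : 1 ≤ ‖k‖ ^ a := Real.one_le_rpow hk1 ha0.le
    nlinarith

/-- A Taylor remainder of order `p` is also one of every order `r ∈ [2, p]`. -/
lemma norm_remainder_le_of_le {χ : E d → ℂ} (hχ : χ ∈ charFcts d)
    {B : Matrix (Fin d) (Fin d) ℝ} {r p C : ℝ} (hr : 2 ≤ r) (hrp : r ≤ p) (hC : 0 ≤ C)
    (h : ∀ k, ‖χ k - 1 + (1 / 2 : ℂ) * (qf B k : ℂ)‖ ≤ C * ‖k‖ ^ p) (k : E d) :
    ‖χ k - 1 + (1 / 2 : ℂ) * (qf B k : ℂ)‖ ≤ (C + 2 + ‖matVec B‖) * ‖k‖ ^ r := by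
  have hr0 : 0 ≤ ‖k‖ ^ r := by positivity
  rcases le_total ‖k‖ 1 with hk | hk
  · have h3 : ‖k‖ ^ p ≤ ‖k‖ ^ r := by
      rcases (norm_nonneg k).eq_or_lt with h0 | h0
      · rw [← h0, Real.zero_rpow (by linarith), Real.zero_rpow (by linarith)]
      · exact Real.rpow_le_rpow_of_exponent_ge h0 hk hrp
    refine (h k).trans ?_
    nlinarith [mul_le_mul_of_nonneg_left h3 hC, mul_nonneg (norm_nonneg (matVec B)) hr0]
  · have h1 := norm_sub_le (χ k) 1
    have h2 := norm_le_one_of_mem hχ k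
    rw [norm_one] at h1
    have h3 : ‖(1 / 2 : ℂ) * (qf B k : ℂ)‖ ≤ ‖matVec B‖ * ‖k‖ ^ 2 := by
      rw [norm_mul, Complex.norm_real, Real.norm_eq_abs]
      have : ‖(1 / 2 : ℂ)‖ = 1 / 2 := by norm_num
      rw [this]
      linarith [abs_qf_le B k, abs_nonneg (qf B k)]
    have h4 : ‖k‖ ^ 2 ≤ ‖k‖ ^ r := by
      rw [← Real.rpow_two]; exact Real.rpow_le_rpow_of_exponent_le hk hr
    have h5 : 1 ≤ ‖k‖ ^ r := Real.one_le_rpow hk (by linarith)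
    have h6 := norm_add_le (χ k - 1) ((1 / 2 : ℂ) * (qf B k : ℂ))
    nlinarith [mul_le_mul_of_nonneg_left h4 (norm_nonneg (matVec B))]

/-- Second moments without component along the leading eigenvector relax exponentially. -/
lemma SpectralData.exists_isMomentFlow (hd : 2 ≤ d) {A : Matrix (Fin d) (Fin d) ℝ} {q β : ℝ}
    {N N' : Matrix (Fin d) (Fin d) ℝ} (h : SpectralData A q β N N')
    {D₀ : Matrix (Fin d) (Fin d) ℝ} (hD₀ : frob N' D₀ = 0) :
    ∃ D, D 0 = D₀ ∧ IsMomentFlow A q β D ∧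
      ∀ t, 0 ≤ t → ‖matVec (D t)‖ ≤ Real.exp (-(gap d q + 2 * β) * t) * ‖matVec D₀‖ := by
  have hsurj : ∀ x, x = matVec (matVec.symm x : Matrix (Fin d) (Fin d) ℝ) := fun x =>
    (matVec.apply_symm_apply x).symm
  obtain ⟨D, h0, hder, hdec⟩ := exists_decaying_flow (pertOp (gap d q) (idVec d) (shearOp A))
    (N' := matVec N') (β := β) (δ := gap d q / 2) (D₀ := matVec D₀)
    (fun x => by
      rw [hsurj x, ← matVec_realMoment hd]
      exact h.left _)
    (fun x hx => by
      rw [hsurj x] at hx ⊢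
      rw [← matVec_realMoment hd, norm_matVec_sq]
      exact h.coercive _ hx) hD₀
  refine ⟨fun t => matVec.symm (D t), by simp [h0], fun i j t => ?_, fun t ht => ?_⟩
  · have h1 := (EuclideanSpace.proj (𝕜 := ℝ) (i, j)).hasFDerivAt.comp_hasDerivAt t (hder t)
    refine h1.congr_deriv ?_
    change ((2 : ℝ) • (pertOp (gap d q) (idVec d) (shearOp A) (D t) - β • D t)) (i, j) = _
    rw [hsurj (D t), ← matVec_realMoment hd]
    simp only
    rfl
  · rw [matVec.apply_symm_apply]
    refine (hdec t ht).trans_eq ?_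
    congr 2; ring

lemma rpow_min_four_le {x p : ℝ} (hx : 0 ≤ x) (hp : 2 < p) : x ^ min p 4 ≤ x ^ 2 + x ^ p := by
  have hr : 2 < min p 4 := lt_min hp (by norm_num)
  have hp0 : 0 ≤ x ^ p := by positivity
  rcases le_total x 1 with h | h
  · have : x ^ min p 4 ≤ x ^ 2 := by
      rcases hx.eq_or_lt with rfl | h0
      · rw [Real.zero_rpow (by linarith)]; norm_num
      · rw [← Real.rpow_two]; exact Real.rpow_le_rpow_of_exponent_ge h0 h hr.le
    linarith
  · have := Real.rpow_le_rpow_of_exponent_le h (min_le_left p 4)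
    linarith [sq_nonneg x]

/-- Convergence for a fixed shear. The scale `lam` is chosen so that the second moment of the
initial datum differs from that of `Ψ(lam ·)` by a matrix without component along the leading
eigenvector. -/
lemma exists_norm_sub_le (hd : 2 ≤ d) {g : ℝ → ℝ} (hg : IsKernel d g) {p : ℝ} (hp : 2 < p)
    {φ₀ : E d → ℂ} (hφ₀ : φ₀ ∈ charFcts d) {B₀ : Matrix (Fin d) (Fin d) ℝ}
    (hB₀ : B₀.transpose = B₀) (hB₀n : ∀ k : E d, 0 ≤ qf B₀ k) {C₁ : ℝ} (hC₁ : 0 ≤ C₁)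
    (hφB : ∀ k, ‖φ₀ k - 1 + (1 / 2 : ℂ) * (qf B₀ k : ℂ)‖ ≤ C₁ * ‖k‖ ^ min p 4) {θ : ℝ}
    (hθ1 : θ ≤ (min p 4 - 2) / 16 * kernelQ d g) (hθ2 : θ ≤ gap d (kernelQ d g) / 2) :
    ∃ C : ℝ, 0 < C ∧ ∀ (A : Matrix (Fin d) (Fin d) ℝ) (β : ℝ) (N N' : Matrix (Fin d) (Fin d) ℝ)
      (Ψ : E d → ℂ), SpectralData A (kernelQ d g) β N N' → Ψ ∈ Fclass (min p 4) N →
      IsStationary g A β Ψ → min p 4 * (‖act A‖ + |β|) ≤ (min p 4 - 2) / 16 * kernelQ d g →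
      ‖act A‖ + |β| ≤ gap d (kernelQ d g) / 8 →
      ∃ lam : ℝ, 0 ≤ lam ∧ ∀ φ : ℝ → E d → ℂ, IsMildSolution g A β φ₀ φ →
        ∀ t : ℝ, 0 ≤ t → ∀ k : E d,
          ‖φ t k - Ψ (lam • k)‖ ≤ C * Real.exp (-θ * t) * (‖k‖ ^ 2 + ‖k‖ ^ p) := by
  have hr2 : 2 < min p 4 := lt_min hp (by norm_num)
  have hr4 : min p 4 ≤ 4 := min_le_right _ _
  set r := min p 4 with hr
  have hq := kernelQ_pos hd hg
  have hq1 := kernelQ_le_one hd hg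
  set μ := (r - 2) / 16 * kernelQ d g with hμ
  have hμ0 : 0 < μ := mul_pos (by linarith) hq
  have hμ1 : μ ≤ 1 / 8 := by nlinarith
  set c := gap d (kernelQ d g) with hc
  set b := ‖matVec B₀‖ with hb
  have hb0 : 0 ≤ b := norm_nonneg _
  obtain ⟨K, hK0, hK⟩ := exists_isStationary hd hg hr2 hr4 (M := √d) (Real.sqrt_nonneg _)
  set L := √(8 * b) ^ r with hL
  have hL0 : 0 ≤ L := by positivity
  set MD := b + 8 * b * √d with hMD
  have hMD0 : 0 ≤ MD := by positivity
  set H₁ := C₁ + b + 2 with hH₁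
  set H₂ := K * L + 8 * b * √d + 2 with hH₂
  set S := MD * (2 + H₁ + H₂) with hS
  have hS0 : 0 ≤ S := by positivity
  -- the summand `S / (2 μ)` lets the contraction of `Γ` absorb the cross terms
  set H := C₁ + K * L + S / (2 * μ) with hH
  have hH0 : 0 ≤ H := by positivity
  have hHS : S ≤ 2 * μ * H := by
    have : 2 * μ * (S / (2 * μ)) = S := by field_simp
    rw [hH, mul_add, this]
    have : 0 ≤ 2 * μ * (C₁ + K * L) := by positivity
    linarith
  have hH₁0 : 0 ≤ H₁ := by positivity
  have hH₂0 : 0 ≤ H₂ := by positivity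
  clear_value H S H₂ H₁ MD L b c μ r
  refine ⟨H + MD + 1, by positivity, fun A β N N' Ψ h hΨ hΨs hε hεc => ?_⟩
  set ε := ‖act A‖ + |β| with hεdef
  have hε0 : 0 ≤ ε := by positivity
  -- `D` decays at a rate at least `3c/4`, while `|φ - 1| / |k|²` grows at a rate at most `2ε ≤ c/4`;
  -- hence the cross terms in the estimate for `Γ` decay at a rate at least `c/2`
  have hβε : |β| ≤ ε := le_add_of_nonneg_left (norm_nonneg _)
  have h2ε : 2 * ε ≤ 1 := by linarith [mul_le_mul_of_nonneg_right hr2.le hε0]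
  -- the profile has the uniform remainder estimate
  have hΨK : ∀ k, ‖Ψ k - 1 + (1 / 2 : ℂ) * (qf N k : ℂ)‖ ≤ K * ‖k‖ ^ r := by
    obtain ⟨Ψ', hΨ', hΨs', hΨK'⟩ := hK A β N (hε.trans_eq hμ) h.eig h.posSemidef h.qf_le
    obtain rfl : Ψ = Ψ' := IsStationary.eq_of_mem_Fclass hd hg hr2 hr4 (hε.trans_eq hμ) hΨs hΨs' hΨ
      (mem_Fclass_iff.2 ⟨hΨ', K, hΨK'⟩)
    exact hΨK'
  have hNN : 0 < frob N' N := lt_of_lt_of_le (by norm_num) h.pairing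
  set l := frob N' B₀ / frob N' N with hl
  have hl0 : 0 ≤ l := div_nonneg (h.nonneg B₀ hB₀ hB₀n) hNN.le
  have hl8 : l ≤ 8 * b := by
    rw [hl, div_le_iff₀ hNN]
    have h1 : frob N' B₀ ≤ 2 * b :=
      hb ▸ (real_inner_le_norm _ _).trans (mul_le_mul_of_nonneg_right h.norm_left (norm_nonneg _))
    nlinarith [h.pairing]
  have hsq : √l ^ 2 = l := Real.sq_sqrt hl0
  have hN1 : ‖matVec N‖ = √d := by
    rw [← Real.sqrt_sq (norm_nonneg (matVec N)), norm_matVec_sq, h.norm_sq]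
  set D₀ := B₀ + (-l) • N with hD₀
  have hD₀N : frob N' D₀ = 0 := by
    rw [hD₀, frob_add_right, frob_smul_right, hl]
    field_simp
    ring
  have hD₀M : ‖matVec D₀‖ ≤ MD := by
    rw [hD₀, map_add, map_smul]
    refine (norm_add_le _ _).trans ?_
    rw [norm_smul, norm_neg, Real.norm_of_nonneg hl0, hN1, hMD, hb]
    rw [hb] at hl8
    gcongr
  obtain ⟨D, hD0, hD, hDdec⟩ := h.exists_isMomentFlow hd hD₀N
  rw [← hc] at hDdec
  have hDqf : ∀ t, 0 ≤ t → ∀ k : E d,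
      |qf (D t) k| ≤ MD * Real.exp (-(c + 2 * β) * t) * ‖k‖ ^ 2 := by
    intro t ht k
    refine (abs_qf_le _ _).trans (mul_le_mul_of_nonneg_right ((hDdec t ht).trans ?_) (sq_nonneg _))
    rw [mul_comm MD]
    exact mul_le_mul_of_nonneg_left hD₀M (Real.exp_pos _).le
  have hβ := abs_le.1 (hβε.trans hεc)
  have hrate : ∀ t, 0 ≤ t →
      Real.exp (-(c + 2 * β) * t) * Real.exp (2 * ε * t) ≤ Real.exp (-θ * t) := by
    intro t ht
    rw [← Real.exp_add, ← add_mul]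
    gcongr
    linarith
  have hrate' : ∀ t, 0 ≤ t → Real.exp (-(c + 2 * β) * t) ≤ Real.exp (-θ * t) := fun t ht =>
    (le_mul_of_one_le_right (Real.exp_pos _).le (Real.one_le_exp (by positivity))).trans
      (hrate t ht)
  set ψ : E d → ℂ := fun k => Ψ (√l • k) with hψdef
  have hψ : ψ ∈ charFcts d := comp_smul_mem_charFcts (mem_Fclass_iff.1 hΨ).1 _
  have hψs : IsStationary g A β ψ := hΨs.comp_smul hd hg (Real.sqrt_nonneg l)
  have hψL : ∀ k, ‖ψ k - 1 + (1 / 2 : ℂ) * (qf (l • N) k : ℂ)‖ ≤ K * L * ‖k‖ ^ r := by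
    intro k
    have h1 := hΨK (√l • k)
    rw [qf_smul_right, hsq, ← qf_smul, norm_smul, Real.norm_of_nonneg (Real.sqrt_nonneg l),
      Real.mul_rpow (Real.sqrt_nonneg l) (norm_nonneg _), ← mul_assoc] at h1
    have h2 : √l ^ r ≤ L := hL ▸ Real.rpow_le_rpow (Real.sqrt_nonneg l) (Real.sqrt_le_sqrt hl8) (by linarith : (0 : ℝ) ≤ r)
    refine h1.trans ?_
    gcongr
  have hψ2 : ∀ k, ‖ψ k - 1‖ ≤ H₂ * ‖k‖ ^ 2 :=
    hH₂ ▸ norm_sub_one_le_sq hψ hr2.le (by positivity) (by positivity) hψL fun k => by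
      refine (abs_qf_le _ _).trans ?_
      rw [map_smul, norm_smul, Real.norm_of_nonneg hl0, hN1]
      gcongr
  have hφ2 : ∀ k, ‖φ₀ k - 1‖ ≤ H₁ * ‖k‖ ^ 2 :=
    hH₁ ▸ norm_sub_one_le_sq hφ₀ hr2.le hC₁ hb0 hφB (hb ▸ abs_qf_le B₀)
  refine ⟨√l, Real.sqrt_nonneg l, fun φ hφ t ht k => ?_⟩
  have hDM : ∀ t, 0 ≤ t → ∀ k : E d, |qf (D t) k| ≤ MD * ‖k‖ ^ 2 := fun t ht k => by
    refine (hDqf t ht k).trans (mul_le_mul_of_nonneg_right ?_ (sq_nonneg _))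
    exact mul_le_of_le_one_right hMD0 (Real.exp_le_one_iff.2
      (mul_nonpos_of_nonpos_of_nonneg (by linarith [hβ.1]) ht))
  have hDθ : ∀ t, 0 ≤ t → ∀ k : E d, |qf (D t) k| ≤ MD * Real.exp (-θ * t) * ‖k‖ ^ 2 :=
    fun t ht k => (hDqf t ht k).trans <| mul_le_mul_of_nonneg_right
      (mul_le_mul_of_nonneg_left (hrate' t ht) hMD0) (sq_nonneg _)
  clear_value l D₀
  have hmain := hφ.norm_sub_le hd hg hψ hψs hD hr2.le hr4 hMD0 hS0 hH0 hDM (θ := θ)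
    (fun k => by
      have h1 : φ₀ k - ψ k + (1 / 2 : ℂ) * (qf (D 0) k : ℂ)
          = (φ₀ k - 1 + (1 / 2 : ℂ) * (qf B₀ k : ℂ))
            - (ψ k - 1 + (1 / 2 : ℂ) * (qf (l • N) k : ℂ)) := by
        rw [hD0, hD₀, qf_add, qf_smul, qf_smul]; push_cast; ring
      rw [h1]
      refine (norm_sub_le _ _).trans ((add_le_add (hφB k) (hψL k)).trans ?_)
      rw [← add_mul]
      gcongr
      rw [hH]
      exact le_add_of_nonneg_right (by positivity))
    (fun t ht u v => by
      have h1 := norm_sub_one_le_rpow (hφ.mem t ht) (a := r - 2) (k := v)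
        (h := H₁ * Real.exp (2 * ε * t)) (by positivity) (by linarith) (by linarith)
        (hφ.norm_sub_one_le hd hg hH₁0 hφ2 h2ε ht v)
      have h2 : 2 + H₁ * Real.exp (2 * ε * t) ≤ (2 + H₁) * Real.exp (2 * ε * t) := by
        have : 1 ≤ Real.exp (2 * ε * t) := Real.one_le_exp (by positivity)
        linarith
      calc _ ≤ (MD * Real.exp (-(c + 2 * β) * t) * ‖u‖ ^ 2)
            * ((2 + H₁) * Real.exp (2 * ε * t) * ‖v‖ ^ (r - 2)) :=
            mul_le_mul (hDqf t ht u) (h1.trans (mul_le_mul_of_nonneg_right h2 (by positivity)))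
              (norm_nonneg _) (by positivity)
        _ = MD * (2 + H₁) * (Real.exp (-(c + 2 * β) * t) * Real.exp (2 * ε * t))
            * (‖u‖ ^ 2 * ‖v‖ ^ (r - 2)) := by ring
        _ ≤ S * Real.exp (-θ * t) * (‖u‖ ^ 2 * ‖v‖ ^ (r - 2)) := by
            gcongr ?_ * ?_ * _
            · rw [hS]
              exact mul_le_mul_of_nonneg_left (by linarith) hMD0
            · exact hrate t ht)
    (fun t ht u v => by
      have h1 := norm_sub_one_le_rpow hψ (a := r - 2) (h := H₂) hH₂0 (by linarith)
        (by linarith) (hψ2 v)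
      calc _ ≤ (MD * Real.exp (-θ * t) * ‖u‖ ^ 2) * ((2 + H₂) * ‖v‖ ^ (r - 2)) :=
            mul_le_mul (hDθ t ht u) h1 (norm_nonneg _) (by positivity)
        _ = MD * (2 + H₂) * Real.exp (-θ * t) * (‖u‖ ^ 2 * ‖v‖ ^ (r - 2)) := by ring
        _ ≤ S * Real.exp (-θ * t) * (‖u‖ ^ 2 * ‖v‖ ^ (r - 2)) := by
            gcongr ?_ * _ * _
            rw [hS]; gcongr; linarith)
    h2ε (by linarith) (by
      have h1 : 2 * μ * H ≤ (1 - r * ε - θ - (1 - 4 * μ)) * H := by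
        gcongr; linarith
      have h2 : (r - 2) / 4 * kernelQ d g = 4 * μ := by rw [hμ]; ring
      rw [h2]
      linarith) ht k
  have hk : ‖k‖ ^ r ≤ ‖k‖ ^ 2 + ‖k‖ ^ p := hr ▸ rpow_min_four_le (norm_nonneg _) hp
  have hkp : 0 ≤ ‖k‖ ^ p := by positivity
  have h1 : φ t k - Ψ (√l • k) = (φ t k - ψ k + (1 / 2 : ℂ) * (qf (D t) k : ℂ))
      - (1 / 2 : ℂ) * (qf (D t) k : ℂ) := by simp only [hψdef]; ring
  have h2 : ‖(1 / 2 : ℂ) * (qf (D t) k : ℂ)‖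
      ≤ MD * Real.exp (-θ * t) * (‖k‖ ^ 2 + ‖k‖ ^ p) := by
    rw [norm_mul, Complex.norm_real, Real.norm_eq_abs]
    have h3 : ‖(1 / 2 : ℂ)‖ = 1 / 2 := by norm_num
    have h4 : MD * Real.exp (-θ * t) * ‖k‖ ^ 2 ≤ MD * Real.exp (-θ * t) * (‖k‖ ^ 2 + ‖k‖ ^ p) :=
      mul_le_mul_of_nonneg_left (by linarith) (by positivity)
    rw [h3]
    linarith [hDθ t ht k, abs_nonneg (qf (D t) k)]
  have h5 : H * Real.exp (-θ * t) * ‖k‖ ^ r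
      ≤ H * Real.exp (-θ * t) * (‖k‖ ^ 2 + ‖k‖ ^ p) :=
    mul_le_mul_of_nonneg_left hk (by positivity)
  have h6 : 0 ≤ Real.exp (-θ * t) * (‖k‖ ^ 2 + ‖k‖ ^ p) := by positivity
  rw [h1]
  refine (norm_sub_le _ _).trans ((add_le_add hmain h2).trans ?_)
  linarith

end MaxwellFourier

end

theorem mainTheorem4 (d : ℕ) (hd : 2 ≤ d) (p : ℝ) (hp : 2 < p) (q : ℝ) :
    ∃ θ : ℝ, 0 < θ ∧
      ∀ g : ℝ → ℝ, MaxwellFourier.IsKernel d g → MaxwellFourier.kernelQ d g = q →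
        ∃ ε₀ : ℝ, 0 < ε₀ ∧
          (∀ A : Matrix (Fin d) (Fin d) ℝ, ‖MaxwellFourier.act A‖ ≤ ε₀ →
            ∃! x : ℝ × Matrix (Fin d) (Fin d) ℝ × (MaxwellFourier.E d → ℂ),
              MaxwellFourier.IsProfile g p A x.1 x.2.1 x.2.2) ∧
          (∀ φ₀ ∈ MaxwellFourier.charFcts d,
            ∀ (c : Fin d → Fin d → ℂ) (C₀ : ℝ), 0 < C₀ →
            (∀ k : MaxwellFourier.E d,
              ‖φ₀ k - (1 + ∑ j, ∑ l, c j l * (k j : ℂ) * (k l : ℂ))‖ ≤ C₀ * ‖k‖ ^ p) →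
            ∃ C : ℝ, 0 < C ∧
              ∀ A : Matrix (Fin d) (Fin d) ℝ, ‖MaxwellFourier.act A‖ ≤ ε₀ →
              ∀ (β : ℝ) (N : Matrix (Fin d) (Fin d) ℝ) (Ψ : MaxwellFourier.E d → ℂ),
                MaxwellFourier.IsProfile g p A β N Ψ →
                ∃ lam : ℝ, 0 ≤ lam ∧
                  ∀ φ : ℝ → MaxwellFourier.E d → ℂ,
                    MaxwellFourier.IsMildSolution g A β φ₀ φ →
                    ∀ t : ℝ, 0 ≤ t → ∀ k : MaxwellFourier.E d,
                      ‖φ t k - Ψ (lam • k)‖ ≤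
                        C * Real.exp (-θ * t) * (‖k‖ ^ 2 + ‖k‖ ^ p)) := by
  have hr2 : 2 < min p 4 := lt_min hp (by norm_num)
  have hr4 : min p 4 ≤ 4 := min_le_right _ _
  have hd2 : (2 : ℝ) ≤ d := by exact_mod_cast hd
  rcases le_or_gt q 0 with hq | hq
  · -- no kernel has `q ≤ 0`
    refine ⟨1, one_pos, fun g hg hgq => ?_⟩
    exact absurd (MaxwellFourier.kernelQ_pos hd hg) (by linarith)
  have hμ : 0 < (min p 4 - 2) / 16 * q := mul_pos (by linarith) hq
  have hgap : 0 < MaxwellFourier.gap d q :=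
    div_pos (mul_pos hq (by linarith)) (by linarith)
  -- a quarter of the distance of the contraction factor of `Γ` from `1`, and a quarter of the rate
  -- `2c` at which the second moments relax when `A = 0`
  refine ⟨min ((min p 4 - 2) / 16 * q) (MaxwellFourier.gap d q / 2), by positivity,
    fun g hg hgq => ?_⟩
  subst hgq
  obtain ⟨ε₀, hε₀, hA⟩ := MaxwellFourier.exists_spectralData_of_pos hd hq
    (show 0 < min ((min p 4 - 2) / 16 * MaxwellFourier.kernelQ d g / 4)
      (MaxwellFourier.gap d (MaxwellFourier.kernelQ d g) / 8) by positivity)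
  have hε : ∀ x : ℝ, 0 ≤ x → x ≤ (min p 4 - 2) / 16 * MaxwellFourier.kernelQ d g / 4 →
      min p 4 * x ≤ (min p 4 - 2) / 16 * MaxwellFourier.kernelQ d g := fun x hx0 hx => by
    have := mul_le_mul_of_nonneg_right hr4 hx0
    linarith
  refine ⟨ε₀, hε₀, fun A hAε => ?_, fun φ₀ hφ₀ c C₀ hC₀ hφc => ?_⟩
  · obtain ⟨β, N, N', hη, h⟩ := hA A hAε
    exact h.existsUnique_isProfile hd hg hp
      (hε _ (by positivity) (hη.trans (min_le_left _ _)))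
  · obtain ⟨B₀, hB₀, hB₀n, hφB⟩ := MaxwellFourier.exists_secondMoment hφ₀ hp hφc
    obtain ⟨C, hC, hconv⟩ := MaxwellFourier.exists_norm_sub_le hd hg hp hφ₀ hB₀ hB₀n
      (by positivity) (MaxwellFourier.norm_remainder_le_of_le hφ₀ hr2.le (min_le_left p 4) hC₀.le
        hφB) (min_le_left _ _) (min_le_right _ _)
    refine ⟨C, hC, fun A hAε β N Ψ hΨ => ?_⟩
    obtain ⟨β', N₀, N', hη, h⟩ := hA A hAε
    obtain ⟨rfl, rfl⟩ := MaxwellFourier.IsProfile.eq_of_spectralData hd h hΨ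
    exact hconv A β N N' Ψ h hΨ.mem hΨ.stationary
      (hε _ (by positivity) (hη.trans (min_le_left _ _))) (hη.trans (min_le_right _ _))
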